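/- Let $n\ge 2$ and $\mathbb R^n_+=\{(x,t):x\in\mathbb R^{n-1},\,t>0\}$. Let $A:\mathbb R^n_+\to\mathbb R^{n\times n}$ be measurable and uniformly elliptic: for some $C_0>0$, $|A(X)\xi\cdot\zeta|\le C_0|\xi||\zeta|$ and $A(X)\xi\cdot\xi\ge C_0^{-1}|\xi|^2$ for all $X\in\mathbb R^n_+$, $\xi,\zeta\in\mathbb R^n$. Write $f\in CM$ if $$\sup_{z\in\mathbb R^{n-1},\,r>0}\frac1{|B(z,r)|}\int_{B(z,r)}\int_0^r|f(x,t)|^2\,\frac{dt}{t}\,dx<\infty,$$ where $B(z,r)$ is the ball in $\mathbb R^{n-1}$. Assume that $L=-\operatorname{div}A\nabla$ is a weak-DKP operator, that is, $f_L^{1/2}\in CM$, where $$f_L(x,t)=\inf_{A_0\in\mathbb R^{n\times n}}\frac1{|B(x,2t)|}\int_{B(x,2t)}\int_t^{2t}|A(y,s)-A_0|^2\,\frac{ds}{s}\,dy .$$ Then there is a map $\rho:\overline{\mathbb R^n_+}\to\overline{\mathbb R^n_+}$, bi-Lipschitz onto its image and mapping $\mathbb R^n_+$ bijectively onto itself,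 such that: (a) $\rho(x,0)=(x,0)$ for every $x\in\mathbb R^{n-1}$; (b) let $J=(\partial_j\rho_i)_{i,j}$ be the Jacobian matrix of $\rho$ and let $A_\rho=|\det J|\,J^{-1}(A\circ\rho)J^{-T}$ be the matrix of the conjugate operator $L_\rho=-\operatorname{div}A_\rho\nabla$. Then $A_\rho$ is measurable and uniformly elliptic on $\mathbb R^n_+$; for every weak solution $u\in W^{1,2}_{loc}(\mathbb R^n_+)$ of $Lu=0$, the function $u\circ\rho\in W^{1,2}_{loc}(\mathbb R^n_+)$ is a weak solution of $L_\rho(u\circ\rho)=0$; and on $\mathbb R^n_+$ $$A_\rho=\begin{bmatrix}B_{\rho,\|}&\mathbf b_\rho\\0&1\end{bmatrix}+C_\rho ,$$ where $B_{\rho,\|}:\mathbb R^n_+\to\mathbb R^{(n-1)\times(n-1)}$ and $\mathbf b_\rho:\mathbb R^n_+\to\mathbb R^{n-1}$ are continuously differentiable, and $|t\nabla B_{\rho,\|}|+|t\nabla\mathbf b_\rho|+|C_\rho|\in CM$. -/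

import Mathlib

open MeasureTheory Set
open scoped ENNReal ContDiff

noncomputable section

namespace WeakDKP

/-- Points `(x, t)` of `ℝⁿ = ℝⁿ⁻¹ × ℝ`, with `n = d + 1`. The boundary variable `x` carries the
Euclidean norm. -/
abbrev Pt (d : ℕ) : Type := EuclideanSpace ℝ (Fin d) × ℝ

/-- Index set of the `n = d + 1` coordinates: `Sum.inl i` is the `i`-th tangential coordinate,
`Sum.inr ()` is the normal coordinate `t`. -/
abbrev Idx (d : ℕ) : Type := Fin d ⊕ Unit

/-- Real `n × n` matrices. -/
abbrev Mat (d : ℕ) : Type := Matrix (Idx d) (Idx d) ℝ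

/-- The open upper half-space. -/
def halfSpace (d : ℕ) : Set (Pt d) := {X | 0 < X.2}

/-- The closed upper half-space. -/
def closedHalfSpace (d : ℕ) : Set (Pt d) := {X | 0 ≤ X.2}

/-- The canonical basis of `ℝⁿ⁻¹ × ℝ`. -/
def stdBasis (d : ℕ) : Module.Basis (Idx d) ℝ (Pt d) :=
  (EuclideanSpace.basisFun (Fin d) ℝ).toBasis.prod (Module.Basis.singleton Unit ℝ)

/-- The Euclidean length of a coordinate vector. -/
def euclNorm {ι : Type*} [Fintype ι] (ξ : ι → ℝ) : ℝ := Real.sqrt (∑ i, ξ i ^ 2)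

/-- The Hilbert-Schmidt norm of a matrix. -/
def matNorm {ι κ : Type*} [Fintype ι] [Fintype κ] (M : Matrix ι κ ℝ) : ℝ :=
  Real.sqrt (∑ i, ∑ j, M i j ^ 2)

/-- The gradient of a scalar function, in coordinates. -/
def grad {d : ℕ} (f : Pt d → ℝ) (X : Pt d) : Idx d → ℝ :=
  fun i => fderiv ℝ f X (stdBasis d i)

/-- `|∇B|(X)` for a matrix-valued function `B`. -/
def matGradNorm {d : ℕ} {ι κ : Type*} [Fintype ι] [Fintype κ]
    (B : Pt d → Matrix ι κ ℝ) (X : Pt d) : ℝ :=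
  Real.sqrt (∑ i, ∑ j, euclNorm (grad (fun Y => B Y i j) X) ^ 2)

/-- `|∇b|(X)` for a vector-valued function `b`. -/
def vecGradNorm {d : ℕ} {ι : Type*} [Fintype ι] (b : Pt d → ι → ℝ) (X : Pt d) : ℝ :=
  Real.sqrt (∑ i, euclNorm (grad (fun Y => b Y i) X) ^ 2)

/-- `L = -div A ∇` is uniformly elliptic on the upper half-space: `A` is measurable, bounded and
coercive there. -/
def UniformlyElliptic {d : ℕ} (A : Pt d → Mat d) : Prop :=
  (∀ i j, AEMeasurable (fun X => A X i j) (volume.restrict (halfSpace d))) ∧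
  ∃ C : ℝ, 0 < C ∧ ∀ X ∈ halfSpace d,
    (∀ ξ ζ : Idx d → ℝ, |(A X).mulVec ξ ⬝ᵥ ζ| ≤ C * euclNorm ξ * euclNorm ζ) ∧
    (∀ ξ : Idx d → ℝ, C⁻¹ * euclNorm ξ ^ 2 ≤ (A X).mulVec ξ ⬝ᵥ ξ)

/-- `g(x,t) dx dt / t` is a Carleson measure with constant `K`: for all `z ∈ ℝⁿ⁻¹` and `r > 0`,
`⨍_{B(z,r)} ∫_0^r g(x,t) dt/t dx ≤ K`. -/
def IsCarlesonDensity {d : ℕ} (g : Pt d → ℝ≥0∞) (K : ℝ≥0∞) : Prop :=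
  ∀ (z : EuclideanSpace ℝ (Fin d)) (r : ℝ), 0 < r →
    (volume (Metric.ball z r))⁻¹ *
      ∫⁻ X in Metric.ball z r ×ˢ Ioo (0 : ℝ) r, g X / ENNReal.ofReal X.2 ≤ K

/-- `f ∈ CM(M)`: the measure `f² dx dt / t` is a Carleson measure with constant `M²`. -/
def InCMWith {d : ℕ} (f : Pt d → ℝ) (M : ℝ) : Prop :=
  IsCarlesonDensity (fun X => ENNReal.ofReal (f X ^ 2)) (ENNReal.ofReal (M ^ 2))

/-- `f ∈ CM`. -/
def InCM {d : ℕ} (f : Pt d → ℝ) : Prop := ∃ M : ℝ, 0 < M ∧ InCMWith f M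

/-- The squared `L²` oscillation of `A` on the Whitney region `B(x,2t) × (t,2t)`:
`inf_{A₀ constant} ⨍_{B(x,2t)} ∫_t^{2t} |A(y,s) - A₀|² ds/s dy`. -/
def whitneyOsc {d : ℕ} (A : Pt d → Mat d) (X : Pt d) : ℝ≥0∞ :=
  ⨅ A₀ : Mat d, (volume (Metric.ball X.1 (2 * X.2)))⁻¹ *
    ∫⁻ Y in Metric.ball X.1 (2 * X.2) ×ˢ Ioo X.2 (2 * X.2),
      ENNReal.ofReal (matNorm (A Y - A₀) ^ 2) / ENNReal.ofReal Y.2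

/-- `L = -div A ∇` is a weak-DKP operator. -/
def IsWeakDKP {d : ℕ} (A : Pt d → Mat d) : Prop :=
  UniformlyElliptic A ∧
    ∃ M : ℝ, 0 < M ∧ IsCarlesonDensity (whitneyOsc A) (ENNReal.ofReal (M ^ 2))

/-- Smooth functions with compact support in the open upper half-space. -/
def IsTest {d : ℕ} (φ : Pt d → ℝ) : Prop :=
  ContDiff ℝ ∞ φ ∧ HasCompactSupport φ ∧ tsupport φ ⊆ halfSpace d

/-- `f ∈ L²_loc` of the open upper half-space. -/
def InL2loc {d : ℕ} (f : Pt d → ℝ) : Prop :=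
  ∀ K : Set (Pt d), IsCompact K → K ⊆ halfSpace d → MemLp f 2 (volume.restrict K)

/-- `g` is the distributional gradient of `u` in the open upper half-space. -/
def IsWeakGradient {d : ℕ} (u : Pt d → ℝ) (g : Pt d → Idx d → ℝ) : Prop :=
  ∀ φ : Pt d → ℝ, IsTest φ → ∀ i,
    ∫ X in halfSpace d, u X * grad φ X i = -∫ X in halfSpace d, g X i * φ X

/-- `u ∈ W^{1,2}_loc` is a weak solution of `-div A ∇u = 0` in the upper half-space. -/
def IsWeakSolution {d : ℕ} (A : Pt d → Mat d) (u : Pt d → ℝ) : Prop :=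
  InL2loc u ∧ ∃ g : Pt d → Idx d → ℝ,
    (∀ i, InL2loc (fun X => g X i)) ∧ IsWeakGradient u g ∧
    ∀ v : Pt d → ℝ, IsTest v →
      ∫ X in halfSpace d, (A X).mulVec (g X) ⬝ᵥ grad v X = 0

/-- `ρ` is a bi-Lipschitz change of variable of the upper half-space onto itself, given together
with its bi-Lipschitz extension to the boundary. -/
def IsBiLipschitzChange {d : ℕ} (ρ : Pt d → Pt d) : Prop :=
  BijOn ρ (halfSpace d) (halfSpace d) ∧
  ∃ K : ℝ, 0 < K ∧ ∀ X ∈ closedHalfSpace d, ∀ Y ∈ closedHalfSpace d,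
    K⁻¹ * dist X Y ≤ dist (ρ X) (ρ Y) ∧ dist (ρ X) (ρ Y) ≤ K * dist X Y

/-- The Jacobian matrix `(∂_j ρ_i)` of `ρ`. -/
def jacobian {d : ℕ} (ρ : Pt d → Pt d) (X : Pt d) : Mat d :=
  LinearMap.toMatrix (stdBasis d) (stdBasis d) (fderiv ℝ ρ X : Pt d →ₗ[ℝ] Pt d)

/-- The matrix of the conjugate operator: `A_ρ = |det J| J⁻¹ (A ∘ ρ) J⁻ᵀ`, `J` the Jacobian matrix
of `ρ`. -/
def conjugate {d : ℕ} (A : Pt d → Mat d) (ρ : Pt d → Pt d) (X : Pt d) : Mat d :=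
  |(jacobian ρ X).det| •
    ((jacobian ρ X)⁻¹ * A (ρ X) * ((jacobian ρ X)⁻¹).transpose)

end WeakDKP

end

noncomputable section

namespace WeakDKP

open Topology Filter

/-! The half-space is treated as the affine group: for X = (x, t) and g = (w, b), `act X g` = (x + t
w, t b). The measure dx dt / t (`nu`) is invariant under X ↦ `act X g`, while g ↦ `act X g` dilates
Lebesgue measure by t^(d+1). In these terms the weak-DKP condition says that the increments a(X) -
a(`act X g`) of each entry are square Carleson on average over g near the identity (0, 1). An
increment by a product is a sum of two increments, and `nu` is invariant, so the set of g near which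
such a bound holds is open and stable under products. It is therefore the whole half-space
(`oscBoundAt_one`, `OscBoundAt.act`, `oscBoundAt_of_one`), and compact sets of translations far from
the identity are allowed.

This is why no smallness of the Carleson norm is needed. Averaging the entries against a kernel κ
(`smoothing`) gives smooth coefficients, and t∂ of them is an average against `kerDeriv κ`. That
kernel has integral zero, so t∇ is controlled by increments and is Carleson. Its L¹ norm, which
controls t∇ pointwise, becomes as small as desired when κ is spread over many dyadic scales
(`exists_kernel`), at the price of a support far from (0, 1).

Let v and h be the smoothed tangential and normal entries of the last row, and ρ(x,t) = (x + t v, t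
h). Since t∇v and t∇h are small, ρ is a small perturbation of a triangular map with diagonal bounded
below, hence bi-Lipschitz and onto (`IsSlow.isBiLipschitzChange`); it fixes the boundary because of
the factor t. Up to the errors t∇v, t∇h, its Jacobian is the matrix S with columns (1, 0) and (v,
h). For the smoothed matrix P one has S · `reduced P` · Sᵀ = h P and det S = h, so conjugation by S
turns P into a matrix with last row (0, 1) (`shearMat_mul_reduced`).

The remaining error A∘ρ - P is again an increment, since ρ(X) = `act X u` with u in a compact set
(`IsSlow.carlesonFinite_errOsc`); `exists_conj_sub_reduced_le` makes the conjugation stable under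
all these errors. Weak solutions are transported by a smooth change of variables, with test
functions given by the Piola transform (`IsDiffeo.sum_grad_piola`). -/

instance instIsAddHaarMeasurePt (d : ℕ) : (volume : Measure (Pt d)).IsAddHaarMeasure :=
  Measure.prod.instIsAddHaarMeasure _ _

theorem lintegral_homothety {E : Type*} [NormedAddCommGroup E] [NormedSpace ℝ E]
    [FiniteDimensional ℝ E] [MeasurableSpace E] [BorelSpace E] (μ : Measure E)
    [μ.IsAddHaarMeasure] (p : E) {t : ℝ} (ht : 0 < t) (F : E → ℝ≥0∞) :
    ∫⁻ g, F (p + t • g) ∂μ =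
      ENNReal.ofReal ((t ^ Module.finrank ℝ E)⁻¹) * ∫⁻ g, F g ∂μ := by
  have h1 : MeasurableEmbedding (fun x : E => t • x) :=
    (Homeomorph.smulOfNeZero t ht.ne').measurableEmbedding
  have h2 := h1.lintegral_map (μ := μ) (fun x => F (p + x))
  rw [← h2, Measure.map_addHaar_smul μ ht.ne', lintegral_smul_measure,
    lintegral_add_left_eq_self (μ := μ) F p, abs_of_pos (by positivity)]
  rfl

theorem finrank_pt (d : ℕ) : Module.finrank ℝ (Pt d) = d + 1 := by
  simp [Pt]

theorem isOpen_halfSpace (d : ℕ) : IsOpen (halfSpace d) :=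
  isOpen_lt continuous_const continuous_snd

theorem measurableSet_halfSpace (d : ℕ) : MeasurableSet (halfSpace d) :=
  (isOpen_halfSpace d).measurableSet

/-! ### The affine group and its invariant measure -/

/-- The right action of the affine group, identified with the half-space, on `ℝⁿ⁻¹ × ℝ`. -/
def act {d : ℕ} (X g : Pt d) : Pt d := (X.1 + X.2 • g.1, X.2 * g.2)

theorem act_eq {d : ℕ} (X g : Pt d) : act X g = (X.1, 0) + X.2 • g := by
  ext <;> simp [act]

theorem act_assoc {d : ℕ} (X g h : Pt d) : act (act X g) h = act X (act g h) := by
  ext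
  · simp [act, smul_smul]; ring
  · simp [act, mul_assoc]

theorem continuous_act {d : ℕ} : Continuous (fun p : Pt d × Pt d => act p.1 p.2) := by
  unfold act; fun_prop

theorem measurable_act {d : ℕ} : Measurable (fun p : Pt d × Pt d => act p.1 p.2) :=
  continuous_act.measurable

theorem act_mem {d : ℕ} {X g : Pt d} (hX : X ∈ halfSpace d) (hg : g ∈ halfSpace d) :
    act X g ∈ halfSpace d := mul_pos (show 0 < X.2 from hX) (show 0 < g.2 from hg)

/-- Division in the affine group: `act g (ldiv g h) = h`. -/
def ldiv {d : ℕ} (g h : Pt d) : Pt d := (g.2⁻¹ • (h.1 - g.1), g.2⁻¹ * h.2)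

theorem act_ldiv {d : ℕ} {g : Pt d} (hg : g ∈ halfSpace d) (h : Pt d) : act g (ldiv g h) = h := by
  have : g.2 ≠ 0 := ne_of_gt hg
  ext <;> simp [act, ldiv, smul_smul, this]

theorem ldiv_act {d : ℕ} {g : Pt d} (hg : g ∈ halfSpace d) (h : Pt d) : ldiv g (act g h) = h := by
  have : g.2 ≠ 0 := ne_of_gt hg
  ext <;> simp [act, ldiv, smul_smul, this]

theorem lintegral_act_left {d : ℕ} {X : Pt d} (hX : X ∈ halfSpace d) (F : Pt d → ℝ≥0∞) :
    ∫⁻ g, F (act X g) = ENNReal.ofReal ((X.2 ^ (d + 1))⁻¹) * ∫⁻ g, F g := by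
  have := lintegral_homothety (volume : Measure (Pt d)) (X.1, 0) hX F
  simpa only [act_eq, finrank_pt] using this

/-- At fixed height t the action translates x by t g.1, which costs nothing; only the dilation of t
by g.2 contributes a factor. -/
theorem lintegral_act_right {d : ℕ} {g : Pt d} (hg : g ∈ halfSpace d) {F : Pt d → ℝ≥0∞}
    (hF : Measurable F) :
    ∫⁻ X, F (act X g) = ENNReal.ofReal (g.2⁻¹) * ∫⁻ X, F X := by
  have hm : Measurable fun X => F (act X g) :=
    hF.comp (measurable_act.comp (measurable_id.prodMk measurable_const))
  rw [Measure.volume_eq_prod, lintegral_prod_symm _ hm.aemeasurable,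
    lintegral_prod_symm _ hF.aemeasurable]
  simp only [act]
  have h1 : ∀ t : ℝ, ∫⁻ x : EuclideanSpace ℝ (Fin d), F (x + t • g.1, t * g.2) =
      ∫⁻ x : EuclideanSpace ℝ (Fin d), F (x, t * g.2) := fun t =>
    lintegral_add_right_eq_self (fun x => F (x, t * g.2)) (t • g.1)
  simp only [h1]
  have h2 := lintegral_homothety (volume : Measure ℝ) 0 hg
    (fun t => ∫⁻ x : EuclideanSpace ℝ (Fin d), F (x, t))
  simpa [mul_comm] using h2

/-- The measure `dx dt / t` on the half-space. -/
def nu (d : ℕ) : Measure (Pt d) :=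
  (volume.restrict (halfSpace d)).withDensity (fun X => (ENNReal.ofReal X.2)⁻¹)

instance (d : ℕ) : SFinite (nu d) := by unfold nu; infer_instance

theorem lintegral_nu {d : ℕ} (F : Pt d → ℝ≥0∞) :
    ∫⁻ X, F X ∂(nu d) = ∫⁻ X in halfSpace d, F X / ENNReal.ofReal X.2 := by
  unfold nu
  rw [lintegral_withDensity_eq_lintegral_mul_non_measurable]
  · refine lintegral_congr fun X => ?_
    simp [div_eq_mul_inv, mul_comm]
  · fun_prop
  · filter_upwards [ae_restrict_mem (measurableSet_halfSpace d)] with X hX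
    simpa using (show 0 < X.2 from hX)

theorem setLIntegral_nu {d : ℕ} {S : Set (Pt d)} (hS : MeasurableSet S) (hSH : S ⊆ halfSpace d)
    (F : Pt d → ℝ≥0∞) :
    ∫⁻ X in S, F X ∂(nu d) = ∫⁻ X in S, F X / ENNReal.ofReal X.2 := by
  rw [← lintegral_indicator hS, lintegral_nu, ← lintegral_indicator (measurableSet_halfSpace d),
    ← lintegral_indicator hS]
  refine lintegral_congr fun X => ?_
  by_cases h : X ∈ S
  · simp [h, hSH h]
  · by_cases h' : X ∈ halfSpace d <;> simp [h, h']

/-- The factor 1 / g.2 coming from Lebesgue measure cancels against the density 1 / t taken at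
height t g.2. The Carleson measure dx dt / t is thus a Haar measure for this side of the group. -/
theorem measurePreserving_act {d : ℕ} {g : Pt d} (hg : g ∈ halfSpace d) :
    MeasurePreserving (fun X => act X g) (nu d) (nu d) := by
  have hm : Measurable fun X => act X g :=
    measurable_act.comp (measurable_id.prodMk measurable_const)
  refine ⟨hm, Measure.ext_of_lintegral _ fun F hF => ?_⟩
  rw [lintegral_map hF hm, lintegral_nu, lintegral_nu]
  have hG : Measurable ((halfSpace d).indicator fun X => F X / ENNReal.ofReal X.2) :=
    Measurable.indicator (by fun_prop) (measurableSet_halfSpace d)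
  have h1 := lintegral_act_right hg hG
  rw [lintegral_indicator (measurableSet_halfSpace d)] at h1
  have hg' : (0:ℝ) < g.2 := hg
  have hb0 : ENNReal.ofReal (g.2⁻¹) ≠ 0 := by
    simpa using hg'
  have hb1 : ENNReal.ofReal (g.2⁻¹) ≠ ⊤ := ENNReal.ofReal_ne_top
  rw [← ENNReal.mul_right_inj hb0 hb1, ← h1, ← lintegral_const_mul' _ _ hb1,
    ← lintegral_indicator (measurableSet_halfSpace d)]
  refine lintegral_congr fun X => ?_
  by_cases hX : X ∈ halfSpace d
  · have h2 : act X g ∈ halfSpace d := act_mem hX hg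
    have hX' : (0:ℝ) < X.2 := hX
    rw [indicator_of_mem hX, indicator_of_mem h2]
    simp only [act, div_eq_mul_inv]
    rw [ENNReal.ofReal_mul hX'.le, ENNReal.mul_inv (by simp) (by simp),
      ← ENNReal.ofReal_inv_of_pos hg']
    ring
  · have h2 : act X g ∉ halfSpace d := by
      intro h
      exact hX (pos_of_mul_pos_left h hg'.le)
    rw [indicator_of_notMem hX, indicator_of_notMem h2]

theorem ae_mem_halfSpace (d : ℕ) : ∀ᵐ X ∂(nu d), X ∈ halfSpace d :=
  (withDensity_absolutelyContinuous _ _).ae_le (ae_restrict_mem (measurableSet_halfSpace d))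

/-! ### Carleson measures -/

/-- The Carleson region above the ball `B(z,r)`. -/
def tent {d : ℕ} (z : EuclideanSpace ℝ (Fin d)) (r : ℝ) : Set (Pt d) :=
  Metric.ball z r ×ˢ Ioo (0 : ℝ) r

theorem measurableSet_tent {d : ℕ} (z : EuclideanSpace ℝ (Fin d)) (r : ℝ) :
    MeasurableSet (tent z r) := Metric.isOpen_ball.measurableSet.prod measurableSet_Ioo

theorem tent_subset {d : ℕ} (z : EuclideanSpace ℝ (Fin d)) (r : ℝ) : tent z r ⊆ halfSpace d :=
  fun _ hX => hX.2.1

theorem volume_ball_mul {d : ℕ} (z : EuclideanSpace ℝ (Fin d)) {c : ℝ} (hc : 0 < c) (r : ℝ) :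
    volume (Metric.ball z (c * r)) = ENNReal.ofReal (c ^ d) * volume (Metric.ball z r) := by
  rw [Measure.addHaar_ball_mul_of_pos _ _ hc, Measure.addHaar_ball_center _ z]
  simp

/-- `g dx dt / t` is a Carleson measure. -/
def CarlesonFinite {d : ℕ} (g : Pt d → ℝ≥0∞) : Prop :=
  ∃ K : ℝ≥0∞, K ≠ ⊤ ∧ ∀ (z : EuclideanSpace ℝ (Fin d)) (r : ℝ), 0 < r →
    ∫⁻ X in tent z r, g X ∂(nu d) ≤ K * volume (Metric.ball z r)

theorem volume_ball_ne {d : ℕ} (z : EuclideanSpace ℝ (Fin d)) {r : ℝ} (hr : 0 < r) :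
    volume (Metric.ball z r) ≠ 0 ∧ volume (Metric.ball z r) ≠ ⊤ :=
  ⟨(Metric.measure_ball_pos _ _ hr).ne', measure_ball_lt_top.ne⟩

theorem isCarlesonDensity_iff {d : ℕ} (g : Pt d → ℝ≥0∞) (K : ℝ≥0∞) :
    IsCarlesonDensity g K ↔ ∀ (z : EuclideanSpace ℝ (Fin d)) (r : ℝ), 0 < r →
      ∫⁻ X in tent z r, g X ∂(nu d) ≤ K * volume (Metric.ball z r) := by
  refine forall₃_congr fun z r hr => ?_
  rw [setLIntegral_nu (measurableSet_tent z r) (tent_subset z r), mul_comm,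
    ← div_eq_mul_inv]
  exact ENNReal.div_le_iff (volume_ball_ne z hr).1 (volume_ball_ne z hr).2

theorem CarlesonFinite.inCM {d : ℕ} {f : Pt d → ℝ}
    (h : CarlesonFinite fun X => ENNReal.ofReal (f X ^ 2)) : InCM f := by
  obtain ⟨K, hK, h⟩ := h
  refine ⟨K.toReal + 1, by positivity, (isCarlesonDensity_iff _ _).2 fun z r hr => ?_⟩
  refine (h z r hr).trans ?_
  gcongr
  refine (ENNReal.ofReal_toReal hK).symm.le.trans (ENNReal.ofReal_le_ofReal ?_)
  nlinarith [ENNReal.toReal_nonneg (a := K)]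

theorem CarlesonFinite.mono_ae {d : ℕ} {f g : Pt d → ℝ≥0∞} (hg : CarlesonFinite g)
    (h : ∀ᵐ X ∂(nu d), f X ≤ g X) : CarlesonFinite f := by
  obtain ⟨K, hK, hg⟩ := hg
  exact ⟨K, hK, fun z r hr => (lintegral_mono_ae (ae_restrict_of_ae h)).trans (hg z r hr)⟩

theorem CarlesonFinite.const_mul {d : ℕ} {g : Pt d → ℝ≥0∞} (hg : CarlesonFinite g) {c : ℝ≥0∞}
    (hc : c ≠ ⊤) : CarlesonFinite fun X => c * g X := by
  obtain ⟨K, hK, hg⟩ := hg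
  refine ⟨c * K, ENNReal.mul_ne_top hc hK, fun z r hr => ?_⟩
  rw [lintegral_const_mul' _ _ hc, mul_assoc]
  gcongr
  exact hg z r hr

theorem CarlesonFinite.finset_sum {d : ℕ} {ι : Type*} (s : Finset ι) {g : ι → Pt d → ℝ≥0∞}
    (hm : ∀ i, AEMeasurable (g i) (nu d)) (hg : ∀ i, CarlesonFinite (g i)) :
    CarlesonFinite fun X => ∑ i ∈ s, g i X := by
  choose K hK hg using hg
  refine ⟨∑ i ∈ s, K i, ENNReal.sum_ne_top.2 fun i _ => hK i, fun z r hr => ?_⟩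
  rw [lintegral_finsetSum' _ fun i _ => (hm i).restrict, Finset.sum_mul]
  exact Finset.sum_le_sum fun i _ => hg i z r hr

theorem setLIntegral_act_le {d : ℕ} {g : Pt d} (hg : g ∈ halfSpace d) {F : Pt d → ℝ≥0∞}
    (hF : Measurable F) {S S' : Set (Pt d)} (hS : MeasurableSet S) (hS' : MeasurableSet S')
    (h : ∀ X ∈ S, act X g ∈ S') :
    ∫⁻ X in S, F (act X g) ∂(nu d) ≤ ∫⁻ X in S', F X ∂(nu d) := by
  rw [← lintegral_indicator hS', ← (measurePreserving_act hg).lintegral_comp (hF.indicator hS'),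
    ← lintegral_indicator hS]
  refine lintegral_mono fun X => ?_
  by_cases hX : X ∈ S
  · simp [hX, h X hX]
  · simp [hX]

theorem setLIntegral_le_act {d : ℕ} {g : Pt d} (hg : g ∈ halfSpace d) {F : Pt d → ℝ≥0∞}
    (hF : Measurable F) {S S' : Set (Pt d)} (hS : MeasurableSet S) (hS' : MeasurableSet S')
    (h : ∀ X, act X g ∈ S → X ∈ S') :
    ∫⁻ X in S, F X ∂(nu d) ≤ ∫⁻ X in S', F (act X g) ∂(nu d) := by
  rw [← lintegral_indicator hS, ← (measurePreserving_act hg).lintegral_comp (hF.indicator hS),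
    ← lintegral_indicator hS']
  refine lintegral_mono fun X => ?_
  by_cases hX : act X g ∈ S
  · simp [hX, h X hX]
  · simp [hX]

theorem lintegral_eq_act_left {d : ℕ} {X : Pt d} (hX : X ∈ halfSpace d) (F : Pt d → ℝ≥0∞) :
    ∫⁻ g, F g = ENNReal.ofReal (X.2 ^ (d + 1)) * ∫⁻ g, F (act X g) := by
  have hX' : (0 : ℝ) < X.2 := hX
  rw [lintegral_act_left hX, ← mul_assoc, ← ENNReal.ofReal_mul (by positivity),
    mul_inv_cancel₀ (by positivity)]
  simp

/-! ### Propagation of increment bounds through the group -/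

/-- The squared increment of `a` between `X` and its translate by `g`. -/
def osc {d : ℕ} (a : Pt d → ℝ) (g X : Pt d) : ℝ≥0∞ := ENNReal.ofReal ((a X - a (act X g)) ^ 2)

theorem measurable_osc {d : ℕ} {a : Pt d → ℝ} (ha : Measurable a) :
    Measurable (fun p : Pt d × Pt d => osc a p.1 p.2) := by
  unfold osc
  have h1 : Measurable fun p : Pt d × Pt d => a (act p.2 p.1) :=
    ha.comp (measurable_act.comp measurable_swap)
  have h2 : Measurable fun p : Pt d × Pt d => a p.2 := ha.comp measurable_snd
  exact ((h2.sub h1).pow_const 2).ennreal_ofReal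

theorem ofReal_sq_sub_le (x y z : ℝ) : ENNReal.ofReal ((x - z) ^ 2) ≤
    2 * ENNReal.ofReal ((x - y) ^ 2) + 2 * ENNReal.ofReal ((y - z) ^ 2) := by
  rw [show (2 : ℝ≥0∞) = ENNReal.ofReal 2 by simp, ← ENNReal.ofReal_mul (by norm_num),
    ← ENNReal.ofReal_mul (by norm_num), ← ENNReal.ofReal_add (by positivity) (by positivity)]
  apply ENNReal.ofReal_le_ofReal
  nlinarith [sq_nonneg (x - y - (y - z))]

/-- The increments of `a` by `g ∈ V` satisfy a Carleson measure estimate, on average over `V`. -/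
def OscBound {d : ℕ} (a : Pt d → ℝ) (V : Set (Pt d)) : Prop :=
  ∃ K : ℝ≥0∞, K ≠ ⊤ ∧ ∀ (z : EuclideanSpace ℝ (Fin d)) (r : ℝ), 0 < r →
    ∫⁻ g in V, ∫⁻ X in tent z r, osc a g X ∂(nu d) ≤ K * volume (Metric.ball z r)

theorem OscBound.mono {d : ℕ} {a : Pt d → ℝ} {V V' : Set (Pt d)} (h : OscBound a V')
    (hV : V ⊆ V') : OscBound a V := by
  obtain ⟨K, hK, h⟩ := h
  exact ⟨K, hK, fun z r hr => (lintegral_mono_set hV).trans (h z r hr)⟩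

theorem OscBound.union {d : ℕ} {a : Pt d → ℝ} {V V' : Set (Pt d)} (h : OscBound a V)
    (h' : OscBound a V') : OscBound a (V ∪ V') := by
  obtain ⟨K, hK, h⟩ := h
  obtain ⟨K', hK', h'⟩ := h'
  refine ⟨K + K', ENNReal.add_ne_top.2 ⟨hK, hK'⟩, fun z r hr => ?_⟩
  rw [add_mul]
  exact (lintegral_union_le _ _ _).trans (add_le_add (h z r hr) (h' z r hr))

/-- `OscBound` holds near `g`. -/
def OscBoundAt {d : ℕ} (a : Pt d → ℝ) (g : Pt d) : Prop := ∃ V ∈ 𝓝 g, OscBound a V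

theorem measurable_lintegral_osc {d : ℕ} {a : Pt d → ℝ} (ha : Measurable a) (S : Set (Pt d)) :
    Measurable fun g => ∫⁻ X in S, osc a g X ∂(nu d) :=
  (measurable_osc ha).lintegral_prod_right'

theorem act_mem_tent {d : ℕ} {z : EuclideanSpace ℝ (Fin d)} {r M : ℝ} {X g : Pt d}
    (hX : X ∈ tent z r) (hg : g ∈ halfSpace d) (hM : ‖g.1‖ ≤ M) (hM' : g.2 ≤ M) :
    act X g ∈ tent z ((1 + M) * r) := by
  obtain ⟨h1, h2, h3⟩ := hX
  have hg : 0 < g.2 := hg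
  rw [mem_ball_iff_norm] at h1
  refine ⟨?_, mul_pos h2 hg, ?_⟩
  · rw [mem_ball_iff_norm]
    have : (act X g).1 - z = (X.1 - z) + X.2 • g.1 := by simp [act]; abel
    rw [this]
    refine (norm_add_le _ _).trans_lt ?_
    rw [norm_smul, Real.norm_of_nonneg h2.le]
    nlinarith [mul_le_mul h3.le hM (norm_nonneg _) (h2.le.trans h3.le)]
  · simp only [act]
    nlinarith

theorem continuousAt_ldiv {d : ℕ} {g h : Pt d} (hg : g ∈ halfSpace d) :
    ContinuousAt (fun p : Pt d × Pt d => ldiv p.1 p.2) (g, h) := by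
  have : g.2 ≠ 0 := ne_of_gt hg
  unfold ldiv
  have h2 : ContinuousAt (fun p : Pt d × Pt d => p.1.2⁻¹) (g, h) :=
    ContinuousAt.inv₀ (by fun_prop) this
  fun_prop

/-- For h near g₀g₁ and g near g₀, the increment of a by h at X is the increment by g at X plus the
increment by g⁻¹h at Xg. Invariance of `nu` absorbs the moved base point, at the cost of a larger
tent. The bounds hold only on average over the translation, so g is averaged over a small ball. -/
theorem OscBoundAt.act {d : ℕ} {a : Pt d → ℝ} (ha : Measurable a) {g₀ g₁ : Pt d}
    (hg₀ : g₀ ∈ halfSpace d) (h₀ : OscBoundAt a g₀) (h₁ : OscBoundAt a g₁) :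
    OscBoundAt a (act g₀ g₁) := by
  obtain ⟨V, hV, K, hK, hKV⟩ := h₀
  obtain ⟨V', hV', K', hK', hKV'⟩ := h₁
  have hV'i : interior V' ∈ 𝓝 (ldiv g₀ (WeakDKP.act g₀ g₁)) := by
    rw [ldiv_act hg₀]; exact interior_mem_nhds.2 hV'
  have hc := (continuousAt_ldiv (h := WeakDKP.act g₀ g₁) hg₀).preimage_mem_nhds hV'i
  -- Continuity of division keeps g⁻¹h in the good neighbourhood of g₁ for all g near g₀ and h near
  -- the product at once.
  obtain ⟨U, hU, W, hW, hUW⟩ := mem_nhds_prod_iff.1 hc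
  obtain ⟨δ, hδ, hB⟩ := Metric.mem_nhds_iff.1
    (Filter.inter_mem hU (Filter.inter_mem hV ((isOpen_halfSpace d).mem_nhds hg₀)))
  obtain ⟨δ', hδ', hW'⟩ := Metric.mem_nhds_iff.1 hW
  set B := Metric.ball g₀ δ
  set W₁ := Metric.ball (WeakDKP.act g₀ g₁) δ'
  set M := ‖g₀‖ + δ
  have hM : ∀ g ∈ B, ‖g‖ ≤ M := fun g hg => by
    have : ‖g - g₀‖ < δ := mem_ball_iff_norm.1 hg
    have := norm_add_le (g - g₀) g₀
    simp only [sub_add_cancel] at this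
    linarith
  have hM0 : 0 < M := by positivity
  have hvB : volume B ≠ 0 := (Metric.measure_ball_pos _ _ hδ).ne'
  have hvB' : volume B ≠ ⊤ := measure_ball_lt_top.ne
  have hvW : volume W₁ ≠ ⊤ := measure_ball_lt_top.ne
  set L : ℝ≥0∞ := 2 * volume W₁ * K + 2 * volume B * (ENNReal.ofReal (M ^ (d + 1)) *
    (K' * ENNReal.ofReal ((1 + M) ^ d)))
  have hL : L ≠ ⊤ := by
    refine ENNReal.add_ne_top.2 ⟨?_, ?_⟩
    · exact ENNReal.mul_ne_top (ENNReal.mul_ne_top (by simp) hvW) hK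
    · exact ENNReal.mul_ne_top (ENNReal.mul_ne_top (by simp) hvB')
        (ENNReal.mul_ne_top (by simp) (ENNReal.mul_ne_top hK' (by simp)))
  refine ⟨W₁, Metric.ball_mem_nhds _ hδ', L / volume B, ENNReal.div_ne_top hL hvB,
    fun z r hr => ?_⟩
  set D : Set (Pt d) → Pt d → ℝ≥0∞ := fun S g => ∫⁻ X in S, osc a g X ∂(nu d)
  have hD : ∀ S, Measurable (D S) := measurable_lintegral_osc ha
  have key : ∀ g ∈ B, ∫⁻ h in W₁, D (tent z r) h ≤ 2 * volume W₁ * D (tent z r) g +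
      2 * (ENNReal.ofReal (M ^ (d + 1)) * ∫⁻ h in interior V', D (tent z ((1 + M) * r)) h) := by
    intro g hg
    have hgH : g ∈ halfSpace d := (hB hg).2.2
    have hg2 : (0:ℝ) < g.2 := hgH
    have hgM : g.2 ≤ M := (le_abs_self _).trans ((norm_snd_le g).trans (hM g hg))
    have h1 : ∀ h, D (tent z r) h ≤
        2 * D (tent z r) g + 2 * D (tent z ((1 + M) * r)) (ldiv g h) := by
      intro h
      have hm1 : Measurable fun X => osc a g X := (measurable_osc ha).of_uncurry_left
      have hm2 : Measurable fun X => osc a (ldiv g h) X := (measurable_osc ha).of_uncurry_left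
      calc D (tent z r) h ≤ ∫⁻ X in tent z r,
            (2 * osc a g X + 2 * osc a (ldiv g h) (WeakDKP.act X g)) ∂(nu d) := by
            refine lintegral_mono fun X => ?_
            refine (ofReal_sq_sub_le _ (a (WeakDKP.act X g)) _).trans (le_of_eq ?_)
            simp only [osc, act_assoc, act_ldiv hgH]
        _ = 2 * D (tent z r) g + 2 * ∫⁻ X in tent z r,
            osc a (ldiv g h) (WeakDKP.act X g) ∂(nu d) := by
            rw [lintegral_add_left (by fun_prop), lintegral_const_mul' _ _ (by simp),
              lintegral_const_mul' _ _ (by simp)]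
        _ ≤ _ := by
            gcongr
            exact setLIntegral_act_le hgH hm2 (measurableSet_tent _ _) (measurableSet_tent _ _)
              fun X hX => act_mem_tent hX hgH ((norm_fst_le g).trans (hM g hg)) hgM
    -- Substitution h = gγ in Lebesgue measure, whose Jacobian g.2^(d+1) is at most M^(d+1).
    have h2 : ∫⁻ h in W₁, D (tent z ((1 + M) * r)) (ldiv g h) ≤
        ENNReal.ofReal (M ^ (d + 1)) * ∫⁻ h in interior V', D (tent z ((1 + M) * r)) h := by
      rw [← lintegral_indicator Metric.isOpen_ball.measurableSet, lintegral_eq_act_left hgH,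
        ← lintegral_indicator isOpen_interior.measurableSet]
      gcongr with h
      by_cases hh : WeakDKP.act g h ∈ W₁
      · have : h ∈ interior V' := by
          have := hUW (Set.mk_mem_prod (hB hg).1 (hW' hh))
          simpa [ldiv_act hgH] using this
        rw [indicator_of_mem hh, indicator_of_mem this, ldiv_act hgH]
      · rw [indicator_of_notMem hh]
        exact zero_le
    calc ∫⁻ h in W₁, D (tent z r) h
        ≤ ∫⁻ h in W₁, (2 * D (tent z r) g + 2 * D (tent z ((1 + M) * r)) (ldiv g h)) :=
          lintegral_mono h1
      _ = 2 * volume W₁ * D (tent z r) g +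
          2 * ∫⁻ h in W₁, D (tent z ((1 + M) * r)) (ldiv g h) := by
          rw [lintegral_add_left measurable_const,
            lintegral_const_mul' 2 (fun h => D (tent z ((1 + M) * r)) (ldiv g h)) (by simp)]
          simp; ring
      _ ≤ _ := by gcongr
  -- Integration of `key` over g ∈ B: the left side does not depend on g, and the factor `volume B`
  -- is divided out at the end.
  have h3 : volume B * ∫⁻ h in W₁, D (tent z r) h ≤ L * volume (Metric.ball z r) := by
    calc volume B * ∫⁻ h in W₁, D (tent z r) h
        = ∫⁻ g in B, ∫⁻ h in W₁, D (tent z r) h := by simp [mul_comm]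
      _ ≤ ∫⁻ g in B, (2 * volume W₁ * D (tent z r) g +
      2 * (ENNReal.ofReal (M ^ (d + 1)) * ∫⁻ h in interior V', D (tent z ((1 + M) * r)) h)) :=
          setLIntegral_mono' Metric.isOpen_ball.measurableSet key
      _ = 2 * volume W₁ * (∫⁻ g in B, D (tent z r) g) + 2 * volume B *
        (ENNReal.ofReal (M ^ (d + 1)) * ∫⁻ h in interior V', D (tent z ((1 + M) * r)) h) := by
          rw [lintegral_add_right _ measurable_const,
            lintegral_const_mul' _ _ (ENNReal.mul_ne_top (by simp) hvW)]
          simp; ring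
      _ ≤ 2 * volume W₁ * (K * volume (Metric.ball z r)) + 2 * volume B *
        (ENNReal.ofReal (M ^ (d + 1)) * (K' * (ENNReal.ofReal ((1 + M) ^ d) *
          volume (Metric.ball z r)))) := by
          rw [← volume_ball_mul z (by positivity) r]
          gcongr
          · exact (lintegral_mono_set fun x hx => (hB hx).2.1).trans (hKV z r hr)
          · exact (lintegral_mono_set interior_subset).trans (hKV' z _ (by positivity))
      _ = _ := by simp only [L]; ring
  rw [← ENNReal.mul_le_mul_iff_right hvB hvB', ← mul_assoc, ENNReal.mul_div_cancel hvB hvB']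
  exact h3

theorem OscBoundAt.eventually {d : ℕ} {a : Pt d → ℝ} {g : Pt d} (h : OscBoundAt a g) :
    ∀ᶠ g' in 𝓝 g, OscBoundAt a g' := by
  obtain ⟨V, hV, h⟩ := h
  filter_upwards [eventually_mem_nhds_iff.2 hV] with g' hg'
  exact ⟨V, hg', h⟩

/-- A neighbourhood of the identity generates the group: (w, b) = (w, 1)(0, b), and both (w, 1) and
(0, b) lie on one-parameter subgroups, so they are powers of elements close to (0, 1). -/
theorem oscBoundAt_of_one {d : ℕ} {a : Pt d → ℝ} (ha : Measurable a)
    (h : OscBoundAt a (0, 1)) {g : Pt d} (hg : g ∈ halfSpace d) : OscBoundAt a g := by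
  obtain ⟨w, b⟩ := g
  have hb : 0 < b := hg
  have h1 : OscBoundAt a (w, 1) := by
    have ht : Tendsto (fun m : ℕ => (((m : ℝ) + 1)⁻¹ • w, (1 : ℝ))) atTop (𝓝 ((0 : ℝ) • w, 1)) := by
      refine Tendsto.prodMk_nhds (Tendsto.smul_const ?_ w) tendsto_const_nhds
      simpa using tendsto_one_div_add_atTop_nhds_zero_nat (𝕜 := ℝ)
    rw [zero_smul] at ht
    obtain ⟨m, hm⟩ := (ht.eventually h.eventually).exists
    have : ∀ k : ℕ, OscBoundAt a ((k * ((m : ℝ) + 1)⁻¹) • w, (1 : ℝ)) := by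
      intro k
      induction k with
      | zero => simpa using h
      | succ k ih =>
        have := OscBoundAt.act ha (by simp [halfSpace]) ih hm
        convert this using 1
        simp [WeakDKP.act, add_mul, add_smul]
    have := this (m + 1)
    rwa [Nat.cast_add_one, mul_inv_cancel₀ (by positivity), one_smul] at this
  have h2 : OscBoundAt a (0, b) := by
    have ht : Tendsto (fun m : ℕ => ((0 : EuclideanSpace ℝ (Fin d)),
        Real.exp (((m : ℝ) + 1)⁻¹ * Real.log b))) atTop (𝓝 (0, Real.exp (0 * Real.log b))) := by
      refine Tendsto.prodMk_nhds tendsto_const_nhds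
        ((Real.continuous_exp.tendsto _).comp (Tendsto.mul_const _ ?_))
      simpa using tendsto_one_div_add_atTop_nhds_zero_nat (𝕜 := ℝ)
    rw [zero_mul, Real.exp_zero] at ht
    obtain ⟨m, hm⟩ := (ht.eventually h.eventually).exists
    have : ∀ k : ℕ, OscBoundAt a (0, Real.exp (k * (((m : ℝ) + 1)⁻¹ * Real.log b))) := by
      intro k
      induction k with
      | zero => simpa using h
      | succ k ih =>
        have := OscBoundAt.act ha (by simp [halfSpace, Real.exp_pos]) ih hm
        convert this using 1
        simp [WeakDKP.act, add_mul, Real.exp_add]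
    have := this (m + 1)
    rwa [Nat.cast_add_one, ← mul_assoc, mul_inv_cancel₀ (by positivity), one_mul,
      Real.exp_log hb] at this
  have := OscBoundAt.act ha (by simp [halfSpace]) h1 h2
  simpa [WeakDKP.act] using this

theorem oscBound_of_isCompact {d : ℕ} {a : Pt d → ℝ} (ha : Measurable a)
    (h : OscBoundAt a (0, 1)) {K : Set (Pt d)} (hK : IsCompact K) (hKH : K ⊆ halfSpace d) :
    OscBound a K := by
  refine hK.induction_on (p := OscBound a) ?_ (fun s t hst ht => ht.mono hst)
    (fun s t hs ht => hs.union ht) fun x hx => ?_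
  · exact ⟨0, by simp, fun z r hr => by simp⟩
  · obtain ⟨V, hV, h⟩ := oscBoundAt_of_one ha h (hKH hx)
    exact ⟨V, mem_nhdsWithin_of_mem_nhds hV, h⟩

/-! ### From Whitney oscillation to increments near the identity -/

/-- Averaged squared oscillation of a scalar function on Whitney regions. -/
def scalarOsc {d : ℕ} (a : Pt d → ℝ) (X : Pt d) : ℝ≥0∞ :=
  ⨅ c : ℝ, (volume (Metric.ball X.1 (2 * X.2)))⁻¹ *
    ∫⁻ Y in Metric.ball X.1 (2 * X.2) ×ˢ Ioo X.2 (2 * X.2),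
      ENNReal.ofReal ((a Y - c) ^ 2) / ENNReal.ofReal Y.2

/-- The Whitney region of the point `(0, 1)`. -/
def whitney (d : ℕ) : Set (Pt d) := Metric.ball 0 2 ×ˢ Ioo 1 2

theorem isOpen_whitney (d : ℕ) : IsOpen (whitney d) := Metric.isOpen_ball.prod isOpen_Ioo

theorem volume_whitney_ne_top (d : ℕ) : volume (whitney d) ≠ ⊤ :=
  ((Metric.isBounded_ball.prod (Metric.isBounded_Ioo 1 2)).measure_lt_top).ne

theorem act_mem_whitney_iff {d : ℕ} {X : Pt d} (hX : X ∈ halfSpace d) (g : Pt d) :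
    act X g ∈ Metric.ball X.1 (2 * X.2) ×ˢ Ioo X.2 (2 * X.2) ↔ g ∈ whitney d := by
  have hX : 0 < X.2 := hX
  simp only [act, whitney, Set.mem_prod, mem_ball_iff_norm, add_sub_cancel_left, norm_smul,
    Real.norm_of_nonneg hX.le, mem_Ioo, sub_zero]
  rw [mul_comm 2, mul_lt_mul_iff_right₀ hX, mul_lt_mul_iff_right₀ hX,
    lt_mul_iff_one_lt_right hX]

/-- Substituting Y = `act X g` carries the fixed box `whitney d` to the Whitney region of X. With t
= X.2, the weight 1/s is at least 1/(2t) there, and the ball has volume (2t)^d times that of the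
unit ball; dividing by t^(d+1) leaves the constant. -/
theorem lintegral_whitney_le {d : ℕ} (a : Pt d → ℝ) (c : ℝ) {X : Pt d}
    (hX : X ∈ halfSpace d) :
    ∫⁻ g in whitney d, ENNReal.ofReal ((a (act X g) - c) ^ 2) ≤
      2 ^ (d + 1) * volume (Metric.ball (0 : EuclideanSpace ℝ (Fin d)) 1) *
      ((volume (Metric.ball X.1 (2 * X.2)))⁻¹ *
        ∫⁻ Y in Metric.ball X.1 (2 * X.2) ×ˢ Ioo X.2 (2 * X.2),
          ENNReal.ofReal ((a Y - c) ^ 2) / ENNReal.ofReal Y.2) := by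
  have hX' : 0 < X.2 := hX
  set S := Metric.ball X.1 (2 * X.2) ×ˢ Ioo X.2 (2 * X.2)
  have hS : MeasurableSet S := Metric.isOpen_ball.measurableSet.prod measurableSet_Ioo
  set β := volume (Metric.ball (0 : EuclideanSpace ℝ (Fin d)) 1)
  have hβ := volume_ball_ne (0 : EuclideanSpace ℝ (Fin d)) one_pos
  have h1 : ∫⁻ g in whitney d, ENNReal.ofReal ((a (act X g) - c) ^ 2) =
      ENNReal.ofReal ((X.2 ^ (d + 1))⁻¹) * ∫⁻ Y in S, ENNReal.ofReal ((a Y - c) ^ 2) := by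
    rw [← lintegral_indicator (isOpen_whitney d).measurableSet, ← lintegral_indicator hS,
      ← lintegral_act_left hX]
    refine lintegral_congr fun g => ?_
    by_cases hg : g ∈ whitney d
    · rw [indicator_of_mem hg, indicator_of_mem ((act_mem_whitney_iff hX g).2 hg)]
    · rw [indicator_of_notMem hg, indicator_of_notMem (mt (act_mem_whitney_iff hX g).1 hg)]
  have h2 : ∫⁻ Y in S, ENNReal.ofReal ((a Y - c) ^ 2) ≤ ENNReal.ofReal (2 * X.2) *
      ∫⁻ Y in S, ENNReal.ofReal ((a Y - c) ^ 2) / ENNReal.ofReal Y.2 := by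
    rw [← lintegral_const_mul' _ _ ENNReal.ofReal_ne_top]
    refine setLIntegral_mono' hS fun Y hY => ?_
    have hY2 : 0 < Y.2 := hX'.trans hY.2.1
    rw [← ENNReal.ofReal_div_of_pos hY2, ← ENNReal.ofReal_mul (by positivity)]
    apply ENNReal.ofReal_le_ofReal
    rw [mul_div_assoc', le_div_iff₀ hY2, mul_comm]
    exact mul_le_mul_of_nonneg_right hY.2.2.le (sq_nonneg _)
  have h3 : volume (Metric.ball X.1 (2 * X.2)) = ENNReal.ofReal ((2 * X.2) ^ d) * β := by
    have := volume_ball_mul X.1 (c := 2 * X.2) (by positivity) 1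
    rw [mul_one] at this
    rw [this, Measure.addHaar_ball_center _ X.1]
  rw [h1]
  refine (mul_le_mul_right h2 _).trans (le_of_eq ?_)
  rw [h3, ENNReal.mul_inv (Or.inr hβ.2) (by simp), ← mul_assoc, ← mul_assoc]
  congr 1
  rw [mul_assoc (2 ^ (d + 1)), mul_comm (ENNReal.ofReal _)⁻¹, ← mul_assoc β,
    ENNReal.mul_inv_cancel hβ.1 hβ.2, one_mul, ← ENNReal.ofReal_inv_of_pos (by positivity),
    show (2 : ℝ≥0∞) ^ (d + 1) = ENNReal.ofReal (2 ^ (d + 1)) by simp,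
    ← ENNReal.ofReal_mul (by positivity), ← ENNReal.ofReal_mul (by positivity)]
  congr 1
  field_simp
  ring

/-- The best constant depends on X; comparing two values of a through it, and then taking the
infimum, replaces it by a double average over translations. -/
theorem lintegral_whitney_whitney_le {d : ℕ} {a : Pt d → ℝ} (ha : Measurable a) {X : Pt d}
    (hX : X ∈ halfSpace d) :
    ∫⁻ g in whitney d, ∫⁻ h in whitney d, ENNReal.ofReal ((a (act X g) - a (act X h)) ^ 2) ≤
      4 * volume (whitney d) *
        (2 ^ (d + 1) * volume (Metric.ball (0 : EuclideanSpace ℝ (Fin d)) 1)) *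
        scalarOsc a X := by
  have hβ := volume_ball_ne (0 : EuclideanSpace ℝ (Fin d)) one_pos
  have hv := volume_whitney_ne_top d
  have hv0 : volume (whitney d) ≠ 0 := by
    refine ((isOpen_whitney d).measure_pos _ ⟨(0, 3 / 2), ?_⟩).ne'
    constructor <;> norm_num
  rw [scalarOsc, ENNReal.mul_iInf_of_ne (by simp [hβ.1, hv0])
    (ENNReal.mul_ne_top (ENNReal.mul_ne_top (by simp) hv) (ENNReal.mul_ne_top (by simp) hβ.2))]
  refine le_iInf fun c => ?_
  have hm : Measurable fun g => ENNReal.ofReal ((a (act X g) - c) ^ 2) := by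
    have : Measurable fun g => a (act X g) :=
      ha.comp (measurable_act.comp (measurable_const.prodMk measurable_id))
    exact ((this.sub_const c).pow_const 2).ennreal_ofReal
  set I := ∫⁻ g in whitney d, ENNReal.ofReal ((a (act X g) - c) ^ 2)
  calc _ ≤ ∫⁻ g in whitney d, ∫⁻ h in whitney d, (2 * ENNReal.ofReal ((a (act X g) - c) ^ 2) +
        2 * ENNReal.ofReal ((a (act X h) - c) ^ 2)) := by
        refine lintegral_mono fun g => lintegral_mono fun h => ?_
        have := ofReal_sq_sub_le (a (act X g)) c (a (act X h))
        rwa [← neg_sub (a _) c, neg_sq] at this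
    _ = ∫⁻ g in whitney d, (2 * volume (whitney d) * ENNReal.ofReal ((a (act X g) - c) ^ 2) +
        2 * I) := by
        refine lintegral_congr fun g => ?_
        rw [lintegral_add_left measurable_const, lintegral_const_mul' 2
          (fun h => ENNReal.ofReal ((a (act X h) - c) ^ 2)) (by simp), lintegral_const,
          Measure.restrict_apply_univ]
        ring
    _ = 4 * volume (whitney d) * I := by
        rw [lintegral_add_right _ measurable_const,
          lintegral_const_mul' _ _ (ENNReal.mul_ne_top (by simp) hv)]
        simp only [lintegral_const, MeasurableSet.univ, Measure.restrict_apply, univ_inter]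
        ring
    _ ≤ _ := by
        rw [mul_assoc (4 * volume (whitney d))]
        gcongr
        exact lintegral_whitney_le a c hX

theorem lintegral_rotate {α : Type*} [MeasurableSpace α] (μ ν : Measure α) [SFinite μ] [SFinite ν]
    {q : α → α → α → ℝ≥0∞} (hq : Measurable fun x : (α × α) × α => q x.1.1 x.1.2 x.2) :
    ∫⁻ g, ∫⁻ h, ∫⁻ X, q g h X ∂ν ∂μ ∂μ = ∫⁻ X, ∫⁻ g, ∫⁻ h, q g h X ∂μ ∂μ ∂ν := by
  have h1 : ∀ g, ∫⁻ h, ∫⁻ X, q g h X ∂ν ∂μ = ∫⁻ X, ∫⁻ h, q g h X ∂μ ∂ν := fun g =>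
    lintegral_lintegral_swap (hq.comp (by fun_prop : Measurable fun x : α × α =>
      ((g, x.1), x.2))).aemeasurable
  simp_rw [h1]
  refine lintegral_lintegral_swap (Measurable.aemeasurable ?_)
  exact Measurable.lintegral_prod_right' (f := fun x : (α × α) × α => q x.1.1 x.2 x.1.2)
    (hq.comp (by fun_prop : Measurable fun x : (α × α) × α => ((x.1.1, x.2), x.1.2)))

theorem setLIntegral_comp_act_le {d : ℕ} {g : Pt d} (hg : 1 ≤ g.2) {V W : Set (Pt d)}
    (hV : MeasurableSet V) (hW : MeasurableSet W) (h : ∀ x ∈ V, act g x ∈ W)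
    (Q : Pt d → ℝ≥0∞) : ∫⁻ x in V, Q (act g x) ≤ ∫⁻ x in W, Q x := by
  have hgH : g ∈ halfSpace d := one_pos.trans_le hg
  rw [← lintegral_indicator hV, ← lintegral_indicator hW, lintegral_eq_act_left hgH (W.indicator Q)]
  have h2 : 1 ≤ ENNReal.ofReal (g.2 ^ (d + 1)) := ENNReal.one_le_ofReal.2 (one_le_pow₀ hg)
  refine (lintegral_mono fun x => ?_).trans (le_mul_of_one_le_left zero_le h2)
  by_cases hx : x ∈ V
  · rw [indicator_of_mem hx, indicator_of_mem (h x hx)]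
  · rw [indicator_of_notMem hx]
    exact zero_le

/-- The double average compares Xg with Xg′ for g, g′ in the Whitney box. Writing g′ = gh and
replacing Xg by X, thanks to the invariance of `nu`, gives the increment by h = g⁻¹g′, which is near
the identity when g and g′ are close. -/
theorem oscBoundAt_one {d : ℕ} {a : Pt d → ℝ} (ha : Measurable a)
    (h : CarlesonFinite (scalarOsc a)) : OscBoundAt a (0, 1) := by
  obtain ⟨K, hK, h⟩ := h
  have hβ := volume_ball_ne (0 : EuclideanSpace ℝ (Fin d)) one_pos
  -- Any interior point of the box would do. The identity (0, 1) lies only on its boundary, hence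
  -- the detour through p.
  set p : Pt d := (0, 3 / 2)
  have hp : act p (0, 1) = p := by simp [act]
  have hpW : act p (0, 1) ∈ whitney d := by
    rw [hp]; constructor <;> norm_num [p]
  have hc := (continuous_act (d := d)).continuousAt.preimage_mem_nhds
    (x := (p, (0, 1))) ((isOpen_whitney d).mem_nhds hpW)
  obtain ⟨U, hU, V, hV, hUV⟩ := mem_nhds_prod_iff.1 hc
  have hUV' : ∀ g ∈ U, ∀ h ∈ V, act g h ∈ whitney d := fun g hg h hh => by
    have := hUV (Set.mk_mem_prod hg hh)
    rwa [mem_preimage] at this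
  obtain ⟨δ, hδ, hB⟩ := Metric.mem_nhds_iff.1
    (Filter.inter_mem hU ((isOpen_whitney d).mem_nhds (hp ▸ hpW)))
  set B := Metric.ball p δ
  have hvB : volume B ≠ 0 := (Metric.measure_ball_pos _ _ hδ).ne'
  have hvB' : volume B ≠ ⊤ := measure_ball_lt_top.ne
  set C := 4 * volume (whitney d) *
    (2 ^ (d + 1) * volume (Metric.ball (0 : EuclideanSpace ℝ (Fin d)) 1))
  have hC : C ≠ ⊤ := ENNReal.mul_ne_top (ENNReal.mul_ne_top (by simp) (volume_whitney_ne_top d))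
    (ENNReal.mul_ne_top (by simp) hβ.2)
  set L := C * (K * ENNReal.ofReal (3 ^ d))
  have hL : L ≠ ⊤ := ENNReal.mul_ne_top hC (ENNReal.mul_ne_top hK (by simp))
  have hV'o := isOpen_interior (s := V)
  refine ⟨interior V, interior_mem_nhds.2 hV, L / volume B, ENNReal.div_ne_top hL hvB,
    fun z r hr => ?_⟩
  set q : Pt d → Pt d → Pt d → ℝ≥0∞ := fun g h X =>
    ENNReal.ofReal ((a (act X g) - a (act X h)) ^ 2)
  have hq : Measurable fun x : (Pt d × Pt d) × Pt d => q x.1.1 x.1.2 x.2 := by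
    have h1 : Measurable fun x : (Pt d × Pt d) × Pt d => a (act x.2 x.1.1) :=
      ha.comp (measurable_act.comp (by fun_prop : Measurable fun x : (Pt d × Pt d) × Pt d =>
        (x.2, x.1.1)))
    have h2 : Measurable fun x : (Pt d × Pt d) × Pt d => a (act x.2 x.1.2) :=
      ha.comp (measurable_act.comp (by fun_prop : Measurable fun x : (Pt d × Pt d) × Pt d =>
        (x.2, x.1.2)))
    exact ((h1.sub h2).pow_const 2).ennreal_ofReal
  have key : ∀ g ∈ B, ∫⁻ h in interior V, ∫⁻ X in tent z r, osc a h X ∂(nu d) ≤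
      ∫⁻ h in whitney d, ∫⁻ X in tent z (3 * r), q g h X ∂(nu d) := by
    intro g hg
    obtain ⟨hg1, hg2⟩ : g ∈ whitney d := (hB hg).2
    rw [mem_ball_zero_iff] at hg1
    have hgH : g ∈ halfSpace d := one_pos.trans hg2.1
    -- If Xg lies in the tent of radius r, then X.2 < r because g.2 > 1, and x moves by less than 2r
    -- because ‖g.1‖ < 2: hence the radius 3r.
    have h1 : ∀ h, ∫⁻ X in tent z r, osc a h X ∂(nu d) ≤
        ∫⁻ X in tent z (3 * r), q g (act g h) X ∂(nu d) := by
      intro h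
      have hm : Measurable fun X => osc a h X := (measurable_osc ha).of_uncurry_left
      refine (setLIntegral_le_act hgH hm (measurableSet_tent z r) (measurableSet_tent z (3 * r))
        ?_).trans (le_of_eq ?_)
      · rintro X ⟨h1, h2, h3⟩
        have hX2 : 0 < X.2 := pos_of_mul_pos_left h2 (le_of_lt hgH)
        have hX3 : X.2 < r := by
          have : X.2 * g.2 < r := h3
          nlinarith [hg2.1]
        refine ⟨?_, hX2, by linarith⟩
        rw [mem_ball_iff_norm] at h1 ⊢
        have : X.1 - z = ((act X g).1 - z) - X.2 • g.1 := by simp [act]; abel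
        rw [this]
        refine (norm_sub_le _ _).trans_lt ?_
        rw [norm_smul, Real.norm_of_nonneg hX2.le]
        nlinarith [norm_nonneg g.1]
      · simp only [osc, q, act_assoc]
    refine (lintegral_mono h1).trans ?_
    exact setLIntegral_comp_act_le hg2.1.le hV'o.measurableSet
      (isOpen_whitney d).measurableSet
      (fun h hh => hUV' g (hB hg).1 h (interior_subset hh))
      (fun h => ∫⁻ X in tent z (3 * r), q g h X ∂(nu d))
  have h3 : volume B * ∫⁻ h in interior V, ∫⁻ X in tent z r, osc a h X ∂(nu d) ≤
      L * volume (Metric.ball z r) := by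
    calc volume B * ∫⁻ h in interior V, ∫⁻ X in tent z r, osc a h X ∂(nu d)
        = ∫⁻ g in B, ∫⁻ h in interior V, ∫⁻ X in tent z r, osc a h X ∂(nu d) := by
          simp [mul_comm]
      _ ≤ ∫⁻ g in B, ∫⁻ h in whitney d, ∫⁻ X in tent z (3 * r), q g h X ∂(nu d) :=
          setLIntegral_mono' Metric.isOpen_ball.measurableSet key
      _ ≤ ∫⁻ g in whitney d, ∫⁻ h in whitney d, ∫⁻ X in tent z (3 * r), q g h X ∂(nu d) :=
          lintegral_mono_set fun x hx => (hB hx).2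
      _ = ∫⁻ X in tent z (3 * r), (∫⁻ g in whitney d, ∫⁻ h in whitney d, q g h X) ∂(nu d) :=
          lintegral_rotate _ _ hq
      _ ≤ ∫⁻ X in tent z (3 * r), C * scalarOsc a X ∂(nu d) :=
          setLIntegral_mono' (measurableSet_tent _ _) fun X hX =>
            lintegral_whitney_whitney_le ha (tent_subset _ _ hX)
      _ ≤ C * (K * (ENNReal.ofReal (3 ^ d) * volume (Metric.ball z r))) := by
          rw [lintegral_const_mul' _ _ hC, ← volume_ball_mul z (by norm_num) r]
          gcongr
          exact h z _ (by positivity)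
      _ = _ := by simp only [L]; ring
  rw [← ENNReal.mul_le_mul_iff_right hvB hvB', ← mul_assoc, ENNReal.mul_div_cancel hvB hvB']
  exact h3

/-- A weak-DKP coefficient has Carleson-controlled increments over every compact set of
translations. -/
theorem oscBound_of_scalarOsc {d : ℕ} {a : Pt d → ℝ} (ha : Measurable a)
    (h : CarlesonFinite (scalarOsc a)) {K : Set (Pt d)} (hK : IsCompact K)
    (hKH : K ⊆ halfSpace d) : OscBound a K :=
  oscBound_of_isCompact ha (oscBoundAt_one ha h) hK hKH

/-! ### Smoothing along the group -/

/-- Averages of `a` against the kernel `κ` transported by the affine group. -/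
def smoothing {d : ℕ} (κ a : Pt d → ℝ) (X : Pt d) : ℝ := ∫ g, a (act X g) * κ g

/-- The kernel of `t ∂_ξ` applied to `smoothing κ`. -/
def kerDeriv {d : ℕ} (κ : Pt d → ℝ) (ξ g : Pt d) : ℝ :=
  -fderiv ℝ κ g (ξ.1, 0) - ξ.2 * ((d + 1) * κ g + fderiv ℝ κ g g)

/-- Moves the dependence on X from the rough function a to the smooth kernel, so that derivatives
fall on κ. -/
theorem smoothing_eq {d : ℕ} (κ a : Pt d → ℝ) {X : Pt d} (hX : X ∈ halfSpace d) :
    smoothing κ a X =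
      ∫ Z, a Z * ((X.2 ^ (d + 1))⁻¹ * κ (X.2⁻¹ • (Z - (X.1, 0)))) := by
  have hX' : 0 < X.2 := hX
  have h1 := Measure.integral_comp_smul (volume : Measure (Pt d))
    (fun y => a ((X.1, 0) + y) * κ (X.2⁻¹ • y)) X.2
  have h2 := integral_add_left_eq_self (μ := (volume : Measure (Pt d)))
    (fun Z => a Z * κ (X.2⁻¹ • (Z - (X.1, 0)))) (X.1, 0)
  simp only [add_sub_cancel_left] at h2
  rw [h2, finrank_pt, abs_of_pos (by positivity)] at h1
  simp only [smul_smul, inv_mul_cancel₀ hX'.ne', one_smul] at h1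
  simp only [smoothing, act_eq]
  rw [h1, smul_eq_mul, ← integral_const_mul]
  congr 1
  ext Z
  ring

/-- The power d + 2 is one more than in `smoothing_eq`: after multiplication by X.2 the derivative
has the normalization of a smoothing kernel again. -/
theorem hasDerivAt_kernel {d : ℕ} {κ : Pt d → ℝ} (hκ : ContDiff ℝ ∞ κ) {X : Pt d}
    (hX : X ∈ halfSpace d) (ξ Z : Pt d) :
    HasDerivAt (fun τ : ℝ => ((X + τ • ξ).2 ^ (d + 1))⁻¹ *
        κ ((X + τ • ξ).2⁻¹ • (Z - ((X + τ • ξ).1, 0))))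
      ((X.2 ^ (d + 2))⁻¹ * kerDeriv κ ξ (X.2⁻¹ • (Z - (X.1, 0)))) 0 := by
  have hX' : X.2 ≠ 0 := ne_of_gt hX
  have e1 : HasDerivAt (fun τ : ℝ => (X + τ • ξ).2) ξ.2 0 := by
    have : HasDerivAt (fun τ : ℝ => X.2 + τ * ξ.2) (1 * ξ.2) 0 :=
      ((hasDerivAt_id 0).mul_const ξ.2).const_add X.2
    simpa using this
  have e2 : HasDerivAt (fun τ : ℝ => Z - ((X + τ • ξ).1, (0 : ℝ))) (-(ξ.1, 0)) 0 := by
    have h1 : HasDerivAt (fun τ : ℝ => (X + τ • ξ).1) ξ.1 0 := by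
      have : HasDerivAt (fun τ : ℝ => X.1 + τ • ξ.1) ((1 : ℝ) • ξ.1) 0 :=
        ((hasDerivAt_id (0 : ℝ)).smul_const ξ.1).const_add X.1
      simpa using this
    exact (h1.prodMk (hasDerivAt_const (0 : ℝ) (0 : ℝ))).const_sub Z
  have e0 : (X + (0 : ℝ) • ξ).2 = X.2 := by simp
  have e0' : (X + (0 : ℝ) • ξ).1 = X.1 := by simp
  have e3 := (e1.inv (by rwa [e0])).smul e2
  have e4 := (e1.pow (d + 1)).inv (by rw [Pi.pow_apply, e0]; positivity)
  have hκd : HasFDerivAt κ (fderiv ℝ κ (X.2⁻¹ • (Z - (X.1, 0))))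
      ((X + (0 : ℝ) • ξ).2⁻¹ • (Z - ((X + (0 : ℝ) • ξ).1, 0))) := by
    rw [e0, e0']
    exact ((hκ.differentiable (by simp)) _).hasFDerivAt
  have e5 := e4.mul (hκd.comp_hasDerivAt (0 : ℝ) e3)
  refine e5.congr_deriv ?_
  simp only [Pi.pow_apply, Pi.inv_apply, Pi.smul_apply', Function.comp, e0, e0', kerDeriv]
  have hz : X.2⁻¹ • -(ξ.1, (0 : ℝ)) + (-ξ.2 / X.2 ^ 2) • (Z - (X.1, 0)) =
      -X.2⁻¹ • ((ξ.1, (0 : ℝ)) + ξ.2 • (X.2⁻¹ • (Z - (X.1, 0)))) := by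
    rw [smul_add, smul_smul, smul_smul]
    congr 1
    · simp
    · congr 1; field_simp
  rw [hz, map_smul, map_add, map_smul]
  simp only [smul_eq_mul, Nat.cast_add, Nat.cast_one, add_tsub_cancel_right]
  set D := fderiv ℝ κ (X.2⁻¹ • (Z - (X.1, 0)))
  field_simp
  ring

theorem exists_bound_of_hasCompactSupport {d : ℕ} {κ : Pt d → ℝ} (hκc : HasCompactSupport κ) :
    ∃ R : ℝ, 0 < R ∧ ∀ g, κ g ≠ 0 → ‖g‖ ≤ R := by
  obtain ⟨R, hR⟩ := (hκc : IsCompact (tsupport κ)).isBounded.exists_norm_le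
  exact ⟨max R 1, by positivity, fun g hg => (hR g (subset_tsupport _ hg)).trans (le_max_left _ _)⟩

section Convolution

variable {d : ℕ} {κ a : Pt d → ℝ}

/-- The kernel of `smoothing`, arranged for `MeasureTheory.convolution`. -/
def convKernel (κ : Pt d → ℝ) (p y : Pt d) : ℝ :=
  (p.2 ^ (d + 1))⁻¹ * κ (p.2⁻¹ • (-y - (p.1, 0)))

theorem convKernel_contDiffOn (hκ : ContDiff ℝ ∞ κ) :
    ContDiffOn ℝ ∞ (↿(convKernel κ)) (halfSpace d ×ˢ univ) := by
  have h2 : ContDiffOn ℝ ∞ (fun q : Pt d × Pt d => q.1.2) (halfSpace d ×ˢ univ) := by fun_prop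
  have h1 : ∀ q ∈ halfSpace d ×ˢ (univ : Set (Pt d)), q.1.2 ≠ 0 := fun q hq => ne_of_gt hq.1
  refine ContDiffOn.mul ((h2.pow (d + 1)).inv fun q hq => pow_ne_zero _ (h1 q hq)) ?_
  refine hκ.comp_contDiffOn ((h2.inv h1).smul ?_)
  fun_prop

/-- Seen as the value at 0 of a convolution whose kernel depends on the parameter X, the average is
covered by the differentiation theorems for convolutions with a parameter, which ask only local
integrability of a. -/
theorem smoothing_eq_convolution (κ a : Pt d → ℝ) {X : Pt d} (hX : X ∈ halfSpace d) :
    smoothing κ a X =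
      convolution a (convKernel κ X) (ContinuousLinearMap.mul ℝ ℝ) volume 0 := by
  rw [smoothing_eq κ a hX, convolution]
  simp [convKernel]

theorem exists_convKernel_support (hκc : HasCompactSupport κ) {X : Pt d}
    (hX : X ∈ halfSpace d) :
    ∃ (s k : Set (Pt d)), IsOpen s ∧ X ∈ s ∧ s ⊆ halfSpace d ∧ IsCompact k ∧
      ∀ p x, p ∈ s → x ∉ k → convKernel κ p x = 0 := by
  have hX' : 0 < X.2 := hX
  obtain ⟨R, hR, hκR⟩ := exists_bound_of_hasCompactSupport hκc
  refine ⟨Metric.ball X 1 ∩ halfSpace d, Metric.closedBall 0 ((‖X‖ + 1) * (1 + R)),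
    Metric.isOpen_ball.inter (isOpen_halfSpace d), ⟨Metric.mem_ball_self one_pos, hX⟩,
    inter_subset_right, isCompact_closedBall _ _, ?_⟩
  rintro p x ⟨hp, hp2⟩ hx
  have hp2 : 0 < p.2 := hp2
  by_contra h
  apply hx
  have h1 := hκR _ (right_ne_zero_of_mul h)
  have hpn : ‖p‖ ≤ ‖X‖ + 1 := by
    have h := norm_add_le (p - X) X
    have h' := mem_ball_iff_norm.1 hp
    rw [sub_add_cancel] at h
    linarith
  rw [norm_smul, norm_inv, Real.norm_of_nonneg hp2.le, inv_mul_le_iff₀ hp2] at h1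
  have h2 : ‖((p.1, 0) : Pt d)‖ ≤ ‖X‖ + 1 := by
    simpa [Prod.norm_def] using (norm_fst_le p).trans hpn
  have h3 : p.2 ≤ ‖X‖ + 1 := (le_abs_self _).trans ((norm_snd_le p).trans hpn)
  rw [mem_closedBall_zero_iff, ← norm_neg x]
  have h4 : -x = (-x - (p.1, 0)) + (p.1, 0) := by abel
  rw [h4]
  refine (norm_add_le _ _).trans ?_
  nlinarith

theorem locallyIntegrable_of_bounded (ha : Measurable a) {M : ℝ} (haM : ∀ X, |a X| ≤ M) :
    LocallyIntegrable a :=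
  (locallyIntegrable_const M).mono ha.aestronglyMeasurable
    (ae_of_all _ fun X => by
      rw [Real.norm_eq_abs, Real.norm_eq_abs]; exact (haM X).trans (le_abs_self M))

theorem contDiffOn_smoothing (hκ : ContDiff ℝ ∞ κ) (hκc : HasCompactSupport κ)
    (ha : Measurable a) {M : ℝ} (haM : ∀ X, |a X| ≤ M) :
    ContDiffOn ℝ ∞ (smoothing κ a) (halfSpace d) := by
  intro X hX
  obtain ⟨s, k, hs, hXs, hsH, hk, hsk⟩ := exists_convKernel_support hκc hX
  have h := contDiffOn_convolution_right_with_param (n := ⊤) (ContinuousLinearMap.mul ℝ ℝ) hs hk hsk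
    (locallyIntegrable_of_bounded ha haM)
    ((convKernel_contDiffOn hκ).mono (prod_mono_left hsH))
  have h2 : ContDiffOn ℝ ∞ (smoothing κ a) s := by
    have h3 : ContDiffOn ℝ ∞ (fun p : Pt d => (p, (0 : Pt d))) s := by fun_prop
    refine (h.comp h3 fun p hp => ⟨hp, mem_univ _⟩).congr fun p hp => ?_
    exact smoothing_eq_convolution κ a (hsH hp)
  exact (h2.contDiffAt (hs.mem_nhds hXs)).contDiffWithinAt

/-- The scale-invariant derivative is itself a smoothing. Its pointwise size is therefore governed
by the L¹ norm of `kerDeriv`, and its Carleson size by increments of a. -/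
theorem fderiv_smoothing (hκ : ContDiff ℝ ∞ κ) (hκc : HasCompactSupport κ)
    (ha : Measurable a) {M : ℝ} (haM : ∀ X, |a X| ≤ M) {X : Pt d} (hX : X ∈ halfSpace d)
    (ξ : Pt d) :
    X.2 * fderiv ℝ (smoothing κ a) X ξ = smoothing (kerDeriv κ ξ) a X := by
  have hX' : 0 < X.2 := hX
  obtain ⟨s, k, hs, hXs, hsH, hk, hsk⟩ := exists_convKernel_support hκc hX
  have hcd : ContDiffOn ℝ ∞ (↿(convKernel κ)) (s ×ˢ univ) :=
    (convKernel_contDiffOn hκ).mono (prod_mono_left hsH)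
  have hopen : IsOpen (s ×ˢ (univ : Set (Pt d))) := hs.prod isOpen_univ
  have h := hasFDerivAt_convolution_right_with_param (ContinuousLinearMap.mul ℝ ℝ) hs hk hsk
    (locallyIntegrable_of_bounded ha haM) (hcd.of_le (by simp)) (X, 0) hXs
  have h2 : HasFDerivAt (fun p : Pt d => (p, (0 : Pt d)))
      ((ContinuousLinearMap.id ℝ (Pt d)).prod (0 : Pt d →L[ℝ] Pt d)) X :=
    (hasFDerivAt_id X).prodMk (hasFDerivAt_const (0 : Pt d) X)
  have h3 := (HasFDerivAt.comp X h h2).congr_of_eventuallyEq (f₁ := smoothing κ a) (by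
    filter_upwards [hs.mem_nhds hXs] with p hp
    exact smoothing_eq_convolution κ a (hsH hp))
  rw [h3.fderiv]
  simp only [ContinuousLinearMap.comp_apply, ContinuousLinearMap.prod_apply,
    ContinuousLinearMap.id_apply, zero_apply, convolution, zero_sub]
  have hcont : Continuous fun Z : Pt d => fderiv ℝ (↿(convKernel κ)) (X, -Z) := by
    have := hcd.continuousOn_fderiv_of_isOpen hopen (by simp)
    exact this.comp_continuous (by fun_prop) fun Z => ⟨hXs, mem_univ _⟩
  have hsupp : HasCompactSupport fun Z : Pt d => fderiv ℝ (↿(convKernel κ)) (X, -Z) := by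
    refine HasCompactSupport.intro (hk.neg) fun Z hZ => ?_
    have : (↿(convKernel κ)) =ᶠ[𝓝 (X, -Z)] fun _ => 0 := by
      have hZ' : -Z ∉ k := by simpa using hZ
      filter_upwards [(hs.prod hk.isClosed.isOpen_compl).mem_nhds ⟨hXs, hZ'⟩] with q hq
      exact hsk q.1 q.2 hq.1 hq.2
    rw [this.fderiv_eq]
    simp
  have hint : Integrable fun Z : Pt d => ((ContinuousLinearMap.mul ℝ ℝ).precompR (Pt d × Pt d))
      (a Z) (fderiv ℝ (↿(convKernel κ)) (X, -Z)) := by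
    have h1 : Integrable fun Z : Pt d => fderiv ℝ (↿(convKernel κ)) (X, -Z) :=
      hcont.integrable_of_hasCompactSupport hsupp
    have : Integrable fun Z : Pt d => a Z • fderiv ℝ (↿(convKernel κ)) (X, -Z) :=
      h1.bdd_smul M ha.aestronglyMeasurable (ae_of_all _ haM)
    refine this.congr (ae_of_all _ fun Z => ?_)
    ext <;> simp
  rw [ContinuousLinearMap.integral_apply hint, smoothing_eq _ _ hX, ← integral_const_mul]
  congr 1
  ext Z
  have hq : HasFDerivAt (↿(convKernel κ)) (fderiv ℝ (↿(convKernel κ)) (X, -Z)) (X, -Z) :=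
    ((hcd.contDiffAt (hopen.mem_nhds ⟨hXs, mem_univ _⟩)).differentiableAt (by simp)).hasFDerivAt
  have hl : HasDerivAt (fun τ : ℝ => (X + τ • ξ, -Z)) (ξ, (0 : Pt d)) 0 := by
    have : HasDerivAt (fun τ : ℝ => X + τ • ξ) ((1 : ℝ) • ξ) 0 :=
      ((hasDerivAt_id (0 : ℝ)).smul_const ξ).const_add X
    rw [one_smul] at this
    exact this.prodMk (hasDerivAt_const (0 : ℝ) (-Z))
  have hq' : HasFDerivAt (↿(convKernel κ)) (fderiv ℝ (↿(convKernel κ)) (X, -Z))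
      ((fun τ : ℝ => (X + τ • ξ, -Z)) 0) := by simpa using hq
  have h5 := hq'.comp_hasDerivAt (0 : ℝ) hl
  have h6 := hasDerivAt_kernel hκ hX ξ Z
  have h7 : (↿(convKernel κ) ∘ fun τ : ℝ => (X + τ • ξ, -Z)) = fun τ : ℝ =>
      ((X + τ • ξ).2 ^ (d + 1))⁻¹ * κ ((X + τ • ξ).2⁻¹ • (Z - ((X + τ • ξ).1, 0))) := by
    ext τ
    simp [convKernel, Function.HasUncurry.uncurry]
  rw [h7] at h5
  have h8 := h5.unique h6
  change X.2 * (a Z * fderiv ℝ (↿(convKernel κ)) (X, -Z) (ξ, 0)) = _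
  rw [h8]
  generalize kerDeriv κ ξ (X.2⁻¹ • (Z - (X.1, 0))) = w
  field_simp
  ring

theorem continuous_kerDeriv (hκ : ContDiff ℝ ∞ κ) (ξ : Pt d) : Continuous (kerDeriv κ ξ) := by
  have h := hκ.continuous_fderiv (by simp)
  have h2 := hκ.continuous
  unfold kerDeriv
  have h3 : Continuous fun g => fderiv ℝ κ g g := h.clm_apply continuous_id
  have h4 : Continuous fun g => fderiv ℝ κ g (ξ.1, 0) := h.clm_apply continuous_const
  fun_prop

theorem kerDeriv_eq_zero (ξ : Pt d) {g : Pt d} (hg : g ∉ tsupport κ) : kerDeriv κ ξ g = 0 := by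
  have h1 : κ g = 0 := image_eq_zero_of_notMem_tsupport hg
  have h2 : fderiv ℝ κ g = 0 := by
    by_contra h
    exact hg (support_fderiv_subset ℝ h)
  simp [kerDeriv, h1, h2]

/-- The smoothing of the constant 1 is constant, so its derivative vanishes. -/
theorem integral_kerDeriv (hκ : ContDiff ℝ ∞ κ) (hκc : HasCompactSupport κ) (ξ : Pt d) :
    ∫ g, kerDeriv κ ξ g = 0 := by
  have hX : ((0, 1) : Pt d) ∈ halfSpace d := show (0 : ℝ) < 1 from one_pos
  have h := fderiv_smoothing (a := fun _ => 1) hκ hκc measurable_const (M := 1) (by simp) hX ξ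
  have h2 : smoothing κ (fun _ => 1) = fun _ => ∫ g, κ g := by
    ext X; simp [smoothing]
  rw [h2] at h
  simpa [smoothing] using h.symm

/-- Cauchy–Schwarz; the constant is the squared L² norm of η, the same for every f. -/
theorem integral_mul_sq_le {η : Pt d → ℝ} (hη : Continuous η) {K : Set (Pt d)}
    (hK : IsCompact K) (hηK : ∀ g ∉ K, η g = 0) :
    ∃ C : ℝ≥0∞, C ≠ ⊤ ∧ ∀ f : Pt d → ℝ, Measurable f →
      ENNReal.ofReal ((∫ g, f g * η g) ^ 2) ≤ C * ∫⁻ g in K, ENNReal.ofReal (f g ^ 2) := by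
  have hηc : HasCompactSupport η := HasCompactSupport.intro hK fun g hg => hηK g hg
  refine ⟨∫⁻ g, ENNReal.ofReal (η g ^ 2), ?_, fun f hf => ?_⟩
  · have : Integrable fun g => η g ^ 2 := by
      refine (hη.pow 2).integrable_of_hasCompactSupport ?_
      exact HasCompactSupport.intro hK fun g hg => by simp [hηK g hg]
    have h2 := this.lintegral_lt_top
    exact h2.ne
  have hsq : ∀ x : ℝ, ENNReal.ofReal (x ^ 2) = ‖x‖ₑ ^ 2 := fun x => by
    rw [← sq_abs, ENNReal.ofReal_pow (abs_nonneg x), ← Real.norm_eq_abs, ofReal_norm]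
  have hsq' : ∀ x : ℝ≥0∞, x ^ (2 : ℝ) = x ^ 2 := fun x => by
    rw [← ENNReal.rpow_natCast]; norm_num
  have h1 : ‖∫ g, f g * η g‖ₑ ≤ ∫⁻ g, ((K.indicator fun g => ‖f g‖ₑ) * fun g => ‖η g‖ₑ) g := by
    refine (enorm_integral_le_lintegral_enorm _).trans (lintegral_mono fun g => ?_)
    by_cases hg : g ∈ K
    · simp [hg]
    · simp [hg, hηK g hg]
  have h2 := ENNReal.lintegral_mul_le_Lp_mul_Lq (volume : Measure (Pt d))
    (Real.HolderConjugate.two_two) (f := K.indicator fun g => ‖f g‖ₑ) (g := fun g => ‖η g‖ₑ)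
    ((Measurable.indicator (by fun_prop) hK.measurableSet).aemeasurable)
    (by fun_prop)
  have h3 : (‖∫ g, f g * η g‖ₑ) ^ 2 ≤ ((∫⁻ g, (K.indicator (fun g => ‖f g‖ₑ) g) ^ 2)) *
      (∫⁻ g, ‖η g‖ₑ ^ 2) := by
    refine (pow_le_pow_left' (h1.trans h2) 2).trans (le_of_eq ?_)
    rw [mul_pow, ← ENNReal.rpow_natCast, ← ENNReal.rpow_natCast, ← ENNReal.rpow_mul,
      ← ENNReal.rpow_mul]
    simp only [hsq']
    norm_num
  simp only [hsq]
  rw [mul_comm]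
  refine h3.trans (le_of_eq ?_)
  congr 1
  rw [← lintegral_indicator hK.measurableSet]
  refine lintegral_congr fun g => ?_
  by_cases hg : g ∈ K <;> simp [hg]

end Convolution

/-! ### A kernel spread over many scales -/

/-- A bump of logarithmically slow variation, supported far from the origin. -/
theorem exists_slow_bump {ε : ℝ} (hε : 0 < ε) :
    ∃ (ψ : ℝ → ℝ) (m R : ℝ), ContDiff ℝ ∞ ψ ∧ 0 < m ∧ ε⁻¹ ≤ m ∧ (∀ b, 0 ≤ ψ b) ∧
      (∀ b, ψ b ≠ 0 → b ∈ Icc m R) ∧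
      (∫⁻ b, ENNReal.ofReal (ψ b / b) = 1) ∧
      ∫⁻ b, ENNReal.ofReal |deriv ψ b| ≤ ENNReal.ofReal ε := by
  set S := Real.smoothTransition
  have hS : ContDiff ℝ ∞ S := Real.smoothTransition.contDiff
  have hS' : Continuous (deriv S) := hS.continuous_deriv (by simp)
  have hSd : Differentiable ℝ S := hS.differentiable (by simp)
  have hS0 : ∀ x, x ∉ Icc (0 : ℝ) 1 → deriv S x = 0 := by
    intro x hx
    rcases not_and_or.1 hx with h | h
    · push Not at h
      have : S =ᶠ[𝓝 x] fun _ => 0 := by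
        filter_upwards [Iio_mem_nhds h] with y hy
        exact Real.smoothTransition.zero_of_nonpos (le_of_lt hy)
      rw [this.deriv_eq]; simp
    · push Not at h
      have : S =ᶠ[𝓝 x] fun _ => 1 := by
        filter_upwards [Ioi_mem_nhds h] with y hy
        exact Real.smoothTransition.one_of_one_le (le_of_lt hy)
      rw [this.deriv_eq]; simp
  have hSc : HasCompactSupport (deriv S) := HasCompactSupport.intro isCompact_Icc hS0
  have hSi : Integrable (deriv S) := hS'.integrable_of_hasCompactSupport hSc
  set c := ∫⁻ x, ENNReal.ofReal |deriv S x|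
  have hc : c ≠ ⊤ := hSi.abs.lintegral_lt_top.ne
  set m := max ε⁻¹ 1
  have hm1 : 1 ≤ m := le_max_right _ _
  have hm : ε⁻¹ ≤ m := le_max_left _ _
  -- The rise and the fall of the bump have total variation at most 2c, whatever the length of the
  -- plateau; a db/b mass of at least A makes this at most ε after normalization.
  set A := 2 * c.toReal / ε + 1
  have hA : 0 < A := by positivity
  -- Chosen so that the plateau [m + 1, R - 1] has db/b length exactly A.
  set R := (m + 1) * Real.exp A + 1
  have hR : m + 1 < R - 1 := by
    have : 1 < Real.exp A := Real.one_lt_exp_iff.2 hA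
    simp only [R]; nlinarith
  set ψ₀ : ℝ → ℝ := fun b => S (b - m) * S (R - b)
  have h1 : ContDiff ℝ ∞ ψ₀ := (hS.comp (by fun_prop)).mul (hS.comp (by fun_prop))
  have h2 : ∀ b, 0 ≤ ψ₀ b := fun b =>
    mul_nonneg (Real.smoothTransition.nonneg _) (Real.smoothTransition.nonneg _)
  have h3 : ∀ b, ψ₀ b ≠ 0 → b ∈ Icc m R := by
    intro b hb
    constructor
    · by_contra h
      exact hb (by
        have : S (b - m) = 0 := Real.smoothTransition.zero_of_nonpos (by linarith)
        simp [ψ₀, this])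
    · by_contra h
      exact hb (by
        have : S (R - b) = 0 := Real.smoothTransition.zero_of_nonpos (by linarith)
        simp [ψ₀, this])
  have h4 : ∀ b ∈ Icc (m + 1) (R - 1), ψ₀ b = 1 := by
    intro b hb
    have e1 : S (b - m) = 1 := Real.smoothTransition.one_of_one_le (by linarith [hb.1])
    have e2 : S (R - b) = 1 := Real.smoothTransition.one_of_one_le (by linarith [hb.2])
    simp [ψ₀, e1, e2]
  have hcont : Continuous fun b => ψ₀ b / b := by
    rw [continuous_iff_continuousAt]
    intro b
    by_cases hb : 0 < b
    · exact h1.continuous.continuousAt.div continuousAt_id hb.ne'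
    · have : (fun b => ψ₀ b / b) =ᶠ[𝓝 b] fun _ => 0 := by
        filter_upwards [Iio_mem_nhds (show b < m by linarith)] with y hy
        have : ψ₀ y = 0 := by
          by_contra h; exact absurd (h3 y h).1 (not_le.2 hy)
        simp [this]
      exact continuousAt_const.congr this.symm
  have hsupp : HasCompactSupport fun b => ψ₀ b / b :=
    HasCompactSupport.intro (isCompact_Icc (a := m) (b := R)) fun b hb => by
      have : ψ₀ b = 0 := by
        by_contra h; exact hb (h3 b h)
      simp [this]
  have hnn : ∀ b, 0 ≤ ψ₀ b / b := fun b => by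
    by_cases h : ψ₀ b = 0
    · simp [h]
    · exact div_nonneg (h2 b) (by linarith [(h3 b h).1])
  have hint := hcont.integrable_of_hasCompactSupport (μ := volume) hsupp
  set N := ∫ b, ψ₀ b / b
  have hN : A ≤ N := by
    have e1 : ∫ b in (m + 1)..(R - 1), b⁻¹ = A := by
      rw [integral_inv_of_pos (by positivity) (by linarith)]
      simp only [R, add_sub_cancel_right]
      rw [mul_div_cancel_left₀ _ (by positivity), Real.log_exp]
    rw [← e1, intervalIntegral.integral_of_le hR.le]
    calc ∫ b in Ioc (m + 1) (R - 1), b⁻¹ = ∫ b in Ioc (m + 1) (R - 1), ψ₀ b / b := by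
          refine setIntegral_congr_fun measurableSet_Ioc fun b hb => ?_
          simp [h4 b (Ioc_subset_Icc_self hb)]
      _ ≤ N := setIntegral_le_integral hint (ae_of_all _ hnn)
  have hN0 : 0 < N := hA.trans_le hN
  have hder : ∀ b, |deriv ψ₀ b| ≤ |deriv S (b - m)| + |deriv S (R - b)| := by
    intro b
    have e1 : HasDerivAt (fun b => S (b - m)) (deriv S (b - m)) b := by
      simpa using HasDerivAt.comp_sub_const b m (hSd (b - m)).hasDerivAt
    have e2 : HasDerivAt (fun b => S (R - b)) (-deriv S (R - b)) b := by
      simpa using HasDerivAt.comp_const_sub R b (hSd (R - b)).hasDerivAt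
    have e3 : deriv ψ₀ b = _ := (e1.mul e2).deriv
    rw [e3]
    refine (abs_add_le _ _).trans (add_le_add ?_ ?_)
    · rw [abs_mul, abs_of_nonneg (Real.smoothTransition.nonneg _)]
      exact mul_le_of_le_one_right (abs_nonneg _) (Real.smoothTransition.le_one _)
    · rw [abs_mul, abs_neg, abs_of_nonneg (Real.smoothTransition.nonneg _)]
      exact mul_le_of_le_one_left (abs_nonneg _) (Real.smoothTransition.le_one _)
  refine ⟨fun b => N⁻¹ * ψ₀ b, m, R, contDiff_const.mul h1, by positivity, hm,
    fun b => mul_nonneg (by positivity) (h2 b), fun b hb => h3 b (right_ne_zero_of_mul hb), ?_, ?_⟩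
  · simp_rw [mul_div_assoc]
    rw [← ofReal_integral_eq_lintegral_ofReal (hint.const_mul _)
      (ae_of_all _ fun b => mul_nonneg (by positivity) (hnn b)), integral_const_mul,
      inv_mul_cancel₀ hN0.ne', ENNReal.ofReal_one]
  · have e1 : ∀ b, ENNReal.ofReal |deriv (fun b => N⁻¹ * ψ₀ b) b| ≤ ENNReal.ofReal N⁻¹ *
        (ENNReal.ofReal |deriv S (b - m)| + ENNReal.ofReal |deriv S (R - b)|) := by
      intro b
      rw [deriv_const_mul_field, abs_mul, abs_of_pos (by positivity : 0 < N⁻¹),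
        ENNReal.ofReal_mul (by positivity), ← ENNReal.ofReal_add (abs_nonneg _) (abs_nonneg _)]
      gcongr
      exact hder b
    refine (lintegral_mono e1).trans ?_
    rw [lintegral_const_mul' _ _ ENNReal.ofReal_ne_top, lintegral_add_left (by fun_prop),
      lintegral_sub_right_eq_self (fun b => ENNReal.ofReal |deriv S b|) m,
      lintegral_sub_left_eq_self (fun b => ENNReal.ofReal |deriv S b|) R]
    change ENNReal.ofReal N⁻¹ * (c + c) ≤ _
    rw [← ENNReal.ofReal_toReal hc, ← ENNReal.ofReal_add (by positivity) (by positivity),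
      ← ENNReal.ofReal_mul (by positivity)]
    apply ENNReal.ofReal_le_ofReal
    rw [inv_mul_le_iff₀ hN0]
    have : 2 * c.toReal / ε ≤ N := by linarith
    rw [div_le_iff₀ hε] at this
    linarith

/-- For fixed b the dilation w ↦ b⁻¹w produces b^d, which leaves one factor 1/b. -/
theorem lintegral_dilated_product {d : ℕ} {Θ : EuclideanSpace ℝ (Fin d) → ℝ≥0∞} {Ψ : ℝ → ℝ≥0∞}
    (hΘ : Measurable Θ) (hΨ : Measurable Ψ) (hΨ0 : ∀ b ≤ 0, Ψ b = 0) :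
    ∫⁻ g : Pt d, ENNReal.ofReal ((g.2 ^ (d + 1))⁻¹) * Θ (g.2⁻¹ • g.1) * Ψ g.2 =
      (∫⁻ w, Θ w) * ∫⁻ b, ENNReal.ofReal b⁻¹ * Ψ b := by
  have hm : Measurable fun g : Pt d =>
      ENNReal.ofReal ((g.2 ^ (d + 1))⁻¹) * Θ (g.2⁻¹ • g.1) * Ψ g.2 := by
    have : Measurable fun g : Pt d => Θ (g.2⁻¹ • g.1) := hΘ.comp (by fun_prop)
    fun_prop
  rw [Measure.volume_eq_prod, lintegral_prod_symm _ hm.aemeasurable,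
    ← lintegral_const_mul _ (by fun_prop)]
  refine lintegral_congr fun b => ?_
  simp only
  by_cases hb : b ≤ 0
  · simp [hΨ0 b hb]
  push Not at hb
  have h1 := lintegral_homothety (volume : Measure (EuclideanSpace ℝ (Fin d))) 0
    (inv_pos.2 hb) Θ
  simp only [zero_add, finrank_euclideanSpace, Fintype.card_fin] at h1
  rw [lintegral_mul_const _ (by fun_prop), lintegral_const_mul _ (by fun_prop), h1,
    ← mul_assoc, ← ENNReal.ofReal_mul (by positivity), ← mul_assoc, mul_comm (∫⁻ w, Θ w)]
  congr 3
  rw [inv_pow, inv_inv, pow_succ]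
  field_simp

/-- The kernel is κ(w, b) = b^(-d-1) θ(w/b) ψ(b). A tangential derivative costs 1/b, small because ψ
lives at large b. In the normal direction, b^(-d-1) θ(w/b) is homogeneous of degree -(d+1), so by
Euler's identity the operator (d+1) + g·∇ leaves only b ψ′(b), whose db/b mass is the variation of
ψ. -/
theorem exists_kernel (d : ℕ) {ε : ℝ} (hε : 0 < ε) :
    ∃ κ : Pt d → ℝ, ContDiff ℝ ∞ κ ∧ HasCompactSupport κ ∧ tsupport κ ⊆ halfSpace d ∧
      (∀ g, 0 ≤ κ g) ∧ ∫ g, κ g = 1 ∧ ∀ ξ, ∫ g, |kerDeriv κ ξ g| ≤ ε * ‖ξ‖ := by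
  let f : ContDiffBump (0 : EuclideanSpace ℝ (Fin d)) := ⟨1, 2, one_pos, one_lt_two⟩
  set θ : EuclideanSpace ℝ (Fin d) → ℝ := f.normed volume
  have hθ : ContDiff ℝ ∞ θ := f.contDiff_normed
  have hθc : HasCompactSupport θ := f.hasCompactSupport_normed
  have hθ0 : ∀ w, 0 ≤ θ w := f.nonneg_normed
  have hθ2 : ∀ w, θ w ≠ 0 → ‖w‖ ≤ 2 := fun w hw => by
    have : w ∈ tsupport θ := subset_tsupport _ hw
    rw [f.tsupport_normed_eq] at this
    simpa using this
  have hθ1 : ∫⁻ w, ENNReal.ofReal (θ w) = 1 := by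
    rw [← ofReal_integral_eq_lintegral_ofReal f.integrable_normed (ae_of_all _ hθ0),
      f.integral_normed, ENNReal.ofReal_one]
  have hθd : Continuous (fderiv ℝ θ) := hθ.continuous_fderiv (by simp)
  have hθi : Integrable (fderiv ℝ θ) :=
    hθd.integrable_of_hasCompactSupport (hθc.fderiv ℝ)
  set c := ∫⁻ w, ENNReal.ofReal ‖fderiv ℝ θ w‖
  have hc : c ≠ ⊤ := hθi.norm.lintegral_lt_top.ne
  -- The tangential part will contribute c ε′ and the normal part 1 · ε′, as θ has mass 1.
  set ε' := ε / (c.toReal + 1)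
  have hε' : 0 < ε' := by positivity
  obtain ⟨ψ, m, R, hψ, hm, hεm, hψ0, hψs, hψ1, hψd⟩ := exists_slow_bump hε'
  have hψn : ∀ b ≤ 0, ψ b = 0 := fun b hb => by
    by_contra h; linarith [(hψs b h).1]
  set κ : Pt d → ℝ := fun g => (g.2 ^ (d + 1))⁻¹ * θ (g.2⁻¹ • g.1) * ψ g.2
  set K : Set (Pt d) := Metric.closedBall 0 (2 * R) ×ˢ Icc m R
  have hKc : IsCompact K := (isCompact_closedBall _ _).prod isCompact_Icc
  have hK : ∀ g, g ∉ K → κ g = 0 := by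
    intro g hg
    by_contra h
    have h1 := hψs _ (right_ne_zero_of_mul h)
    have h2 := hθ2 _ (right_ne_zero_of_mul (left_ne_zero_of_mul h))
    have hg2 : 0 < g.2 := hm.trans_le h1.1
    rw [norm_smul, norm_inv, Real.norm_of_nonneg hg2.le, inv_mul_le_iff₀ hg2] at h2
    exact hg ⟨by rw [mem_closedBall_zero_iff]; linarith [h1.2], h1⟩
  have hκc : HasCompactSupport κ := HasCompactSupport.intro hKc hK
  have hκK : tsupport κ ⊆ K := closure_minimal (fun g hg => by
    by_contra h; exact hg (hK g h)) hKc.isClosed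
  have hKH : K ⊆ halfSpace d := fun g hg => hm.trans_le hg.2.1
  have hκ : ContDiff ℝ ∞ κ := by
    rw [contDiff_iff_contDiffAt]
    intro g
    by_cases hg : 0 < g.2
    · have h2 : ContDiffAt ℝ ∞ (fun g : Pt d => g.2) g := by fun_prop
      have h3 : ContDiffAt ℝ ∞ (fun g : Pt d => g.2⁻¹ • g.1) g :=
        (h2.inv hg.ne').smul (by fun_prop)
      exact (((h2.pow (d + 1)).inv (by positivity)).mul (hθ.contDiffAt.comp g h3)).mul
        (hψ.contDiffAt.comp g h2)
    · have : κ =ᶠ[𝓝 g] fun _ => 0 := by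
        have : g ∈ Kᶜ := fun h => hg (hKH h)
        filter_upwards [hKc.isClosed.isOpen_compl.mem_nhds this] with x hx using hK x hx
      exact contDiffAt_const.congr_of_eventuallyEq this
  have hκ0 : ∀ g, 0 ≤ κ g := fun g => by
    by_cases hg : 0 < g.2
    · have := hψ0 g.2
      have := hθ0 (g.2⁻¹ • g.1)
      positivity
    · simp [κ, hψn _ (not_lt.1 hg)]
  refine ⟨κ, hκ, hκc, hκK.trans hKH, hκ0, ?_, fun ξ => ?_⟩
  · rw [integral_eq_lintegral_of_nonneg_ae (ae_of_all _ hκ0)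
      hκ.continuous.aestronglyMeasurable]
    have e : ∀ g, ENNReal.ofReal (κ g) = ENNReal.ofReal ((g.2 ^ (d + 1))⁻¹) *
        (fun w => ENNReal.ofReal (θ w)) (g.2⁻¹ • g.1) *
          (fun b => ENNReal.ofReal (ψ b)) g.2 := by
      intro g
      rw [← ENNReal.ofReal_mul' (hθ0 _), ← ENNReal.ofReal_mul' (hψ0 _)]
    simp_rw [e]
    rw [lintegral_dilated_product (hθ.continuous.measurable.ennreal_ofReal)
      (hψ.continuous.measurable.ennreal_ofReal) (fun b hb => by simp [hψn b hb]), hθ1, one_mul]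
    have e2 : ∀ b, ENNReal.ofReal b⁻¹ * ENNReal.ofReal (ψ b) = ENNReal.ofReal (ψ b / b) := by
      intro b
      rw [← ENNReal.ofReal_mul' (hψ0 _), div_eq_inv_mul]
    simp_rw [e2, hψ1]
    simp
  · have hκd := hκ.differentiable (by simp)
    have key : ∀ g, ENNReal.ofReal |kerDeriv κ ξ g| ≤ ENNReal.ofReal ‖ξ‖ *
        (ENNReal.ofReal ((g.2 ^ (d + 1))⁻¹) *
          (fun w => ENNReal.ofReal ‖fderiv ℝ θ w‖) (g.2⁻¹ • g.1) *
          (fun b => ENNReal.ofReal (ψ b / b)) g.2 +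
        ENNReal.ofReal ((g.2 ^ (d + 1))⁻¹) *
          (fun w => ENNReal.ofReal (θ w)) (g.2⁻¹ • g.1) *
          (fun b => ENNReal.ofReal (b * |deriv ψ b|)) g.2) := by
      intro g
      by_cases hg : g ∈ tsupport κ
      swap
      · simp [kerDeriv_eq_zero ξ hg]
      have hg2 : 0 < g.2 := hKH (hκK hg)
      have e1 : fderiv ℝ κ g (ξ.1, 0) = (g.2 ^ (d + 1))⁻¹ *
          fderiv ℝ θ (g.2⁻¹ • g.1) (g.2⁻¹ • ξ.1) * ψ g.2 := by
        have hl : HasDerivAt (fun τ : ℝ => g + τ • ((ξ.1, 0) : Pt d)) (ξ.1, 0) 0 := by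
          simpa using ((hasDerivAt_id (0 : ℝ)).smul_const ((ξ.1, 0) : Pt d)).const_add g
        have h1 := HasFDerivAt.comp_hasDerivAt (f := fun τ : ℝ => g + τ • ((ξ.1, 0) : Pt d))
          (0 : ℝ) (hκd _).hasFDerivAt hl
        have hl2 : HasDerivAt (fun τ : ℝ => g.2⁻¹ • (g.1 + τ • ξ.1)) (g.2⁻¹ • ξ.1) 0 := by
          have h := (((hasDerivAt_id (0 : ℝ)).smul_const ξ.1).const_add g.1).const_smul g.2⁻¹
          rw [one_smul] at h
          exact h
        have h2 := ((HasFDerivAt.comp_hasDerivAt (f := fun τ : ℝ => g.2⁻¹ • (g.1 + τ • ξ.1))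
          (0 : ℝ) ((hθ.differentiable (by simp)) _).hasFDerivAt hl2).const_mul
            (g.2 ^ (d + 1))⁻¹).mul_const (ψ g.2)
        have h3 : (κ ∘ fun τ : ℝ => g + τ • ((ξ.1, 0) : Pt d)) = fun τ : ℝ =>
            (g.2 ^ (d + 1))⁻¹ * (θ ∘ fun τ : ℝ => g.2⁻¹ • (g.1 + τ • ξ.1)) τ * ψ g.2 := by
          ext τ; simp [κ]
        rw [h3] at h1
        simpa using h1.unique h2
      -- Euler's identity, obtained by differentiating κ along the ray τ ↦ τ g at τ = 1; the
      -- argument w/b is constant along the ray.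
      have e2 : (d + 1) * κ g + fderiv ℝ κ g g =
          (g.2 ^ (d + 1))⁻¹ * θ (g.2⁻¹ • g.1) * (g.2 * deriv ψ g.2) := by
        have hl : HasDerivAt (fun τ : ℝ => τ • g) g 1 := by
          simpa using (hasDerivAt_id (1 : ℝ)).smul_const g
        have h1 := HasFDerivAt.comp_hasDerivAt (f := fun τ : ℝ => τ • g)
          (1 : ℝ) (hκd _).hasFDerivAt hl
        have hl2 : HasDerivAt (fun τ : ℝ => τ * g.2) g.2 1 := by
          simpa using (hasDerivAt_id (1 : ℝ)).mul_const g.2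
        have h2 := HasDerivAt.comp (h := fun τ : ℝ => τ * g.2) (1 : ℝ)
          ((hψ.differentiable (by simp)) _).hasDerivAt hl2
        have h4 := ((((hl2.pow (d + 1)).inv (by simp; positivity)).mul_const
          (θ (g.2⁻¹ • g.1))).mul h2)
        have h3 : (κ ∘ fun τ : ℝ => τ • g) =ᶠ[𝓝 1]
            ((fun τ : ℝ => ((fun τ : ℝ => τ * g.2) ^ (d + 1))⁻¹ τ * θ (g.2⁻¹ • g.1)) *
              (ψ ∘ fun τ : ℝ => τ * g.2)) := by
          filter_upwards [Ioi_mem_nhds (zero_lt_one' ℝ)] with τ hτ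
          have hτ : τ ≠ 0 := ne_of_gt hτ
          have : (τ * g.2)⁻¹ • τ • g.1 = g.2⁻¹ • g.1 := by
            rw [smul_smul]; congr 1; field_simp
          simp only [κ, Function.comp, Pi.mul_apply, Pi.inv_apply, Pi.pow_apply, Prod.smul_fst,
            Prod.smul_snd, smul_eq_mul, this]
        have h5 := h1.unique (h4.congr_of_eventuallyEq h3)
        rw [one_smul] at h5
        rw [h5]
        simp only [κ, Pi.pow_apply, Pi.inv_apply, one_mul, Function.comp, Nat.cast_add,
          Nat.cast_one, add_tsub_cancel_right]
        field_simp
        ring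
      simp only
      rw [← ENNReal.ofReal_mul (by positivity), ← ENNReal.ofReal_mul (by positivity),
        ← ENNReal.ofReal_mul (by positivity),
        ← ENNReal.ofReal_mul (mul_nonneg (by positivity) (hθ0 _)),
        ← ENNReal.ofReal_add (mul_nonneg (by positivity) (div_nonneg (hψ0 _) hg2.le))
          (mul_nonneg (mul_nonneg (by positivity) (hθ0 _)) (by positivity)),
        ← ENNReal.ofReal_mul (norm_nonneg _)]
      apply ENNReal.ofReal_le_ofReal
      rw [kerDeriv, e1, e2]
      have hξ1 : ‖ξ.1‖ ≤ ‖ξ‖ := norm_fst_le ξ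
      have hξ2 : |ξ.2| ≤ ‖ξ‖ := norm_snd_le ξ
      have hq : 0 ≤ (g.2 ^ (d + 1))⁻¹ := by positivity
      refine (abs_sub _ _).trans ?_
      rw [mul_add]
      refine add_le_add ?_ ?_
      · rw [abs_neg, abs_mul, abs_mul, abs_of_nonneg hq, abs_of_nonneg (hψ0 _)]
        have h1 : |fderiv ℝ θ (g.2⁻¹ • g.1) (g.2⁻¹ • ξ.1)| ≤
            ‖fderiv ℝ θ (g.2⁻¹ • g.1)‖ * (g.2⁻¹ * ‖ξ‖) := by
          refine (ContinuousLinearMap.le_opNorm (fderiv ℝ θ (g.2⁻¹ • g.1)) _).trans ?_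
          rw [norm_smul, norm_inv, Real.norm_of_nonneg hg2.le]
          gcongr
        calc _ ≤ (g.2 ^ (d + 1))⁻¹ * (‖fderiv ℝ θ (g.2⁻¹ • g.1)‖ * (g.2⁻¹ * ‖ξ‖)) * ψ g.2 :=
              mul_le_mul_of_nonneg_right (mul_le_mul_of_nonneg_left h1 hq) (hψ0 _)
          _ = _ := by field_simp
      · rw [abs_mul, abs_mul, abs_mul, abs_of_nonneg hq, abs_of_nonneg (hθ0 _), abs_mul,
          abs_of_pos hg2]
        exact mul_le_mul_of_nonneg_right hξ2
          (mul_nonneg (mul_nonneg hq (hθ0 _)) (by positivity))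
    have hint := (continuous_kerDeriv hκ ξ).abs
    have hm1 : Measurable fun w => ENNReal.ofReal ‖fderiv ℝ θ w‖ :=
      hθd.norm.measurable.ennreal_ofReal
    have hm2 : Measurable fun w => ENNReal.ofReal (θ w) :=
      hθ.continuous.measurable.ennreal_ofReal
    have hm3 : Measurable fun b => ENNReal.ofReal (ψ b / b) :=
      (hψ.continuous.measurable.div measurable_id).ennreal_ofReal
    have hm4 : Measurable fun b => ENNReal.ofReal (b * |deriv ψ b|) :=
      ((measurable_id.mul (measurable_deriv ψ).norm)).ennreal_ofReal
    have htot : ∫⁻ g, ENNReal.ofReal |kerDeriv κ ξ g| ≤ ENNReal.ofReal (ε * ‖ξ‖) := by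
      refine (lintegral_mono key).trans ?_
      rw [lintegral_const_mul' _ _ ENNReal.ofReal_ne_top, lintegral_add_left,
        lintegral_dilated_product hm1 hm3 (fun b hb => by simp [hψn b hb]),
        lintegral_dilated_product hm2 hm4 (fun b hb => by
          rw [ENNReal.ofReal_eq_zero]
          exact mul_nonpos_of_nonpos_of_nonneg hb (abs_nonneg _)), hθ1, one_mul]
      · have e1 : ∫⁻ b, ENNReal.ofReal b⁻¹ * ENNReal.ofReal (ψ b / b) ≤ ENNReal.ofReal ε' := by
          rw [← mul_one (ENNReal.ofReal ε'), ← hψ1,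
            ← lintegral_const_mul' _ _ ENNReal.ofReal_ne_top]
          refine lintegral_mono fun b => ?_
          by_cases hb : ψ b = 0
          · simp [hb]
          · gcongr
            rw [inv_le_comm₀ (hm.trans_le (hψs b hb).1) hε']
            exact hεm.trans (hψs b hb).1
        have e2 : ∫⁻ b, ENNReal.ofReal b⁻¹ * ENNReal.ofReal (b * |deriv ψ b|) ≤
            ENNReal.ofReal ε' := by
          refine (lintegral_mono fun b => ?_).trans hψd
          rcases le_or_gt b 0 with hb | hb
          · simp [ENNReal.ofReal_of_nonpos (inv_nonpos.2 hb)]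
          · rw [← ENNReal.ofReal_mul (by positivity), inv_mul_cancel_left₀ hb.ne']
        calc _ ≤ ENNReal.ofReal ‖ξ‖ * (c * ENNReal.ofReal ε' + ENNReal.ofReal ε') := by
              gcongr
          _ = _ := by
              rw [← ENNReal.ofReal_toReal hc, ← ENNReal.ofReal_mul (by positivity),
                ← ENNReal.ofReal_add (by positivity) (by positivity),
                ← ENNReal.ofReal_mul (by positivity)]
              congr 1
              simp only [ε']
              field_simp
      · have : Measurable fun g : Pt d => ENNReal.ofReal ‖fderiv ℝ θ (g.2⁻¹ • g.1)‖ :=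
          hm1.comp (by fun_prop : Measurable fun g : Pt d => g.2⁻¹ • g.1)
        have h' : Measurable fun g : Pt d => ENNReal.ofReal (ψ g.2 / g.2) :=
          hm3.comp measurable_snd
        fun_prop
    rw [integral_eq_lintegral_of_nonneg_ae (ae_of_all _ fun g => abs_nonneg _)
      hint.aestronglyMeasurable]
    exact ENNReal.toReal_le_of_le_ofReal (by positivity) htot

/-! ### The bi-Lipschitz change of variable -/

/-- The change of variable `(x, t) ↦ (x + t v(x,t), t h(x,t))`. -/
def shear {d : ℕ} (v : Pt d → EuclideanSpace ℝ (Fin d)) (h : Pt d → ℝ) (X : Pt d) : Pt d :=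
  act X (v X, h X)

/-- Smooth bounded data `v`, `h` with small scale-invariant gradients. -/
structure IsSlow {d : ℕ} (v : Pt d → EuclideanSpace ℝ (Fin d)) (h : Pt d → ℝ) (c C ε : ℝ) :
    Prop where
  c_pos : 0 < c
  C_nonneg : 0 ≤ C
  ε_nonneg : 0 ≤ ε
  small : ε * (1 + (C + 1) / c) ≤ 1 / 2
  contDiffOn_v : ContDiffOn ℝ ∞ v (halfSpace d)
  contDiffOn_h : ContDiffOn ℝ ∞ h (halfSpace d)
  norm_v_le : ∀ X ∈ halfSpace d, ‖v X‖ ≤ C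
  le_h : ∀ X ∈ halfSpace d, c ≤ h X
  h_le : ∀ X ∈ halfSpace d, h X ≤ C
  fderiv_v_le : ∀ X ∈ halfSpace d, ∀ ξ, X.2 * ‖fderiv ℝ v X ξ‖ ≤ ε * ‖ξ‖
  fderiv_h_le : ∀ X ∈ halfSpace d, ∀ ξ, X.2 * |fderiv ℝ h X ξ| ≤ ε * ‖ξ‖

theorem convex_halfSpace (d : ℕ) : Convex ℝ (halfSpace d) := by
  intro X hX Y hY a b ha hb hab
  have hX : 0 < X.2 := hX
  have hY : 0 < Y.2 := hY
  change 0 < a * X.2 + b * Y.2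
  rcases ha.eq_or_lt with h | h
  · have : b = 1 := by linarith
    subst h; subst this; simpa using hY
  · have := mul_pos h hX
    have := mul_nonneg hb hY.le
    linarith

namespace IsSlow

variable {d : ℕ} {v : Pt d → EuclideanSpace ℝ (Fin d)} {h : Pt d → ℝ} {c C ε : ℝ}

theorem differentiableAt_v (hs : IsSlow v h c C ε) {X : Pt d} (hX : X ∈ halfSpace d) :
    DifferentiableAt ℝ v X :=
  (hs.contDiffOn_v.contDiffAt ((isOpen_halfSpace d).mem_nhds hX)).differentiableAt (by simp)

theorem differentiableAt_h (hs : IsSlow v h c C ε) {X : Pt d} (hX : X ∈ halfSpace d) :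
    DifferentiableAt ℝ h X :=
  (hs.contDiffOn_h.contDiffAt ((isOpen_halfSpace d).mem_nhds hX)).differentiableAt (by simp)

theorem hasFDerivAt_smul_v (hs : IsSlow v h c C ε) {X : Pt d} (hX : X ∈ halfSpace d) :
    HasFDerivAt (fun X : Pt d => X.2 • v X)
      (X.2 • fderiv ℝ v X + (ContinuousLinearMap.snd ℝ _ ℝ).smulRight (v X)) X :=
  hasFDerivAt_snd.smul (hs.differentiableAt_v hX).hasFDerivAt

theorem hasFDerivAt_mul_h (hs : IsSlow v h c C ε) {X : Pt d} (hX : X ∈ halfSpace d) :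
    HasFDerivAt (fun X : Pt d => X.2 * h X)
      (X.2 • fderiv ℝ h X + h X • (ContinuousLinearMap.snd ℝ _ ℝ)) X :=
  hasFDerivAt_snd.mul (hs.differentiableAt_h hX).hasFDerivAt

theorem hasFDerivAt_shear (hs : IsSlow v h c C ε) {X : Pt d} (hX : X ∈ halfSpace d) :
    HasFDerivAt (shear v h) ((ContinuousLinearMap.fst ℝ _ ℝ +
      (X.2 • fderiv ℝ v X + (ContinuousLinearMap.snd ℝ _ ℝ).smulRight (v X))).prod
      (X.2 • fderiv ℝ h X + h X • (ContinuousLinearMap.snd ℝ _ ℝ))) X :=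
  (hasFDerivAt_fst.add (hs.hasFDerivAt_smul_v hX)).prodMk (hs.hasFDerivAt_mul_h hX)

theorem fderiv_shear (hs : IsSlow v h c C ε) {X : Pt d} (hX : X ∈ halfSpace d) (ξ : Pt d) :
    fderiv ℝ (shear v h) X ξ = (ξ.1 + (X.2 • fderiv ℝ v X ξ + ξ.2 • v X),
      X.2 * fderiv ℝ h X ξ + ξ.2 * h X) := by
  rw [(hs.hasFDerivAt_shear hX).fderiv]
  simp [mul_comm]

theorem contDiffOn_shear (hs : IsSlow v h c C ε) : ContDiffOn ℝ ∞ (shear v h) (halfSpace d) := by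
  have h1 := hs.contDiffOn_v
  have h2 := hs.contDiffOn_h
  unfold shear act
  fun_prop

theorem shear_mem (hs : IsSlow v h c C ε) {X : Pt d} (hX : X ∈ halfSpace d) :
    shear v h X ∈ halfSpace d :=
  act_mem hX (hs.c_pos.trans_le (hs.le_h X hX))

/-- The constant in the lower Lipschitz bound. -/
abbrev lowConst (c C : ℝ) : ℝ := 2 * (1 + (C + 1) / c)

theorem lowConst_pos (hs : IsSlow v h c C ε) : 0 < lowConst c C := by
  have := hs.c_pos
  have := hs.C_nonneg
  positivity

/-- Inverts a perturbed triangular system: η.2 controls ξ.2, then η.1 and ξ.2 control ξ.1. It is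
stated for two bare vectors so as to serve both for the derivative and for finite differences. -/
theorem norm_le_of_bounds (hs : IsSlow v h c C ε) {ξ η : Pt d}
    (h1 : ‖η.1 - ξ.1‖ ≤ C * |ξ.2| + ε * ‖ξ‖) (h2 : c * |ξ.2| - ε * ‖ξ‖ ≤ |η.2|) :
    ‖ξ‖ ≤ lowConst c C * ‖η‖ := by
  have hc := hs.c_pos
  have hC := hs.C_nonneg
  have hε := hs.ε_nonneg
  have hη1 : ‖η.1‖ ≤ ‖η‖ := norm_fst_le η
  have hη2 : |η.2| ≤ ‖η‖ := norm_snd_le η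
  set n := ‖ξ‖
  set N := ‖η‖
  have hn : 0 ≤ n := norm_nonneg _
  have hN : 0 ≤ N := norm_nonneg _
  have hS : 0 ≤ N + ε * n := by positivity
  have hq : |ξ.2| ≤ (N + ε * n) / c := by
    rw [le_div_iff₀ hc]; linarith
  have hp : ‖ξ.1‖ ≤ (N + ε * n) + C * ((N + ε * n) / c) := by
    have h3 : ‖ξ.1‖ ≤ ‖η.1‖ + ‖η.1 - ξ.1‖ := by
      have := norm_sub_le η.1 (η.1 - ξ.1)
      rwa [sub_sub_cancel] at this
    have := mul_le_mul_of_nonneg_left hq hC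
    linarith
  have hsplit : (1 + (C + 1) / c) * (N + ε * n) =
      (N + ε * n) + C * ((N + ε * n) / c) + (N + ε * n) / c := by field_simp; ring
  have hSc : 0 ≤ (N + ε * n) / c := by positivity
  have hCS : 0 ≤ C * ((N + ε * n) / c) := by positivity
  -- The norm of the product space is a maximum, so the two components are bounded separately;
  -- `small` then absorbs half of n into the left side.
  have hmax : n ≤ (1 + (C + 1) / c) * (N + ε * n) := by
    rw [hsplit]
    refine max_le ?_ ?_
    · linarith
    · rw [Real.norm_eq_abs]; linarith
  have := mul_le_mul_of_nonneg_right hs.small hn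
  simp only [lowConst]
  nlinarith

theorem norm_le_fderiv (hs : IsSlow v h c C ε) {X : Pt d} (hX : X ∈ halfSpace d) (ξ : Pt d) :
    ‖ξ‖ ≤ lowConst c C * ‖fderiv ℝ (shear v h) X ξ‖ := by
  have hX' : 0 < X.2 := hX
  apply hs.norm_le_of_bounds <;> rw [hs.fderiv_shear hX]
  · simp only [add_sub_cancel_left]
    refine (norm_add_le _ _).trans ?_
    rw [norm_smul, norm_smul, Real.norm_of_nonneg hX'.le, Real.norm_eq_abs, add_comm]
    refine add_le_add ?_ (hs.fderiv_v_le X hX ξ)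
    rw [mul_comm]
    exact mul_le_mul_of_nonneg_right (hs.norm_v_le X hX) (abs_nonneg _)
  · simp only
    have h1 := hs.fderiv_h_le X hX ξ
    have h2 : c * |ξ.2| ≤ |ξ.2 * h X| := by
      rw [abs_mul, mul_comm]
      exact mul_le_mul_of_nonneg_left ((hs.le_h X hX).trans (le_abs_self _)) (abs_nonneg _)
    have h3 : |ξ.2 * h X| ≤ |X.2 * fderiv ℝ h X ξ + ξ.2 * h X| + |X.2 * fderiv ℝ h X ξ| := by
      have := abs_sub (X.2 * fderiv ℝ h X ξ + ξ.2 * h X) (X.2 * fderiv ℝ h X ξ)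
      rwa [add_sub_cancel_left] at this
    rw [abs_mul X.2, abs_of_pos hX'] at h3
    linarith

theorem norm_fderiv_le (hs : IsSlow v h c C ε) {X : Pt d} (hX : X ∈ halfSpace d) (ξ : Pt d) :
    ‖fderiv ℝ (shear v h) X ξ‖ ≤ (1 + C + ε) * ‖ξ‖ := by
  have hX' : 0 < X.2 := hX
  have hξ1 : ‖ξ.1‖ ≤ ‖ξ‖ := norm_fst_le ξ
  have hξ2 : |ξ.2| ≤ ‖ξ‖ := norm_snd_le ξ
  have hC := hs.C_nonneg
  rw [hs.fderiv_shear hX]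
  refine max_le ?_ ?_
  · refine (norm_add_le _ _).trans ((add_le_add_right (norm_add_le _ _) _).trans ?_)
    rw [norm_smul, norm_smul, Real.norm_of_nonneg hX'.le, Real.norm_eq_abs]
    have h1 := hs.fderiv_v_le X hX ξ
    have h2 : |ξ.2| * ‖v X‖ ≤ ‖ξ‖ * C :=
      mul_le_mul hξ2 (hs.norm_v_le X hX) (norm_nonneg _) (norm_nonneg _)
    linarith
  · refine (norm_add_le _ _).trans ?_
    rw [norm_mul, norm_mul, Real.norm_of_nonneg hX'.le, Real.norm_eq_abs, Real.norm_eq_abs,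
      Real.norm_eq_abs]
    have h1 := hs.fderiv_h_le X hX ξ
    have h3 : |h X| ≤ C := by
      rw [abs_of_pos (hs.c_pos.trans_le (hs.le_h X hX))]; exact hs.h_le X hX
    have h2 : |ξ.2| * |h X| ≤ ‖ξ‖ * C := mul_le_mul hξ2 h3 (abs_nonneg _) (norm_nonneg _)
    have := norm_nonneg ξ
    linarith

/-- The mean value theorem for t v and t h on segments of the convex half-space. Invertibility of
each derivative would only give local injectivity. -/
theorem norm_sub_le_shear (hs : IsSlow v h c C ε) {X Y : Pt d} (hX : X ∈ halfSpace d)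
    (hY : Y ∈ halfSpace d) : ‖X - Y‖ ≤ lowConst c C * ‖shear v h X - shear v h Y‖ := by
  apply hs.norm_le_of_bounds
  · have h1 : (shear v h X - shear v h Y).1 - (X - Y).1 = X.2 • v X - Y.2 • v Y := by
      simp [shear, act]; abel
    rw [h1]
    have hseg : ∀ τ ∈ Icc (0 : ℝ) 1, Y + τ • (X - Y) ∈ halfSpace d := fun τ hτ =>
      (convex_halfSpace d).add_smul_sub_mem hY hX hτ
    have hd : ∀ τ ∈ Icc (0 : ℝ) 1, HasDerivWithinAt
        (fun τ : ℝ => (Y + τ • (X - Y)).2 • v (Y + τ • (X - Y)))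
        ((Y + τ • (X - Y)).2 • fderiv ℝ v (Y + τ • (X - Y)) (X - Y) +
          (X - Y).2 • v (Y + τ • (X - Y)))
        (Icc 0 1) τ := by
      intro τ hτ
      have hl : HasDerivAt (fun τ : ℝ => Y + τ • (X - Y)) (X - Y) τ := by
        simpa using ((hasDerivAt_id τ).smul_const (X - Y)).const_add Y
      exact ((hs.hasFDerivAt_smul_v (hseg τ hτ)).comp_hasDerivAt τ hl).hasDerivWithinAt
    have := norm_image_sub_le_of_norm_deriv_le_segment_01'
      (C := C * |(X - Y).2| + ε * ‖X - Y‖) hd fun τ hτ => ?_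
    · simpa using this
    · have hZ := hseg τ (Ico_subset_Icc_self hτ)
      set Z := Y + τ • (X - Y)
      have hZ' : 0 < Z.2 := hZ
      refine (norm_add_le _ _).trans ?_
      rw [norm_smul, norm_smul, Real.norm_of_nonneg hZ'.le, Real.norm_eq_abs, add_comm]
      refine add_le_add ?_ (hs.fderiv_v_le Z hZ _)
      rw [mul_comm]
      exact mul_le_mul_of_nonneg_right (hs.norm_v_le Z hZ) (abs_nonneg _)
  · obtain ⟨Z, hZs, hZ⟩ := domain_mvt
      (fun Z hZ => (hs.hasFDerivAt_mul_h hZ).hasFDerivWithinAt) (convex_halfSpace d) hY hX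
    have hZH : Z ∈ halfSpace d := (convex_halfSpace d).segment_subset hY hX hZs
    have hZ' : 0 < Z.2 := hZH
    have e : (shear v h X - shear v h Y).2 =
        Z.2 * fderiv ℝ h Z (X - Y) + (X - Y).2 * h Z := by
      have : (shear v h X - shear v h Y).2 = X.2 * h X - Y.2 * h Y := rfl
      rw [this, hZ]
      simp; ring
    rw [e]
    have h1 := hs.fderiv_h_le Z hZH (X - Y)
    have h2 : c * |(X - Y).2| ≤ |(X - Y).2 * h Z| := by
      rw [abs_mul, mul_comm]
      exact mul_le_mul_of_nonneg_left ((hs.le_h Z hZH).trans (le_abs_self _)) (abs_nonneg _)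
    have h3 : |(X - Y).2 * h Z| ≤ |Z.2 * fderiv ℝ h Z (X - Y) + (X - Y).2 * h Z| +
        |Z.2 * fderiv ℝ h Z (X - Y)| := by
      have := abs_sub (Z.2 * fderiv ℝ h Z (X - Y) + (X - Y).2 * h Z)
        (Z.2 * fderiv ℝ h Z (X - Y))
      rwa [add_sub_cancel_left] at this
    rw [abs_mul Z.2, abs_of_pos hZ'] at h3
    linarith

theorem norm_shear_sub_le (hs : IsSlow v h c C ε) {X Y : Pt d} (hX : X ∈ halfSpace d)
    (hY : Y ∈ halfSpace d) : ‖shear v h X - shear v h Y‖ ≤ (1 + C + ε) * ‖X - Y‖ := by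
  have hC := hs.C_nonneg
  have hε := hs.ε_nonneg
  refine (convex_halfSpace d).norm_image_sub_le_of_norm_hasFDerivWithin_le
    (fun Z hZ => (((hs.hasFDerivAt_shear hZ).differentiableAt).hasFDerivAt).hasFDerivWithinAt)
    (fun Z hZ => ContinuousLinearMap.opNorm_le_bound _ (by positivity) (hs.norm_fderiv_le hZ)) hY hX

/-- At a boundary point v and h may have no limit, but they are bounded, so t v and t h tend to 0.
-/
theorem tendsto_shear (hs : IsSlow v h c C ε) {X : Pt d} (hX : X ∈ closedHalfSpace d) :
    Tendsto (fun δ : ℝ => shear v h (X.1, X.2 + δ)) (𝓝[>] 0) (𝓝 (shear v h X)) := by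
  have hX : 0 ≤ X.2 := hX
  have hl : Tendsto (fun δ : ℝ => (X.1, X.2 + δ)) (𝓝[>] 0) (𝓝 X) := by
    have : Continuous fun δ : ℝ => (X.1, X.2 + δ) := by fun_prop
    have h := this.tendsto 0
    simp only [add_zero] at h
    exact h.mono_left nhdsWithin_le_nhds
  rcases hX.eq_or_lt with h0 | h0
  · have e : shear v h X = X := by
      ext <;> simp [shear, act, ← h0]
    rw [e]
    have hd : Tendsto (fun δ : ℝ => δ) (𝓝[>] 0) (𝓝 0) := nhdsWithin_le_nhds
    have hpos : ∀ᶠ δ : ℝ in 𝓝[>] 0, 0 < δ := eventually_mem_nhdsWithin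
    refine Tendsto.prodMk_nhds (x := X.1) (y := X.2) ?_ ?_
    · have h1 : Tendsto (fun δ : ℝ => δ • v (X.1, X.2 + δ)) (𝓝[>] 0) (𝓝 0) := by
        refine squeeze_zero_norm' (a := fun δ => δ * C) ?_ (by simpa using hd.mul_const C)
        filter_upwards [hpos] with δ hδ
        rw [norm_smul, Real.norm_of_nonneg hδ.le]
        exact mul_le_mul_of_nonneg_left (hs.norm_v_le _ (by
          change 0 < X.2 + δ; linarith)) hδ.le
      simpa [← h0] using h1.const_add X.1
    · have h1 : Tendsto (fun δ : ℝ => δ * h (X.1, X.2 + δ)) (𝓝[>] 0) (𝓝 0) := by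
        refine squeeze_zero_norm' (a := fun δ => δ * C) ?_ (by simpa using hd.mul_const C)
        filter_upwards [hpos] with δ hδ
        have hm : (X.1, X.2 + δ) ∈ halfSpace d := by change 0 < X.2 + δ; linarith
        rw [norm_mul, Real.norm_of_nonneg hδ.le,
          Real.norm_of_nonneg (hs.c_pos.le.trans (hs.le_h _ hm))]
        exact mul_le_mul_of_nonneg_left (hs.h_le _ hm) hδ.le
      simpa [← h0] using h1
  · exact ((hs.contDiffOn_shear.contDiffAt
      ((isOpen_halfSpace d).mem_nhds h0)).continuousAt.tendsto).comp hl

/-- Raising both points by δ leaves X - Y unchanged and brings them into the open half-space; then δ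
→ 0. -/
theorem shear_bounds (hs : IsSlow v h c C ε) {X Y : Pt d} (hX : X ∈ closedHalfSpace d)
    (hY : Y ∈ closedHalfSpace d) :
    ‖X - Y‖ ≤ lowConst c C * ‖shear v h X - shear v h Y‖ ∧
      ‖shear v h X - shear v h Y‖ ≤ (1 + C + ε) * ‖X - Y‖ := by
  have hlim := ((hs.tendsto_shear hX).sub (hs.tendsto_shear hY)).norm
  have hX : 0 ≤ X.2 := hX
  have hY : 0 ≤ Y.2 := hY
  have hpos : ∀ᶠ δ : ℝ in 𝓝[>] 0, (X.1, X.2 + δ) ∈ halfSpace d ∧ (Y.1, Y.2 + δ) ∈ halfSpace d := by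
    filter_upwards [self_mem_nhdsWithin] with δ hδ
    have hδ : 0 < δ := hδ
    exact ⟨by change 0 < X.2 + δ; linarith, by change 0 < Y.2 + δ; linarith⟩
  have e : ∀ δ : ℝ, (X.1, X.2 + δ) - (Y.1, Y.2 + δ) = X - Y := fun δ => by ext <;> simp
  constructor
  · refine ge_of_tendsto (hlim.const_mul (lowConst c C)) ?_
    filter_upwards [hpos] with δ hδ
    rw [← e δ]; exact hs.norm_sub_le_shear hδ.1 hδ.2
  · refine le_of_tendsto hlim ?_
    filter_upwards [hpos] with δ hδ
    rw [← e δ]; exact hs.norm_shear_sub_le hδ.1 hδ.2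

theorem injOn_shear (hs : IsSlow v h c C ε) : InjOn (shear v h) (halfSpace d) := by
  intro X hX Y hY hXY
  have := hs.norm_sub_le_shear hX hY
  rw [hXY, sub_self, norm_zero, mul_zero] at this
  exact sub_eq_zero.1 (norm_le_zero_iff.1 this)

/-- The derivative of `shear v h`, as a continuous linear equivalence. -/
def fderivEquiv (hs : IsSlow v h c C ε) {X : Pt d} (hX : X ∈ halfSpace d) : Pt d ≃L[ℝ] Pt d :=
  (LinearEquiv.ofInjectiveEndo (fderiv ℝ (shear v h) X : Pt d →ₗ[ℝ] Pt d) (by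
    rw [← LinearMap.ker_eq_bot, LinearMap.ker_eq_bot']
    intro ξ hξ
    have h1 := hs.norm_le_fderiv hX ξ
    have h2 : fderiv ℝ (shear v h) X ξ = 0 := hξ
    rw [h2, norm_zero, mul_zero] at h1
    exact norm_le_zero_iff.1 h1)).toContinuousLinearEquiv

theorem hasFDerivAt_fderivEquiv (hs : IsSlow v h c C ε) {X : Pt d} (hX : X ∈ halfSpace d) :
    HasFDerivAt (shear v h) (hs.fderivEquiv hX : Pt d →L[ℝ] Pt d) X := by
  have : (hs.fderivEquiv hX : Pt d →L[ℝ] Pt d) = fderiv ℝ (shear v h) X := by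
    ext ξ <;> rfl
  rw [this]
  exact (hs.hasFDerivAt_shear hX).differentiableAt.hasFDerivAt

theorem map_nhds_shear (hs : IsSlow v h c C ε) {X : Pt d} (hX : X ∈ halfSpace d) :
    map (shear v h) (𝓝 X) = 𝓝 (shear v h X) :=
  ((hs.contDiffOn_shear.contDiffAt ((isOpen_halfSpace d).mem_nhds hX)).hasStrictFDerivAt'
    (hs.hasFDerivAt_fderivEquiv hX) (by simp)).map_nhds_eq_of_equiv

/-- The image is open by the inverse function theorem and relatively closed by the lower Lipschitz
bound; the half-space is connected. -/
theorem surjOn_shear (hs : IsSlow v h c C ε) :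
    SurjOn (shear v h) (halfSpace d) (halfSpace d) := by
  refine (convex_halfSpace d).isPreconnected.subset_of_closure_inter_subset ?_ ?_ ?_
  · rw [isOpen_iff_mem_nhds]
    rintro _ ⟨X, hX, rfl⟩
    rw [← hs.map_nhds_shear hX]
    exact image_mem_map ((isOpen_halfSpace d).mem_nhds hX)
  · have h1 : ((0, 1) : Pt d) ∈ halfSpace d := show (0 : ℝ) < 1 from one_pos
    exact ⟨_, hs.shear_mem h1, mem_image_of_mem _ h1⟩
  · rintro Y ⟨hYc, hY⟩
    have hY' : 0 < Y.2 := hY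
    obtain ⟨y, hy, hlim⟩ := mem_closure_iff_seq_limit.1 hYc
    choose X hXH hXy using hy
    have hcau : CauchySeq X := by
      rw [Metric.cauchySeq_iff']
      intro e he
      have hp := hs.lowConst_pos
      obtain ⟨N, hN⟩ := Metric.cauchySeq_iff'.1 hlim.cauchySeq (e / lowConst c C) (by positivity)
      refine ⟨N, fun n hn => ?_⟩
      have h1 := hN n hn
      rw [dist_eq_norm] at h1 ⊢
      have h2 := hs.norm_sub_le_shear (hXH n) (hXH N)
      rw [hXy, hXy] at h2
      rw [lt_div_iff₀' hp] at h1
      exact h2.trans_lt h1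
    obtain ⟨Z, hZ⟩ := cauchySeq_tendsto_of_complete hcau
    have hZ2 : Tendsto (fun n => (X n).2) atTop (𝓝 Z.2) := (continuous_snd.tendsto Z).comp hZ
    have hy2 : Tendsto (fun n => (y n).2) atTop (𝓝 Y.2) := (continuous_snd.tendsto Y).comp hlim
    -- The limit of the preimages does not fall on the boundary: heights are multiplied by at most
    -- C.
    have hle : Y.2 ≤ Z.2 * C := by
      refine le_of_tendsto_of_tendsto' hy2 (hZ2.mul_const C) fun n => ?_
      rw [← hXy n]
      exact mul_le_mul_of_nonneg_left (hs.h_le _ (hXH n)) (le_of_lt (hXH n))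
    have hZH : Z ∈ halfSpace d := by
      change 0 < Z.2
      by_contra hneg
      have := mul_nonpos_of_nonpos_of_nonneg (not_lt.1 hneg) hs.C_nonneg
      linarith
    refine ⟨Z, hZH, ?_⟩
    have hcont := (hs.contDiffOn_shear.contDiffAt
      ((isOpen_halfSpace d).mem_nhds hZH)).continuousAt.tendsto.comp hZ
    refine tendsto_nhds_unique hcont (hlim.congr fun n => (hXy n).symm)

theorem isBiLipschitzChange (hs : IsSlow v h c C ε) : IsBiLipschitzChange (shear v h) := by
  have hC := hs.C_nonneg
  have hε := hs.ε_nonneg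
  have hp := hs.lowConst_pos
  refine ⟨⟨fun X hX => hs.shear_mem hX, hs.injOn_shear, hs.surjOn_shear⟩,
    max (lowConst c C) (1 + C + ε), by positivity, fun X hX Y hY => ?_⟩
  obtain ⟨h1, h2⟩ := hs.shear_bounds hX hY
  rw [dist_eq_norm, dist_eq_norm]
  constructor
  · rw [inv_mul_le_iff₀ (by positivity)]
    exact h1.trans (mul_le_mul_of_nonneg_right (le_max_left _ _) (norm_nonneg _))
  · exact h2.trans (mul_le_mul_of_nonneg_right (le_max_right _ _) (norm_nonneg _))

end IsSlow

/-! ### Transport of weak solutions by a diffeomorphism -/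

/-- `σ` is a smooth inverse of the smooth map `ρ` on the half-space. -/
structure IsDiffeo {d : ℕ} (ρ σ : Pt d → Pt d) : Prop where
  contDiffOn : ContDiffOn ℝ ∞ ρ (halfSpace d)
  contDiffOn_inv : ContDiffOn ℝ ∞ σ (halfSpace d)
  mapsTo : MapsTo ρ (halfSpace d) (halfSpace d)
  mapsTo_inv : MapsTo σ (halfSpace d) (halfSpace d)
  left_inv : ∀ X ∈ halfSpace d, σ (ρ X) = X
  right_inv : ∀ X ∈ halfSpace d, ρ (σ X) = X

theorem IsSlow.exists_isDiffeo {d : ℕ} {v : Pt d → EuclideanSpace ℝ (Fin d)} {h : Pt d → ℝ}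
    {c C ε : ℝ} (hs : IsSlow v h c C ε) : ∃ σ, IsDiffeo (shear v h) σ := by
  have hbij : BijOn (shear v h) (halfSpace d) (halfSpace d) :=
    ⟨fun X hX => hs.shear_mem hX, hs.injOn_shear, hs.surjOn_shear⟩
  have hinv := hbij.invOn_invFunOn
  set σ := Function.invFunOn (shear v h) (halfSpace d)
  have hσ : MapsTo σ (halfSpace d) (halfSpace d) := hbij.surjOn.mapsTo_invFunOn
  have hσc : ContinuousOn σ (halfSpace d) := by
    intro Y hY
    refine ContinuousAt.continuousWithinAt ?_
    have h1 := hs.map_nhds_shear (hσ hY)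
    rw [hinv.2 hY] at h1
    rw [ContinuousAt, ← h1, tendsto_map'_iff]
    refine (tendsto_id).congr' ?_
    filter_upwards [(isOpen_halfSpace d).mem_nhds (hσ hY)] with X hX
    exact (hinv.1 hX).symm
  let e : OpenPartialHomeomorph (Pt d) (Pt d) :=
    { toFun := shear v h
      invFun := σ
      source := halfSpace d
      target := halfSpace d
      map_source' := fun X hX => hs.shear_mem hX
      map_target' := fun X hX => hσ hX
      left_inv' := fun X hX => hinv.1 hX
      right_inv' := fun X hX => hinv.2 hX
      open_source := isOpen_halfSpace d
      open_target := isOpen_halfSpace d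
      continuousOn_toFun := hs.contDiffOn_shear.continuousOn
      continuousOn_invFun := hσc }
  refine ⟨σ, hs.contDiffOn_shear, fun Y hY => ContDiffAt.contDiffWithinAt ?_, hbij.mapsTo, hσ,
    fun X hX => hinv.1 hX, fun X hX => hinv.2 hX⟩
  exact e.contDiffAt_symm hY (hs.hasFDerivAt_fderivEquiv (hσ hY))
    (hs.contDiffOn_shear.contDiffAt ((isOpen_halfSpace d).mem_nhds (hσ hY)))

theorem det_jacobian {d : ℕ} (ρ : Pt d → Pt d) (X : Pt d) :
    (jacobian ρ X).det = (fderiv ℝ ρ X).det := by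
  rw [jacobian, LinearMap.det_toMatrix]

theorem jacobian_apply {d : ℕ} (ρ : Pt d → Pt d) (X : Pt d) (i j : Idx d) :
    jacobian ρ X i j = (stdBasis d).repr (fderiv ℝ ρ X (stdBasis d j)) i := by
  rw [jacobian, LinearMap.toMatrix_apply]
  rfl

theorem grad_comp {d : ℕ} {ρ : Pt d → Pt d} {w : Pt d → ℝ} {X : Pt d}
    (hρ : DifferentiableAt ℝ ρ X) (hw : DifferentiableAt ℝ w (ρ X)) :
    grad (fun Y => w (ρ Y)) X = (jacobian ρ X).transpose.mulVec (grad w (ρ X)) := by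
  ext i
  have h1 : fderiv ℝ (fun Y => w (ρ Y)) X = (fderiv ℝ w (ρ X)).comp (fderiv ℝ ρ X) :=
    fderiv_comp X hw hρ
  rw [grad, h1, ContinuousLinearMap.comp_apply]
  conv_lhs => rw [← (stdBasis d).sum_repr (fderiv ℝ ρ X (stdBasis d i)), map_sum]
  simp only [Matrix.mulVec, dotProduct, Matrix.transpose_apply, jacobian_apply, map_smul,
    smul_eq_mul, grad]

theorem IsTest.continuous_grad {d : ℕ} {φ : Pt d → ℝ} (h : IsTest φ) (i : Idx d) :
    Continuous fun X => grad φ X i :=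
  (h.1.continuous_fderiv (by simp)).clm_apply continuous_const

theorem IsTest.grad_eq_zero {d : ℕ} {φ : Pt d → ℝ} {X : Pt d} (hX : X ∉ tsupport φ) (i : Idx d) :
    grad φ X i = 0 := by
  have h2 : fderiv ℝ φ X = 0 := by
    by_contra h
    exact hX (support_fderiv_subset ℝ h)
  simp [grad, h2]

/-- The changes of variable are controlled only inside the half-space, so pulled-back test functions
are extended by zero; smoothness survives because they vanish near the boundary. -/
theorem isTest_indicator {d : ℕ} {f : Pt d → ℝ} (hf : ContDiffOn ℝ ∞ f (halfSpace d))
    {K : Set (Pt d)} (hK : IsCompact K) (hKH : K ⊆ halfSpace d)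
    (h0 : ∀ X ∈ halfSpace d, X ∉ K → f X = 0) : IsTest ((halfSpace d).indicator f) := by
  have hz : ∀ X ∉ K, (halfSpace d).indicator f X = 0 := fun X hX => by
    by_cases h : X ∈ halfSpace d
    · rw [indicator_of_mem h, h0 X h hX]
    · rw [indicator_of_notMem h]
  refine ⟨?_, HasCompactSupport.intro hK hz, ?_⟩
  · rw [contDiff_iff_contDiffAt]
    intro X
    by_cases h : X ∈ halfSpace d
    · refine (hf.contDiffAt ((isOpen_halfSpace d).mem_nhds h)).congr_of_eventuallyEq ?_
      filter_upwards [(isOpen_halfSpace d).mem_nhds h] with Y hY using indicator_of_mem hY f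
    · have : (halfSpace d).indicator f =ᶠ[𝓝 X] fun _ => 0 := by
        filter_upwards [hK.isClosed.isOpen_compl.mem_nhds fun hX => h (hKH hX)] with Y hY
          using hz Y hY
      exact contDiffAt_const.congr_of_eventuallyEq this
  · refine (closure_minimal (fun X hX => ?_) hK.isClosed).trans hKH
    by_contra h
    exact hX (hz X h)

theorem integrableOn_mul_of_tsupport {d : ℕ} {f η : Pt d → ℝ} (hf : InL2loc f)
    (hη : Continuous η) {K : Set (Pt d)} (hK : IsCompact K) (hKH : K ⊆ halfSpace d)
    (h0 : ∀ X ∉ K, η X = 0) : IntegrableOn (fun X => f X * η X) (halfSpace d) := by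
  have : IsFiniteMeasure (volume.restrict K) := ⟨by simpa using hK.measure_lt_top⟩
  have h1 : IntegrableOn f K := (hf K hK hKH).integrable (by norm_num)
  have h2 : IntegrableOn (fun X => f X * η X) K := h1.mul_continuousOn hη.continuousOn hK
  exact h2.of_forall_sdiff_eq_zero (measurableSet_halfSpace d) fun X hX => by simp [h0 X hX.2]

theorem InL2loc.of_continuousOn {d : ℕ} {f : Pt d → ℝ} (hf : ContinuousOn f (halfSpace d)) :
    InL2loc f := fun K hK hKH => by
  have : IsFiniteMeasure (volume.restrict K) := ⟨by simpa using hK.measure_lt_top⟩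
  obtain ⟨C, hC⟩ := hK.exists_bound_of_continuousOn (hf.mono hKH)
  exact MemLp.of_bound ((hf.mono hKH).aestronglyMeasurable hK.measurableSet) C
    ((ae_restrict_iff' hK.measurableSet).2 (ae_of_all _ hC))

theorem InL2loc.mul_continuousOn {d : ℕ} {f η : Pt d → ℝ} (hf : InL2loc f)
    (hη : ContinuousOn η (halfSpace d)) : InL2loc fun X => η X * f X := fun K hK hKH => by
  obtain ⟨C, hC⟩ := hK.exists_bound_of_continuousOn (hη.mono hKH)
  refine MemLp.of_le_mul (c := C) (hf K hK hKH)
    (((hη.mono hKH).aestronglyMeasurable hK.measurableSet).mul (hf K hK hKH).1)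
    ((ae_restrict_iff' hK.measurableSet).2 (ae_of_all _ fun X hX => ?_))
  rw [norm_mul]
  exact mul_le_mul_of_nonneg_right (hC X hX) (norm_nonneg _)

theorem setIntegral_halfSpace_eq {d : ℕ} {f : Pt d → ℝ} (h : ∀ X ∉ halfSpace d, f X = 0) :
    ∫ X in halfSpace d, f X = ∫ X, f X :=
  setIntegral_eq_integral_of_forall_compl_eq_zero h

theorem IsTest.integral_mul_grad {d : ℕ} {f g : Pt d → ℝ} (hf : IsTest f) (hg : IsTest g)
    (i : Idx d) :
    ∫ X in halfSpace d, f X * grad g X i = -∫ X in halfSpace d, grad f X i * g X := by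
  have hz : ∀ {f : Pt d → ℝ}, IsTest f → ∀ X ∉ halfSpace d, f X = 0 := fun hf X hX =>
    image_eq_zero_of_notMem_tsupport fun h => hX (hf.2.2 h)
  rw [setIntegral_halfSpace_eq fun X hX => by rw [hz hf X hX, zero_mul],
    setIntegral_halfSpace_eq fun X hX => by rw [hz hg X hX, mul_zero]]
  have hi : ∀ {f g : Pt d → ℝ}, Continuous f → Continuous g → HasCompactSupport f →
      Integrable fun X => f X * g X := fun hf hg hc =>
    (hf.mul hg).integrable_of_hasCompactSupport hc.mul_right
  refine integral_mul_fderiv_eq_neg_fderiv_mul_of_integrable ?_ ?_ ?_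
    (fun X _ => hf.1.differentiable (by simp) X) (fun X _ => hg.1.differentiable (by simp) X)
  · refine ((hf.continuous_grad i).mul hg.1.continuous).integrable_of_hasCompactSupport
      hg.2.1.mul_left
  · exact hi hf.1.continuous (hg.continuous_grad i) hf.2.1
  · exact hi hf.1.continuous hg.1.continuous hf.2.1

namespace IsDiffeo

variable {d : ℕ} {ρ σ : Pt d → Pt d}

theorem symm (h : IsDiffeo ρ σ) : IsDiffeo σ ρ :=
  ⟨h.contDiffOn_inv, h.contDiffOn, h.mapsTo_inv, h.mapsTo, h.right_inv, h.left_inv⟩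

theorem differentiableAt (h : IsDiffeo ρ σ) {X : Pt d} (hX : X ∈ halfSpace d) :
    DifferentiableAt ℝ ρ X :=
  (h.contDiffOn.contDiffAt ((isOpen_halfSpace d).mem_nhds hX)).differentiableAt (by simp)

theorem injOn (h : IsDiffeo ρ σ) : InjOn ρ (halfSpace d) := fun X hX Y hY e => by
  rw [← h.left_inv X hX, e, h.left_inv Y hY]

theorem image_eq (h : IsDiffeo ρ σ) : ρ '' halfSpace d = halfSpace d :=
  Subset.antisymm (image_subset_iff.2 h.mapsTo) fun Y hY =>
    ⟨σ Y, h.mapsTo_inv hY, h.right_inv Y hY⟩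

theorem fderiv_comp_fderiv (h : IsDiffeo ρ σ) {X : Pt d} (hX : X ∈ halfSpace d) :
    (fderiv ℝ σ (ρ X)).comp (fderiv ℝ ρ X) = ContinuousLinearMap.id ℝ (Pt d) := by
  rw [← fderiv_comp X (h.symm.differentiableAt (h.mapsTo hX)) (h.differentiableAt hX)]
  have : σ ∘ ρ =ᶠ[𝓝 X] id := by
    filter_upwards [(isOpen_halfSpace d).mem_nhds hX] with Y hY using h.left_inv Y hY
  rw [this.fderiv_eq, fderiv_id]

theorem jacobian_mul (h : IsDiffeo ρ σ) {X : Pt d} (hX : X ∈ halfSpace d) :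
    jacobian σ (ρ X) * jacobian ρ X = 1 := by
  rw [jacobian, jacobian, ← LinearMap.toMatrix_comp]
  have := congrArg (fun L : Pt d →L[ℝ] Pt d => (L : Pt d →ₗ[ℝ] Pt d)) (h.fderiv_comp_fderiv hX)
  exact (congrArg (LinearMap.toMatrix (stdBasis d) (stdBasis d)) this).trans
    (LinearMap.toMatrix_id _)

theorem jacobian_inv (h : IsDiffeo ρ σ) {X : Pt d} (hX : X ∈ halfSpace d) :
    (jacobian ρ X)⁻¹ = jacobian σ (ρ X) :=
  Matrix.inv_eq_left_inv (h.jacobian_mul hX)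

theorem det_ne_zero (h : IsDiffeo ρ σ) {X : Pt d} (hX : X ∈ halfSpace d) :
    (jacobian ρ X).det ≠ 0 := by
  have := congrArg Matrix.det (h.jacobian_mul hX)
  rw [Matrix.det_mul, Matrix.det_one] at this
  exact right_ne_zero_of_mul_eq_one this

theorem contDiffOn_jacobian (h : IsDiffeo ρ σ) (i j : Idx d) :
    ContDiffOn ℝ ∞ (fun X => jacobian ρ X i j) (halfSpace d) := by
  have h1 : ContDiffOn ℝ ∞ (fun X => fderiv ℝ ρ X (stdBasis d j)) (halfSpace d) :=
    (h.contDiffOn.fderiv_of_isOpen (isOpen_halfSpace d) (by simp)).clm_apply contDiffOn_const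
  have h2 : ContDiff ℝ ∞ fun Y : Pt d => (stdBasis d).repr Y i :=
    (LinearMap.toContinuousLinearMap ((stdBasis d).coord i)).contDiff
  simp only [jacobian_apply]
  exact h2.comp_contDiffOn h1

theorem contDiffOn_abs_det (h : IsDiffeo ρ σ) :
    ContDiffOn ℝ ∞ (fun X => |(jacobian ρ X).det|) (halfSpace d) := by
  have h1 : ContDiffOn ℝ ∞ (fun X => (jacobian ρ X).det) (halfSpace d) := by
    simp only [Matrix.det_apply]
    refine ContDiffOn.sum fun s _ => ContDiffOn.const_smul _ ?_
    exact contDiffOn_prod fun i _ => h.contDiffOn_jacobian _ _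
  intro X hX
  exact (contDiffAt_abs (h.det_ne_zero hX)).comp_contDiffWithinAt X (h1 X hX)

theorem integral_eq (h : IsDiffeo ρ σ) (g : Pt d → ℝ) :
    ∫ Y in halfSpace d, g Y = ∫ X in halfSpace d, |(jacobian ρ X).det| * g (ρ X) := by
  have := integral_image_eq_integral_abs_det_fderiv_smul volume (measurableSet_halfSpace d)
    (fun X hX => (h.differentiableAt hX).hasFDerivAt.hasFDerivWithinAt) h.injOn g
  rw [h.image_eq] at this
  simpa only [det_jacobian, smul_eq_mul] using this

theorem setLIntegral_comp_le (h : IsDiffeo ρ σ) {K : Set (Pt d)} (hK : MeasurableSet K)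
    (hKH : K ⊆ halfSpace d) {C : ℝ} (hC : ∀ X ∈ K, 1 ≤ C * |(jacobian ρ X).det|)
    (F : Pt d → ℝ≥0∞) :
    ∫⁻ X in K, F (ρ X) ≤ ENNReal.ofReal C * ∫⁻ Y in ρ '' K, F Y := by
  rw [lintegral_image_eq_lintegral_abs_det_fderiv_mul volume hK
    (fun X hX => (h.differentiableAt (hKH hX)).hasFDerivAt.hasFDerivWithinAt)
    (h.injOn.mono hKH), ← lintegral_const_mul' _ _ ENNReal.ofReal_ne_top]
  refine setLIntegral_mono' hK fun X hX => ?_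
  rw [← mul_assoc, ← ENNReal.ofReal_mul' (abs_nonneg _), ← det_jacobian]
  exact le_mul_of_one_le_left zero_le (ENNReal.one_le_ofReal.2 (hC X hX))

theorem map_restrict_le (h : IsDiffeo ρ σ) {K : Set (Pt d)} (hK : MeasurableSet K)
    (hKH : K ⊆ halfSpace d) {C : ℝ} (hC : ∀ X ∈ K, 1 ≤ C * |(jacobian ρ X).det|) :
    Measure.map ρ (volume.restrict K) ≤ ENNReal.ofReal C • volume.restrict (ρ '' K) := by
  have hm : AEMeasurable ρ (volume.restrict K) :=
    (h.contDiffOn.continuousOn.mono hKH).aemeasurable hK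
  refine Measure.le_iff.2 fun S hS => ?_
  rw [Measure.map_apply_of_aemeasurable hm hS, Measure.smul_apply, smul_eq_mul]
  have h1 := h.setLIntegral_comp_le hK hKH hC (S.indicator 1)
  rw [lintegral_indicator_one hS] at h1
  refine le_trans ?_ h1
  have h2 : ∫⁻ X in K, S.indicator (1 : Pt d → ℝ≥0∞) (ρ X) =
      ∫⁻ y, S.indicator (1 : Pt d → ℝ≥0∞) y ∂(Measure.map ρ (volume.restrict K)) :=
    (lintegral_map' ((measurable_const.indicator hS).aemeasurable) hm).symm
  rw [h2, lintegral_indicator_one hS, Measure.map_apply_of_aemeasurable hm hS]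

theorem inL2loc_comp (h : IsDiffeo ρ σ) {u : Pt d → ℝ} (hu : InL2loc u) :
    InL2loc fun X => u (ρ X) := fun K hK hKH => by
  have hc : ContinuousOn (fun X => |(jacobian ρ X).det|⁻¹) K :=
    ((h.contDiffOn_abs_det.continuousOn).mono hKH).inv₀ fun X hX =>
      abs_ne_zero.2 (h.det_ne_zero (hKH hX))
  obtain ⟨C, hC⟩ := hK.exists_bound_of_continuousOn hc
  have hle := h.map_restrict_le hK.measurableSet hKH (C := C) fun X hX => by
    have h1 := hC X hX
    have h2 : 0 < |(jacobian ρ X).det| := abs_pos.2 (h.det_ne_zero (hKH hX))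
    rw [Real.norm_of_nonneg (by positivity), inv_le_iff_one_le_mul₀ h2] at h1
    exact h1
  have hρc := h.contDiffOn.continuousOn.mono hKH
  have h3 := (hu (ρ '' K) (hK.image_of_continuousOn hρc)
    (image_subset_iff.2 fun X hX => h.mapsTo (hKH hX)))
  exact (h3.of_measure_le_smul ENNReal.ofReal_ne_top hle).comp_of_map
    (hρc.aemeasurable hK.measurableSet)

theorem isTest_comp (h : IsDiffeo ρ σ) {w : Pt d → ℝ} (hw : IsTest w) :
    IsTest ((halfSpace d).indicator fun X => w (ρ X)) := by
  refine isTest_indicator (hw.1.comp_contDiffOn h.contDiffOn)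
    (K := σ '' tsupport w) ((hw.2.1 : IsCompact (tsupport w)).image_of_continuousOn
      (h.contDiffOn_inv.continuousOn.mono hw.2.2))
    (image_subset_iff.2 fun X hX => h.mapsTo_inv (hw.2.2 hX)) fun X hX hXK => ?_
  refine image_eq_zero_of_notMem_tsupport fun hmem => hXK ⟨ρ X, hmem, h.left_inv X hX⟩

theorem grad_indicator_comp (h : IsDiffeo ρ σ) {w : Pt d → ℝ} (hw : IsTest w) {X : Pt d}
    (hX : X ∈ halfSpace d) :
    grad ((halfSpace d).indicator fun X => w (ρ X)) X =
      (jacobian ρ X).transpose.mulVec (grad w (ρ X)) := by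
  rw [← grad_comp (h.differentiableAt hX) (hw.1.differentiable (by simp) _)]
  have : (halfSpace d).indicator (fun X => w (ρ X)) =ᶠ[𝓝 X] fun X => w (ρ X) := by
    filter_upwards [(isOpen_halfSpace d).mem_nhds hX] with Y hY
    rw [indicator_of_mem hY]
  ext i
  rw [grad, grad, this.fderiv_eq]

/-- The components of the Piola transform of `φ e_i`. -/
def piola (ρ σ : Pt d → Pt d) (φ : Pt d → ℝ) (i j : Idx d) : Pt d → ℝ :=
  (halfSpace d).indicator fun Y => |(jacobian σ Y).det| * (φ (σ Y) * jacobian ρ (σ Y) j i)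

theorem isTest_piola (h : IsDiffeo ρ σ) {φ : Pt d → ℝ} (hφ : IsTest φ) (i j : Idx d) :
    IsTest (piola ρ σ φ i j) := by
  refine isTest_indicator (K := ρ '' tsupport φ) ?_
    ((hφ.2.1 : IsCompact (tsupport φ)).image_of_continuousOn
      (h.contDiffOn.continuousOn.mono hφ.2.2))
    (image_subset_iff.2 fun X hX => h.mapsTo (hφ.2.2 hX)) fun Y hY hYK => ?_
  · exact h.symm.contDiffOn_abs_det.mul ((hφ.1.comp_contDiffOn h.contDiffOn_inv).mul
      ((h.contDiffOn_jacobian j i).comp h.contDiffOn_inv h.mapsTo_inv))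
  · have : φ (σ Y) = 0 :=
      image_eq_zero_of_notMem_tsupport fun hmem => hYK ⟨σ Y, hmem, h.right_inv Y hY⟩
    simp [this]

theorem integrableOn_mul_grad {f : Pt d → ℝ} (hf : InL2loc f) {φ : Pt d → ℝ} (hφ : IsTest φ)
    (i : Idx d) : IntegrableOn (fun X => f X * grad φ X i) (halfSpace d) :=
  integrableOn_mul_of_tsupport hf (hφ.continuous_grad i) hφ.2.1 hφ.2.2
    fun _ hX => IsTest.grad_eq_zero hX i

theorem integrableOn_mul_test {f : Pt d → ℝ} (hf : InL2loc f) {φ : Pt d → ℝ} (hφ : IsTest φ) :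
    IntegrableOn (fun X => f X * φ X) (halfSpace d) :=
  integrableOn_mul_of_tsupport hf hφ.1.continuous hφ.2.1 hφ.2.2
    fun _ hX => image_eq_zero_of_notMem_tsupport hX

/-- The Piola identity. -/
theorem sum_grad_piola (h : IsDiffeo ρ σ) {φ : Pt d → ℝ} (hφ : IsTest φ) (i : Idx d) :
    ∀ᵐ Y ∂(volume : Measure (Pt d)), Y ∈ halfSpace d →
      ∑ j, grad (piola ρ σ φ i j) Y j = |(jacobian σ Y).det| * grad φ (σ Y) i := by
  have hc2 : ContinuousOn (fun Y => |(jacobian σ Y).det| * grad φ (σ Y) i) (halfSpace d) :=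
    h.symm.contDiffOn_abs_det.continuousOn.mul
      ((hφ.continuous_grad i).comp_continuousOn h.contDiffOn_inv.continuousOn)
  have hc1 : Continuous fun Y => ∑ j, grad (piola ρ σ φ i j) Y j :=
    continuous_finsetSum _ fun j _ => (h.isTest_piola hφ i j).continuous_grad j
  have hc : ContinuousOn (fun Y => ∑ j, grad (piola ρ σ φ i j) Y j -
      |(jacobian σ Y).det| * grad φ (σ Y) i) (halfSpace d) := hc1.continuousOn.sub hc2
  -- The identity is proved in weak form, against every test function w. No second derivative of ρ
  -- nor derivative of a determinant has to be computed.
  have key := (isOpen_halfSpace d).ae_eq_zero_of_integral_contDiff_smul_eq_zero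
    (hc.locallyIntegrableOn (measurableSet_halfSpace d)) (μ := volume) ?_
  · filter_upwards [key] with Y hY hYH
    exact sub_eq_zero.1 (hY hYH)
  intro w hw1 hw2 hw3
  have hw : IsTest w := ⟨hw1, hw2, hw3⟩
  have hw0 : ∀ X ∉ halfSpace d, w X = 0 := fun X hX =>
    image_eq_zero_of_notMem_tsupport fun h => hX (hw3 h)
  rw [← setIntegral_halfSpace_eq fun X hX => by simp [hw0 X hX]]
  have hw' := h.isTest_comp hw
  have e1 : ∫ Y in halfSpace d, (|(jacobian σ Y).det| * grad φ (σ Y) i) * w Y =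
      ∑ j, ∫ Y in halfSpace d, grad (piola ρ σ φ i j) Y j * w Y := by
    -- Pull back to X, integrate by parts onto w ∘ ρ, apply the chain rule, push forward again and
    -- integrate by parts in Y.
    calc ∫ Y in halfSpace d, (|(jacobian σ Y).det| * grad φ (σ Y) i) * w Y
        = ∫ X in halfSpace d, grad φ X i * (halfSpace d).indicator (fun X => w (ρ X)) X := by
          rw [h.symm.integral_eq
            (fun X => grad φ X i * (halfSpace d).indicator (fun X => w (ρ X)) X)]
          refine setIntegral_congr_fun (measurableSet_halfSpace d) fun Y hY => ?_
          simp only [indicator_of_mem (h.mapsTo_inv hY), h.right_inv Y hY]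
          ring
      _ = -∫ X in halfSpace d, φ X * grad ((halfSpace d).indicator fun X => w (ρ X)) X i := by
          rw [hφ.integral_mul_grad hw', neg_neg]
      _ = -∫ Y in halfSpace d, ∑ j, piola ρ σ φ i j Y * grad w Y j := by
          rw [h.symm.integral_eq]
          congr 1
          refine setIntegral_congr_fun (measurableSet_halfSpace d) fun Y hY => ?_
          simp only [h.grad_indicator_comp hw (h.mapsTo_inv hY), h.right_inv Y hY,
            Matrix.mulVec, dotProduct, Matrix.transpose_apply, piola, indicator_of_mem hY,
            Finset.mul_sum]
          refine Finset.sum_congr rfl fun j _ => ?_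
          ring
      _ = _ := by
          rw [integral_finsetSum _ fun j _ => integrableOn_mul_grad
            (InL2loc.of_continuousOn (h.isTest_piola hφ i j).1.continuous.continuousOn) hw j,
            ← Finset.sum_neg_distrib]
          refine Finset.sum_congr rfl fun j _ => ?_
          rw [(h.isTest_piola hφ i j).integral_mul_grad hw, neg_neg]
  have e2 : ∑ j, ∫ Y in halfSpace d, grad (piola ρ σ φ i j) Y j * w Y =
      ∫ Y in halfSpace d, (∑ j, grad (piola ρ σ φ i j) Y j) * w Y := by
    simp only [Finset.sum_mul]
    rw [integral_finsetSum _ fun j _ => integrableOn_mul_test (InL2loc.of_continuousOn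
      ((h.isTest_piola hφ i j).continuous_grad j).continuousOn) hw]
  have e3 : ∀ Y, w Y • (∑ j, grad (piola ρ σ φ i j) Y j -
      |(jacobian σ Y).det| * grad φ (σ Y) i) = (∑ j, grad (piola ρ σ φ i j) Y j) * w Y -
      (|(jacobian σ Y).det| * grad φ (σ Y) i) * w Y := fun Y => by
    rw [smul_eq_mul]; ring
  simp only [e3]
  rw [integral_sub (integrableOn_mul_test (InL2loc.of_continuousOn hc1.continuousOn) hw)
    (integrableOn_mul_test (InL2loc.of_continuousOn hc2) hw), e1, e2, sub_self]

/-- Testing u ∘ ρ against ∂ᵢφ amounts, by the Piola identity, to testing u against the divergence of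
the Piola field of φ eᵢ, whose components are admissible test functions. -/
theorem isWeakGradient_comp (h : IsDiffeo ρ σ) {u : Pt d → ℝ} {g : Pt d → Idx d → ℝ}
    (hu : InL2loc u) (hg : ∀ i, InL2loc fun X => g X i) (hug : IsWeakGradient u g) :
    IsWeakGradient (fun X => u (ρ X))
      (fun X => (jacobian ρ X).transpose.mulVec (g (ρ X))) := by
  intro φ hφ i
  calc ∫ X in halfSpace d, u (ρ X) * grad φ X i
      = ∫ Y in halfSpace d, u Y * (|(jacobian σ Y).det| * grad φ (σ Y) i) := by
        rw [h.symm.integral_eq]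
        refine setIntegral_congr_fun (measurableSet_halfSpace d) fun Y hY => ?_
        simp only [h.right_inv Y hY]
        ring
    _ = ∫ Y in halfSpace d, ∑ j, u Y * grad (piola ρ σ φ i j) Y j := by
        refine setIntegral_congr_ae (measurableSet_halfSpace d) ?_
        filter_upwards [h.sum_grad_piola hφ i] with Y hY hYH
        rw [← hY hYH, Finset.mul_sum]
    _ = ∑ j, ∫ Y in halfSpace d, u Y * grad (piola ρ σ φ i j) Y j :=
        integral_finsetSum _ fun j _ => integrableOn_mul_grad hu (h.isTest_piola hφ i j) j
    _ = -∫ Y in halfSpace d, ∑ j, g Y j * piola ρ σ φ i j Y := by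
        rw [integral_finsetSum _ fun j _ => integrableOn_mul_test (hg j) (h.isTest_piola hφ i j),
          ← Finset.sum_neg_distrib]
        exact Finset.sum_congr rfl fun j _ => hug _ (h.isTest_piola hφ i j) j
    _ = _ := by
        rw [h.symm.integral_eq (fun X => (jacobian ρ X).transpose.mulVec (g (ρ X)) i * φ X)]
        congr 1
        refine setIntegral_congr_fun (measurableSet_halfSpace d) fun Y hY => ?_
        simp only [h.right_inv Y hY, Matrix.mulVec, dotProduct, Matrix.transpose_apply, piola,
          indicator_of_mem hY, Finset.mul_sum, Finset.sum_mul]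
        refine Finset.sum_congr rfl fun j _ => ?_
        ring

/-- Gradients of compositions are Jᵀ times a gradient, and the outer factors of the conjugate matrix
cancel these Jᵀ. The same identity yields both the weak equation and ellipticity. -/
theorem conjugate_mulVec (h : IsDiffeo ρ σ) (A : Pt d → Mat d) {X : Pt d}
    (hX : X ∈ halfSpace d) (y z : Idx d → ℝ) :
    (conjugate A ρ X).mulVec ((jacobian ρ X).transpose.mulVec y) ⬝ᵥ
      (jacobian ρ X).transpose.mulVec z =
      |(jacobian ρ X).det| * ((A (ρ X)).mulVec y ⬝ᵥ z) := by
  have hdet : IsUnit (jacobian ρ X).det := (h.det_ne_zero hX).isUnit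
  rw [conjugate, Matrix.smul_mulVec, smul_dotProduct, smul_eq_mul, Matrix.mulVec_mulVec,
    Matrix.mul_assoc, ← Matrix.transpose_mul, Matrix.mul_nonsing_inv _ hdet,
    Matrix.transpose_one, Matrix.mul_one, ← Matrix.mulVec_mulVec, Matrix.mulVec_transpose,
    dotProduct_comm, ← Matrix.dotProduct_mulVec, Matrix.mulVec_mulVec,
    Matrix.mul_nonsing_inv _ hdet, Matrix.one_mulVec, dotProduct_comm]

theorem isWeakSolution_comp (h : IsDiffeo ρ σ) {A : Pt d → Mat d} {u : Pt d → ℝ}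
    (hu : IsWeakSolution A u) : IsWeakSolution (conjugate A ρ) fun X => u (ρ X) := by
  obtain ⟨hu, g, hg, hug, hA⟩ := hu
  refine ⟨h.inL2loc_comp hu, _, fun i => ?_, h.isWeakGradient_comp hu hg hug, fun w hw => ?_⟩
  · simp only [Matrix.mulVec, dotProduct, Matrix.transpose_apply]
    intro K hK hKH
    exact memLp_finsetSum _ fun j _ => ((h.inL2loc_comp (hg j)).mul_continuousOn
      (h.contDiffOn_jacobian j i).continuousOn) K hK hKH
  · have hw' := h.symm.isTest_comp hw
    rw [← hA _ hw', h.integral_eq (fun Y => (A Y).mulVec (g Y) ⬝ᵥ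
      grad ((halfSpace d).indicator fun X => w (σ X)) Y)]
    refine setIntegral_congr_fun (measurableSet_halfSpace d) fun X hX => ?_
    have e : grad w X = (jacobian ρ X).transpose.mulVec
        (grad ((halfSpace d).indicator fun X => w (σ X)) (ρ X)) := by
      rw [h.symm.grad_indicator_comp hw (h.mapsTo hX), h.left_inv X hX, Matrix.mulVec_mulVec,
        ← Matrix.transpose_mul, h.jacobian_mul hX, Matrix.transpose_one, Matrix.one_mulVec]
    simp only [e]
    exact h.conjugate_mulVec A hX _ _

end IsDiffeo

/-! ### Jacobian bounds and transport of Carleson measures -/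

theorem stdBasis_inl {d : ℕ} (j : Fin d) :
    stdBasis d (Sum.inl j) = (EuclideanSpace.single j 1, 0) := by
  simp [stdBasis]

theorem stdBasis_inr (d : ℕ) (u : Unit) : stdBasis d (Sum.inr u) = (0, 1) := by
  simp [stdBasis]

theorem stdBasis_repr_inl {d : ℕ} (Y : Pt d) (i : Fin d) :
    (stdBasis d).repr Y (Sum.inl i) = Y.1 i := by
  simp [stdBasis]

theorem stdBasis_repr_inr {d : ℕ} (Y : Pt d) (u : Unit) :
    (stdBasis d).repr Y (Sum.inr u) = Y.2 := by
  simp [stdBasis]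

theorem norm_stdBasis_le {d : ℕ} (j : Idx d) : ‖stdBasis d j‖ ≤ 1 := by
  rcases j with j | u
  · rw [stdBasis_inl, Prod.norm_def]; simp
  · rw [stdBasis_inr, Prod.norm_def]; simp

theorem abs_repr_le {d : ℕ} (Y : Pt d) (i : Idx d) : |(stdBasis d).repr Y i| ≤ ‖Y‖ := by
  rcases i with i | u
  · rw [stdBasis_repr_inl]
    exact (PiLp.norm_apply_le Y.1 i).trans (norm_fst_le Y)
  · rw [stdBasis_repr_inr]
    exact norm_snd_le Y

theorem abs_jacobian_le {d : ℕ} {ρ : Pt d → Pt d} {X : Pt d} {R : ℝ}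
    (h : ∀ ξ, ‖fderiv ℝ ρ X ξ‖ ≤ R * ‖ξ‖) (hR : 0 ≤ R) (i j : Idx d) : |jacobian ρ X i j| ≤ R := by
  rw [jacobian_apply]
  refine (abs_repr_le _ i).trans ((h _).trans ?_)
  exact mul_le_of_le_one_right hR (norm_stdBasis_le j)

/-- A bound for determinants of matrices with entries bounded by `R`. -/
abbrev detBound (d : ℕ) (R : ℝ) : ℝ := (Fintype.card (Idx d)).factorial * R ^ Fintype.card (Idx d)

theorem abs_det_le {d : ℕ} {M : Mat d} {R : ℝ} (h : ∀ i j, |M i j| ≤ R) :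
    |M.det| ≤ detBound d R := by
  have := Matrix.det_le (A := M) (abv := IsAbsoluteValue.toAbsoluteValue (abs : ℝ → ℝ)) (x := R) h
  simpa [detBound, nsmul_eq_mul] using this

namespace IsSlow

variable {d : ℕ} {v : Pt d → EuclideanSpace ℝ (Fin d)} {h : Pt d → ℝ} {c C ε : ℝ}
  {σ : Pt d → Pt d}

theorem abs_jacobian_le (hs : IsSlow v h c C ε) {X : Pt d} (hX : X ∈ halfSpace d) (i j : Idx d) :
    |jacobian (shear v h) X i j| ≤ 1 + C + ε := by
  have := hs.C_nonneg
  have := hs.ε_nonneg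
  exact WeakDKP.abs_jacobian_le (hs.norm_fderiv_le hX) (by positivity) i j

theorem abs_jacobian_inv_le (hs : IsSlow v h c C ε) (hσ : IsDiffeo (shear v h) σ) {X : Pt d}
    (hX : X ∈ halfSpace d) (i j : Idx d) :
    |(jacobian (shear v h) X)⁻¹ i j| ≤ lowConst c C := by
  rw [hσ.jacobian_inv hX]
  refine WeakDKP.abs_jacobian_le (fun ξ => ?_) hs.lowConst_pos.le i j
  refine (hs.norm_le_fderiv hX _).trans (le_of_eq ?_)
  congr 2
  have h1 := hσ.symm.fderiv_comp_fderiv (hσ.mapsTo hX)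
  rw [hσ.left_inv X hX] at h1
  exact congrArg (fun L : Pt d →L[ℝ] Pt d => L ξ) h1

/-- A lower bound for |det J| is an upper bound for |det J⁻¹|, and the entries of J⁻¹ are bounded by
the lower Lipschitz constant. -/
theorem one_le_det (hs : IsSlow v h c C ε) (hσ : IsDiffeo (shear v h) σ) {X : Pt d}
    (hX : X ∈ halfSpace d) :
    1 ≤ detBound d (lowConst c C) * |(jacobian (shear v h) X).det| := by
  have h1 := abs_det_le (hs.abs_jacobian_inv_le hσ hX)
  have h2 : (jacobian (shear v h) X).det * (jacobian (shear v h) X)⁻¹.det = 1 := by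
    rw [← Matrix.det_mul, Matrix.mul_nonsing_inv _ (hσ.det_ne_zero hX).isUnit, Matrix.det_one]
  have h3 := congrArg abs h2
  rw [abs_mul, abs_one] at h3
  rw [← h3, mul_comm]
  exact mul_le_mul_of_nonneg_right h1 (abs_nonneg _)

/-- Carleson estimates are stable under the change of variable. -/
theorem carlesonFinite_comp (hs : IsSlow v h c C ε) (hσ : IsDiffeo (shear v h) σ)
    {F : Pt d → ℝ≥0∞} (hF : CarlesonFinite F) : CarlesonFinite fun X => F (shear v h X) := by
  obtain ⟨K, hK, hF⟩ := hF
  have hC := hs.C_nonneg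
  set D := detBound d (lowConst c C)
  refine ⟨ENNReal.ofReal C * (ENNReal.ofReal D * (K * ENNReal.ofReal ((1 + C) ^ d))), ?_,
    fun z r hr => ?_⟩
  · exact ENNReal.mul_ne_top (by simp) (ENNReal.mul_ne_top (by simp)
      (ENNReal.mul_ne_top hK (by simp)))
  have hsub : shear v h '' tent z r ⊆ tent z ((1 + C) * r) := by
    rintro _ ⟨X, hX, rfl⟩
    have hXH := tent_subset z r hX
    exact act_mem_tent hX (hs.c_pos.trans_le (hs.le_h X hXH)) (hs.norm_v_le X hXH) (hs.h_le X hXH)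
  calc ∫⁻ X in tent z r, F (shear v h X) ∂(nu d)
      ≤ ∫⁻ X in tent z r, ENNReal.ofReal C *
          (fun Y : Pt d => F Y / ENNReal.ofReal Y.2) (shear v h X) := by
        rw [setLIntegral_nu (measurableSet_tent z r) (tent_subset z r)]
        refine setLIntegral_mono' (measurableSet_tent z r) fun X hX => ?_
        have hXH := tent_subset z r hX
        have hX2 : 0 < X.2 := hXH
        have hh : 0 < h X := hs.c_pos.trans_le (hs.le_h X hXH)
        have e : ENNReal.ofReal (shear v h X).2 = ENNReal.ofReal X.2 * ENNReal.ofReal (h X) :=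
          ENNReal.ofReal_mul hX2.le
        simp only [e, div_eq_mul_inv]
        -- The weight 1/t at X and at its image differ by the factor h(X) ≤ C.
        have h1 : 1 ≤ ENNReal.ofReal C * (ENNReal.ofReal (h X))⁻¹ := by
          rw [← ENNReal.ofReal_inv_of_pos hh, ← ENNReal.ofReal_mul hC, ENNReal.one_le_ofReal,
            ← div_eq_mul_inv, one_le_div hh]
          exact hs.h_le X hXH
        rw [ENNReal.mul_inv (by simp) (by simp)]
        refine (le_mul_of_one_le_left zero_le h1).trans (le_of_eq ?_)
        ring
    _ ≤ ENNReal.ofReal C * (ENNReal.ofReal D *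
          ∫⁻ Y in tent z ((1 + C) * r), F Y / ENNReal.ofReal Y.2) := by
        rw [lintegral_const_mul' _ _ ENNReal.ofReal_ne_top]
        gcongr
        refine (hσ.setLIntegral_comp_le (measurableSet_tent z r) (tent_subset z r)
          (fun X hX => hs.one_le_det hσ (tent_subset z r hX))
          (fun Y => F Y / ENNReal.ofReal Y.2)).trans ?_
        gcongr
    _ ≤ ENNReal.ofReal C * (ENNReal.ofReal D * (K * (ENNReal.ofReal ((1 + C) ^ d) *
          volume (Metric.ball z r)))) := by
        rw [← setLIntegral_nu (measurableSet_tent _ _) (tent_subset _ _),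
          ← volume_ball_mul z (by positivity) r]
        gcongr
        exact hF z _ (by positivity)
    _ = _ := by ring

end IsSlow

/-! ### Comparison of the coefficients at ρ(X) with their averages -/

/-- Mean square difference between `a ∘ ρ` and the values of `a` near the base point. -/
def errOsc {d : ℕ} (ρ : Pt d → Pt d) (a : Pt d → ℝ) (K : Set (Pt d)) (X : Pt d) : ℝ≥0∞ :=
  ∫⁻ g in K, ENNReal.ofReal ((a (ρ X) - a (act X g)) ^ 2)

theorem measurable_errOsc {d : ℕ} {ρ : Pt d → Pt d} {a : Pt d → ℝ} (hρ : Measurable ρ)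
    (ha : Measurable a) (K : Set (Pt d)) : Measurable (errOsc ρ a K) := by
  unfold errOsc
  refine Measurable.lintegral_prod_right' (f := fun p : Pt d × Pt d =>
    ENNReal.ofReal ((a (ρ p.1) - a (act p.1 p.2)) ^ 2)) ?_
  exact (((ha.comp (hρ.comp measurable_fst)).sub (ha.comp measurable_act)).pow_const
    2).ennreal_ofReal

theorem carlesonFinite_lintegral_osc {d : ℕ} {a : Pt d → ℝ} (ha : Measurable a)
    {K : Set (Pt d)} (h : OscBound a K) :
    CarlesonFinite fun Y => ∫⁻ g in K, osc a g Y := by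
  obtain ⟨L, hL, h⟩ := h
  refine ⟨L, hL, fun z r hr => le_trans (le_of_eq ?_) (h z r hr)⟩
  exact lintegral_lintegral_swap (μ := (nu d).restrict (tent z r)) (ν := volume.restrict K)
    (f := fun Y g => osc a g Y) ((measurable_osc ha).comp measurable_swap).aemeasurable

/-- With u = (v X, h X) one has ρ(X) = `act X u`. Writing g = uγ turns a(ρ X) - a(Xg) into the
increment by γ at Y = ρ(X). Here γ ranges over a compact set that need not be near the identity, so
the bound for arbitrary compact sets of translations is needed. -/
theorem IsSlow.carlesonFinite_errOsc {d : ℕ} {v : Pt d → EuclideanSpace ℝ (Fin d)}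
    {h : Pt d → ℝ} {c C ε : ℝ} {σ : Pt d → Pt d} (hs : IsSlow v h c C ε)
    (hσ : IsDiffeo (shear v h) σ) {a : Pt d → ℝ} (ha : Measurable a)
    (hosc : CarlesonFinite (scalarOsc a)) {K : Set (Pt d)} (hK : IsCompact K)
    (hKH : K ⊆ halfSpace d) : CarlesonFinite (errOsc (shear v h) a K) := by
  set U : Set (Pt d) := Metric.closedBall 0 C ×ˢ Icc c C
  have hU : IsCompact U := (isCompact_closedBall _ _).prod isCompact_Icc
  have hUH : U ⊆ halfSpace d := fun u hu => hs.c_pos.trans_le hu.2.1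
  set K' : Set (Pt d) := (fun p : Pt d × Pt d => ldiv p.1 p.2) '' (U ×ˢ K)
  have hK' : IsCompact K' := (hU.prod hK).image_of_continuousOn fun p hp =>
    (continuousAt_ldiv (hUH hp.1)).continuousWithinAt
  have hK'H : K' ⊆ halfSpace d := by
    rintro _ ⟨⟨u, g⟩, ⟨hu, hg⟩, rfl⟩
    have h1 : 0 < u.2 := hUH hu
    have h2 : 0 < g.2 := hKH hg
    change 0 < u.2⁻¹ * g.2
    positivity
  have h1 := hs.carlesonFinite_comp hσ
    (carlesonFinite_lintegral_osc ha (oscBound_of_scalarOsc ha hosc hK' hK'H))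
  refine (h1.const_mul (c := ENNReal.ofReal (C ^ (d + 1))) ENNReal.ofReal_ne_top).mono_ae ?_
  filter_upwards [ae_mem_halfSpace d] with X hX
  set u : Pt d := (v X, h X)
  have hu : u ∈ U := ⟨by simpa using hs.norm_v_le X hX, hs.le_h X hX, hs.h_le X hX⟩
  have hu2 : 0 < u.2 := hUH hu
  unfold errOsc
  rw [← lintegral_indicator hK.measurableSet, lintegral_eq_act_left (hUH hu),
    ← lintegral_indicator hK'.measurableSet]
  refine mul_le_mul' (ENNReal.ofReal_le_ofReal (pow_le_pow_left₀ hu2.le hu.2.2 _))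
    (lintegral_mono fun γ => ?_)
  by_cases hγ : act u γ ∈ K
  · have hmem : γ ∈ K' := ⟨(u, act u γ), ⟨hu, hγ⟩, ldiv_act (hUH hu) γ⟩
    rw [indicator_of_mem hγ, indicator_of_mem hmem, ← act_assoc]
    rfl
  · rw [indicator_of_notMem hγ]
    exact zero_le

section Smoothing

variable {d : ℕ} {a : Pt d → ℝ} {M : ℝ}

theorem measurable_act_right (ha : Measurable a) (X : Pt d) : Measurable fun g => a (act X g) :=
  ha.comp (measurable_act.comp (measurable_const.prodMk measurable_id))

theorem measurable_smoothing (ha : Measurable a) {κ : Pt d → ℝ} (hκ : Measurable κ) :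
    Measurable (smoothing κ a) := by
  have : StronglyMeasurable fun p : Pt d × Pt d => a (act p.1 p.2) * κ p.2 :=
    ((ha.comp measurable_act).mul (hκ.comp measurable_snd)).stronglyMeasurable
  exact this.integral_prod_right'.measurable

theorem integrable_mul_kernel (ha : Measurable a) (haM : ∀ X, |a X| ≤ M) {η : Pt d → ℝ}
    (hη : Integrable η) (X : Pt d) : Integrable fun g => a (act X g) * η g :=
  hη.bdd_mul (c := M) (measurable_act_right ha X).aestronglyMeasurable (ae_of_all _ fun _ => haM _)

theorem abs_smoothing_le (haM : ∀ X, |a X| ≤ M) {η : Pt d → ℝ} (hη : Integrable η) (X : Pt d) :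
    |smoothing η a X| ≤ M * ∫ g, |η g| := by
  rw [← integral_const_mul, ← Real.norm_eq_abs, smoothing]
  refine norm_integral_le_of_norm_le (hη.abs.const_mul M) (ae_of_all _ fun g => ?_)
  rw [norm_mul]
  exact mul_le_mul_of_nonneg_right (haM _) (abs_nonneg _)

theorem le_smoothing (ha : Measurable a) (haM : ∀ X, |a X| ≤ M) {l : ℝ} (hal : ∀ X, l ≤ a X)
    {κ : Pt d → ℝ} (hκ : Integrable κ) (hκ0 : ∀ g, 0 ≤ κ g) (hκ1 : ∫ g, κ g = 1) (X : Pt d) :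
    l ≤ smoothing κ a X := by
  calc l = ∫ g, l * κ g := by rw [integral_const_mul, hκ1, mul_one]
    _ ≤ _ := integral_mono (hκ.const_mul l) (integrable_mul_kernel ha haM hκ X) fun g =>
      mul_le_mul_of_nonneg_right (hal _) (hκ0 g)

/-- Serves twice: with η = κ, of integral 1, it compares a ∘ ρ with the smoothing; with η =
`kerDeriv κ ξ`, of integral 0, it bounds the gradient of the smoothing. -/
theorem smoothing_sub_sq_le {η : Pt d → ℝ} (hη : Continuous η) {K : Set (Pt d)}
    (hK : IsCompact K) (hηK : ∀ g ∉ K, η g = 0) :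
    ∃ L : ℝ≥0∞, L ≠ ⊤ ∧ ∀ (a : Pt d → ℝ) (M : ℝ), Measurable a → (∀ X, |a X| ≤ M) → ∀ ρ X,
      ENNReal.ofReal ((smoothing η a X - a (ρ X) * ∫ g, η g) ^ 2) ≤ L * errOsc ρ a K X := by
  obtain ⟨L, hL, h⟩ := integral_mul_sq_le hη hK hηK
  have hηi : Integrable η :=
    hη.integrable_of_hasCompactSupport (HasCompactSupport.intro hK hηK)
  refine ⟨L, hL, fun a M ha haM ρ X => ?_⟩
  have h1 := h (fun g => a (act X g) - a (ρ X)) ((measurable_act_right ha X).sub_const _)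
  have h2 : ∫ g, (a (act X g) - a (ρ X)) * η g = smoothing η a X - a (ρ X) * ∫ g, η g := by
    simp only [sub_mul]
    rw [integral_sub (integrable_mul_kernel ha haM hηi X) (hηi.const_mul _), integral_const_mul]
    rfl
  rw [h2] at h1
  refine h1.trans (le_of_eq ?_)
  simp only [errOsc]
  congr 2
  ext g
  congr 1
  ring

end Smoothing

/-! ### Bounded measurable representatives of the coefficients -/

theorem euclNorm_single {ι : Type*} [Fintype ι] [DecidableEq ι] (i : ι) :
    euclNorm (Pi.single i (1 : ℝ)) = 1 := by
  have : ∀ j, (Pi.single i (1 : ℝ) : ι → ℝ) j ^ 2 = if j = i then 1 else 0 := fun j => by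
    by_cases h : j = i <;> simp [h]
  simp [euclNorm, this]

theorem abs_entry_le {d : ℕ} {M : Mat d} {C : ℝ}
    (h : ∀ ξ ζ : Idx d → ℝ, |M.mulVec ξ ⬝ᵥ ζ| ≤ C * euclNorm ξ * euclNorm ζ) (i j : Idx d) :
    |M i j| ≤ C := by
  simpa [euclNorm_single] using h (Pi.single j 1) (Pi.single i 1)

theorem le_diag_entry {d : ℕ} {M : Mat d} {c : ℝ}
    (h : ∀ ξ : Idx d → ℝ, c * euclNorm ξ ^ 2 ≤ M.mulVec ξ ⬝ᵥ ξ) (i : Idx d) : c ≤ M i i := by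
  simpa [euclNorm_single] using h (Pi.single i 1)

/-- Truncating a measurable representative makes the bounds hold at every point of the whole space,
which frees the averaging estimates from null sets. -/
theorem exists_measurable_between {d : ℕ} {f : Pt d → ℝ} {lo hi : ℝ}
    (hf : AEMeasurable f (volume.restrict (halfSpace d)))
    (h : ∀ X ∈ halfSpace d, lo ≤ f X ∧ f X ≤ hi) :
    ∃ a : Pt d → ℝ, Measurable a ∧ (∀ X, lo ≤ a X ∧ a X ≤ hi) ∧
      a =ᵐ[volume.restrict (halfSpace d)] f := by
  have h0 : ((0, 1) : Pt d) ∈ halfSpace d := one_pos (α := ℝ)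
  have hle : lo ≤ hi := (h _ h0).1.trans (h _ h0).2
  refine ⟨fun X => max lo (min (hf.mk f X) hi),
    measurable_const.max (hf.measurable_mk.min measurable_const),
    fun X => ⟨le_max_left _ _, max_le hle (min_le_right _ _)⟩, ?_⟩
  filter_upwards [hf.ae_eq_mk, ae_restrict_mem (measurableSet_halfSpace d)] with X hX hXH
  rw [← hX, min_eq_left (h X hXH).2, max_eq_right (h X hXH).1]

theorem sq_entry_le_matNorm {ι κ : Type*} [Fintype ι] [Fintype κ] (M : Matrix ι κ ℝ) (i : ι)
    (j : κ) : M i j ^ 2 ≤ matNorm M ^ 2 := by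
  rw [matNorm, Real.sq_sqrt (by positivity)]
  calc M i j ^ 2 ≤ ∑ j, M i j ^ 2 :=
        Finset.single_le_sum (f := fun j => M i j ^ 2) (fun _ _ => sq_nonneg _) (Finset.mem_univ j)
    _ ≤ _ := Finset.single_le_sum (f := fun i => ∑ j, M i j ^ 2)
        (fun _ _ => Finset.sum_nonneg fun _ _ => sq_nonneg _) (Finset.mem_univ i)

theorem scalarOsc_le_whitneyOsc {d : ℕ} {A : Pt d → Mat d} {a : Pt d → ℝ} {i j : Idx d}
    (ha : a =ᵐ[volume.restrict (halfSpace d)] fun X => A X i j) {X : Pt d}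
    (hX : X ∈ halfSpace d) : scalarOsc a X ≤ whitneyOsc A X := by
  refine le_iInf fun A₀ => (iInf_le _ (A₀ i j)).trans ?_
  gcongr _ * ?_
  have hX2 : 0 < X.2 := hX
  have hsub : Metric.ball X.1 (2 * X.2) ×ˢ Ioo X.2 (2 * X.2) ⊆ halfSpace d :=
    fun Y hY => hX2.trans hY.2.1
  refine lintegral_mono_ae ?_
  filter_upwards [ae_restrict_of_ae_restrict_of_subset hsub ha] with Y hY
  refine ENNReal.div_le_div_right (ENNReal.ofReal_le_ofReal ?_) _
  rw [hY]
  exact sq_entry_le_matNorm (A Y - A₀) i j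

/-- The entries of a weak-DKP matrix, modified on a null set. -/
structure IsEntries {d : ℕ} (A : Pt d → Mat d) (a : Idx d → Idx d → Pt d → ℝ) (M : ℝ) : Prop where
  pos : 0 < M
  measurable : ∀ i j, Measurable (a i j)
  abs_le : ∀ i j X, |a i j X| ≤ M
  inv_le : ∀ X, M⁻¹ ≤ a (Sum.inr ()) (Sum.inr ()) X
  ae_eq : ∀ i j, a i j =ᵐ[volume.restrict (halfSpace d)] fun X => A X i j
  carlesonFinite : ∀ i j, CarlesonFinite (scalarOsc (a i j))

theorem IsWeakDKP.exists_isEntries {d : ℕ} {A : Pt d → Mat d} (hA : IsWeakDKP A) :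
    ∃ a M, IsEntries A a M := by
  obtain ⟨⟨hm, C, hC, hell⟩, M, -, hM⟩ := hA
  have key : ∀ i j : Idx d, ∃ a : Pt d → ℝ, Measurable a ∧
      (∀ X, (if i = j then C⁻¹ else -C) ≤ a X ∧ a X ≤ C) ∧
      a =ᵐ[volume.restrict (halfSpace d)] fun X => A X i j := fun i j => by
    refine exists_measurable_between (hm i j) fun X hX => ?_
    have h1 := abs_le.1 (abs_entry_le (hell X hX).1 i j)
    refine ⟨?_, h1.2⟩
    split_ifs with hij
    · subst hij
      exact le_diag_entry (hell X hX).2 i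
    · exact h1.1
  choose a ha hb hae using key
  refine ⟨a, C, hC, ha, fun i j X => abs_le.2 ⟨le_trans ?_ (hb i j X).1, (hb i j X).2⟩,
    fun X => by simpa using (hb (Sum.inr ()) (Sum.inr ()) X).1, hae, fun i j => ?_⟩
  · have : 0 < C⁻¹ := by positivity
    split_ifs <;> linarith
  · refine CarlesonFinite.mono_ae ⟨_, ENNReal.ofReal_ne_top,
      (isCarlesonDensity_iff _ _).1 hM⟩ ?_
    filter_upwards [ae_mem_halfSpace d] with X hX
    exact scalarOsc_le_whitneyOsc (hae i j) hX

/-! ### The change of variable built from the last row -/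

section Change

variable {d : ℕ} {A : Pt d → Mat d} {a : Idx d → Idx d → Pt d → ℝ} {M : ℝ} {κ : Pt d → ℝ}

/-- The vector of the smoothed tangential entries in the last row. -/
def rowVec (κ : Pt d → ℝ) (a : Idx d → Idx d → Pt d → ℝ) (X : Pt d) : EuclideanSpace ℝ (Fin d) :=
  WithLp.toLp 2 fun i => smoothing κ (a (Sum.inr ()) (Sum.inl i)) X

theorem norm_le_card_mul {v : EuclideanSpace ℝ (Fin d)} {R : ℝ} (h : ∀ i, |v i| ≤ R) :
    ‖v‖ ≤ d * R := by
  rw [← (EuclideanSpace.basisFun (Fin d) ℝ).sum_repr v]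
  refine (norm_sum_le _ _).trans ((Finset.sum_le_card_nsmul _ _ R fun i _ => ?_).trans ?_)
  · rw [norm_smul]; simpa using h i
  · simp

theorem fderiv_rowVec_apply (hκ : ContDiff ℝ ∞ κ) (hκc : HasCompactSupport κ)
    (ha : IsEntries A a M) {X : Pt d} (hX : X ∈ halfSpace d) (ξ : Pt d) (i : Fin d) :
    fderiv ℝ (rowVec κ a) X ξ i =
      fderiv ℝ (smoothing κ (a (Sum.inr ()) (Sum.inl i))) X ξ := by
  have hd : DifferentiableAt ℝ (rowVec κ a) X := by
    rw [differentiableAt_euclidean]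
    exact fun i => ((contDiffOn_smoothing hκ hκc (ha.measurable _ _) (ha.abs_le _ _)).contDiffAt
      ((isOpen_halfSpace d).mem_nhds hX)).differentiableAt (by simp)
  have h2 := (EuclideanSpace.proj (𝕜 := ℝ) i).hasFDerivAt.comp X hd.hasFDerivAt
  have h3 : fderiv ℝ (smoothing κ (a (Sum.inr ()) (Sum.inl i))) X = _ := h2.fderiv
  rw [h3]
  rfl

/-- The factor d + 1 comes from bounding the Euclidean norm of the d tangential components crudely
by their sum; it also covers h. The lower bound on h is ellipticity tested on the normal vector. -/
theorem isSlow_rowVec (hκ : ContDiff ℝ ∞ κ) (hκc : HasCompactSupport κ)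
    (hκ0 : ∀ g, 0 ≤ κ g) (hκ1 : ∫ g, κ g = 1) {ε : ℝ} (hε : 0 ≤ ε)
    (hκε : ∀ ξ, ∫ g, |kerDeriv κ ξ g| ≤ ε * ‖ξ‖) (ha : IsEntries A a M)
    (hsmall : (d + 1) * M * ε * (1 + ((d + 1) * M + 1) / M⁻¹) ≤ 1 / 2) :
    IsSlow (rowVec κ a) (smoothing κ (a (Sum.inr ()) (Sum.inr ()))) M⁻¹ ((d + 1) * M)
      ((d + 1) * M * ε) := by
  have hM := ha.pos
  have hκi : Integrable κ := hκ.continuous.integrable_of_hasCompactSupport hκc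
  have hb : ∀ i j X, |smoothing κ (a i j) X| ≤ M := fun i j X => by
    refine (abs_smoothing_le (ha.abs_le i j) hκi X).trans (le_of_eq ?_)
    simp only [abs_of_nonneg (hκ0 _), hκ1, mul_one]
  have hdb : ∀ i j, ∀ X ∈ halfSpace d, ∀ ξ,
      |X.2 * fderiv ℝ (smoothing κ (a i j)) X ξ| ≤ M * ε * ‖ξ‖ := fun i j X hX ξ => by
    rw [fderiv_smoothing hκ hκc (ha.measurable i j) (ha.abs_le i j) hX, mul_assoc]
    refine (abs_smoothing_le (ha.abs_le i j) ?_ X).trans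
      (mul_le_mul_of_nonneg_left (hκε ξ) hM.le)
    exact (continuous_kerDeriv hκ ξ).integrable_of_hasCompactSupport
      (HasCompactSupport.intro hκc fun g hg => kerDeriv_eq_zero ξ hg)
  have hC : M ≤ (d + 1) * M := by nlinarith [(Nat.cast_nonneg d : (0 : ℝ) ≤ d)]
  have hd0 : (0 : ℝ) ≤ d := Nat.cast_nonneg d
  have hME : 0 ≤ M * ε := by positivity
  refine
    { c_pos := by positivity
      C_nonneg := by positivity
      ε_nonneg := by positivity
      small := hsmall
      contDiffOn_v := ?_
      contDiffOn_h := contDiffOn_smoothing hκ hκc (ha.measurable _ _) (ha.abs_le _ _)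
      norm_v_le := fun X _ => (norm_le_card_mul (R := M) fun i => hb _ _ X).trans (by nlinarith)
      le_h := fun X _ => le_smoothing (ha.measurable _ _) (ha.abs_le _ _) ha.inv_le hκi hκ0 hκ1 X
      h_le := fun X _ => (le_abs_self _).trans ((hb _ _ X).trans hC)
      fderiv_v_le := fun X hX ξ => ?_
      fderiv_h_le := fun X hX ξ => ?_ }
  · rw [contDiffOn_euclidean]
    exact fun i => contDiffOn_smoothing hκ hκc (ha.measurable _ _) (ha.abs_le _ _)
  · have hX2 : 0 < X.2 := hX
    have h1 : ‖X.2 • fderiv ℝ (rowVec κ a) X ξ‖ ≤ d * (M * ε * ‖ξ‖) :=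
      norm_le_card_mul fun i => by
        have := hdb (Sum.inr ()) (Sum.inl i) X hX ξ
        rwa [← fderiv_rowVec_apply hκ hκc ha hX ξ i] at this
    rw [norm_smul, Real.norm_of_nonneg hX2.le] at h1
    refine h1.trans ?_
    nlinarith [mul_nonneg hME (norm_nonneg ξ)]
  · have hX2 : 0 < X.2 := hX
    have h1 := hdb (Sum.inr ()) (Sum.inr ()) X hX ξ
    rw [abs_mul, abs_of_pos hX2] at h1
    refine h1.trans ?_
    nlinarith [mul_nonneg hd0 (mul_nonneg hME (norm_nonneg ξ))]

end Change

/-! ### Entrywise matrix bounds and ellipticity of the conjugate operator -/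

theorem abs_mul_apply_le {ι ι' κ : Type*} [Fintype ι] {M : Matrix ι' ι ℝ} {N : Matrix ι κ ℝ}
    {R S : ℝ} (hR : 0 ≤ R) (hM : ∀ i j, |M i j| ≤ R) (hN : ∀ i j, |N i j| ≤ S) (i : ι') (j : κ) :
    |(M * N) i j| ≤ Fintype.card ι * (R * S) := by
  rw [Matrix.mul_apply]
  refine (Finset.abs_sum_le_sum_abs _ _).trans
    ((Finset.sum_le_card_nsmul _ _ (R * S) fun k _ => ?_).trans ?_)
  · rw [abs_mul]
    exact mul_le_mul (hM i k) (hN k j) (abs_nonneg _) hR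
  · simp

section Norms

variable {ι κ : Type*} [Fintype ι] [Fintype κ]

theorem abs_apply_le_euclNorm (z : ι → ℝ) (i : ι) : |z i| ≤ euclNorm z := by
  rw [euclNorm, ← Real.sqrt_sq_eq_abs]
  exact Real.sqrt_le_sqrt
    (Finset.single_le_sum (f := fun i => z i ^ 2) (fun _ _ => sq_nonneg _) (Finset.mem_univ i))

theorem euclNorm_le {z : ι → ℝ} {R : ℝ} (h : ∀ i, |z i| ≤ R) :
    euclNorm z ≤ Fintype.card ι * R := by
  have h0 : euclNorm z ≤ ∑ i, |z i| := by
    refine Real.sqrt_le_iff.2 ⟨Finset.sum_nonneg fun _ _ => abs_nonneg _, ?_⟩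
    simp only [← sq_abs (z _)]
    exact Finset.sum_sq_le_sq_sum_of_nonneg fun _ _ => abs_nonneg _
  refine h0.trans ((Finset.sum_le_card_nsmul _ _ R fun i _ => h i).trans ?_)
  simp

theorem matNorm_le {M : Matrix ι κ ℝ} {R : ℝ} (h : ∀ i j, |M i j| ≤ R) :
    matNorm M ≤ Fintype.card ι * (Fintype.card κ * R) := by
  have h0 : matNorm M = euclNorm fun i => euclNorm fun j => M i j := by
    simp only [matNorm, euclNorm]
    congr 1
    refine Finset.sum_congr rfl fun i _ => ?_
    rw [Real.sq_sqrt (by positivity)]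
  rw [h0]
  refine euclNorm_le fun i => ?_
  rw [abs_of_nonneg (show 0 ≤ euclNorm fun j => M i j from Real.sqrt_nonneg _)]
  exact euclNorm_le (h i)

theorem euclNorm_mulVec_le {M : Matrix κ ι ℝ} {R : ℝ} (hR : 0 ≤ R) (hM : ∀ i j, |M i j| ≤ R)
    (y : ι → ℝ) :
    euclNorm (M.mulVec y) ≤ Fintype.card κ * (Fintype.card ι * R) * euclNorm y := by
  have : euclNorm (M.mulVec y) ≤ Fintype.card κ * (Fintype.card ι * (R * euclNorm y)) := by
    refine euclNorm_le fun i => (Finset.abs_sum_le_sum_abs _ _).trans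
      ((Finset.sum_le_card_nsmul _ _ (R * euclNorm y) fun k _ => ?_).trans ?_)
    · rw [abs_mul]
      exact mul_le_mul (hM i k) (abs_apply_le_euclNorm y k) (abs_nonneg _) hR
    · simp
  refine this.trans (le_of_eq ?_)
  ring

end Norms

namespace IsDiffeo

variable {d : ℕ} {ρ σ : Pt d → Pt d}

theorem map_restrict_absolutelyContinuous (h : IsDiffeo ρ σ) {D : ℝ}
    (hD : ∀ X ∈ halfSpace d, 1 ≤ D * |(jacobian ρ X).det|) :
    Measure.map ρ (volume.restrict (halfSpace d)) ≪ volume.restrict (halfSpace d) := by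
  have h1 := h.map_restrict_le (measurableSet_halfSpace d) subset_rfl hD
  rw [h.image_eq] at h1
  exact (Measure.absolutelyContinuous_of_le h1).trans Measure.smul_absolutelyContinuous

theorem uniformlyElliptic_conjugate (h : IsDiffeo ρ σ) (hρ : Measurable ρ) {A : Pt d → Mat d}
    (hA : UniformlyElliptic A) {R R' D : ℝ} (hR : ∀ X ∈ halfSpace d, ∀ i j, |jacobian ρ X i j| ≤ R)
    (hR' : ∀ X ∈ halfSpace d, ∀ i j, |(jacobian ρ X)⁻¹ i j| ≤ R')
    (hD : ∀ X ∈ halfSpace d, 1 ≤ D * |(jacobian ρ X).det|) :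
    UniformlyElliptic (conjugate A ρ) := by
  obtain ⟨hm, C, hC, hell⟩ := hA
  refine ⟨fun i j => ?_, ?_⟩
  · have hco : ∀ {f : Pt d → ℝ}, ContinuousOn f (halfSpace d) →
        AEMeasurable f (volume.restrict (halfSpace d)) :=
      fun hf => hf.aemeasurable (measurableSet_halfSpace d)
    have h1 : ∀ k l, AEMeasurable (fun X => A (ρ X) k l) (volume.restrict (halfSpace d)) :=
      fun k l => ((hm k l).mono_ac (h.map_restrict_absolutelyContinuous hD)).comp_measurable hρ
    have h2 : ∀ k l, AEMeasurable (fun X => (jacobian ρ X)⁻¹ k l)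
        (volume.restrict (halfSpace d)) := fun k l => by
      refine hco ?_
      refine ((h.symm.contDiffOn_jacobian k l).continuousOn.comp
        h.contDiffOn.continuousOn h.mapsTo).congr fun X hX => ?_
      rw [h.jacobian_inv hX]
      rfl
    simp only [conjugate, Matrix.smul_apply, Matrix.mul_apply, Matrix.transpose_apply, smul_eq_mul]
    refine (hco h.contDiffOn_abs_det.continuousOn).mul ?_
    refine Finset.aemeasurable_fun_sum _ fun k _ => AEMeasurable.mul ?_ (h2 j k)
    exact Finset.aemeasurable_fun_sum _ fun l _ => (h2 i l).mul (h1 l k)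
  · have h0 : ((0, 1) : Pt d) ∈ halfSpace d := one_pos (α := ℝ)
    have hR0 : 0 ≤ R := (abs_nonneg _).trans (hR _ h0 (Sum.inr ()) (Sum.inr ()))
    have hR0' : 0 ≤ R' := (abs_nonneg _).trans (hR' _ h0 (Sum.inr ()) (Sum.inr ()))
    have hD0 : 0 ≤ D := by
      by_contra hneg
      have h1 := hD _ h0
      have := mul_nonneg (neg_nonneg.2 (not_le.1 hneg).le) (abs_nonneg (jacobian ρ (0, 1)).det)
      linarith
    set n : ℝ := (Fintype.card (Idx d) : ℝ)
    set N := n * (n * R)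
    set N' := n * (n * R')
    set E := detBound d R
    have hE : 0 ≤ E := by positivity
    -- The first term serves the upper bound, the second the coercivity; 1 ensures positivity.
    set C' := E * C * N' ^ 2 + D * C * N ^ 2 + 1
    have hC' : 0 < C' := by positivity
    have hN' : 0 ≤ N' := by positivity
    have hN : 0 ≤ N := by positivity
    refine ⟨C', hC', fun X hX => ?_⟩
    set J := jacobian ρ X
    have hJ : ∀ ξ : Idx d → ℝ, J.transpose.mulVec ((J⁻¹).transpose.mulVec ξ) = ξ := fun ξ => by
      rw [Matrix.mulVec_mulVec, ← Matrix.transpose_mul,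
        Matrix.nonsing_inv_mul _ (h.det_ne_zero hX).isUnit, Matrix.transpose_one,
        Matrix.one_mulVec]
    have hy : ∀ ξ : Idx d → ℝ, euclNorm ((J⁻¹).transpose.mulVec ξ) ≤ N' * euclNorm ξ :=
      euclNorm_mulVec_le hR0' fun i j => hR' X hX j i
    have hJy : ∀ y : Idx d → ℝ, euclNorm (J.transpose.mulVec y) ≤ N * euclNorm y :=
      euclNorm_mulVec_le hR0 fun i j => hR X hX j i
    obtain ⟨hup, hlow⟩ := hell (ρ X) (h.mapsTo hX)
    have hn : ∀ z : Idx d → ℝ, 0 ≤ euclNorm z := fun z => Real.sqrt_nonneg _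
    constructor
    · intro ξ ζ
      have h1 := h.conjugate_mulVec A hX ((J⁻¹).transpose.mulVec ξ) ((J⁻¹).transpose.mulVec ζ)
      rw [hJ, hJ] at h1
      rw [h1, abs_mul, abs_abs]
      calc _ ≤ E * (C * (N' * euclNorm ξ) * (N' * euclNorm ζ)) := by
            refine mul_le_mul (abs_det_le (hR X hX)) ((hup _ _).trans ?_) (abs_nonneg _) hE
            have := mul_nonneg hN' (hn ξ)
            have := hn ((J⁻¹).transpose.mulVec ζ)
            gcongr
            · exact hy ξ
            · exact hy ζ
        _ = E * C * N' ^ 2 * (euclNorm ξ * euclNorm ζ) := by ring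
        _ ≤ C' * (euclNorm ξ * euclNorm ζ) := by
            refine mul_le_mul_of_nonneg_right ?_ (mul_nonneg (hn ξ) (hn ζ))
            have : 0 ≤ D * C * N ^ 2 := by positivity
            simp only [C']; linarith
        _ = _ := by ring
    · intro ξ
      set y := (J⁻¹).transpose.mulVec ξ
      have h1 := h.conjugate_mulVec A hX y y
      rw [hJ] at h1
      rw [h1, inv_mul_le_iff₀ hC']
      have h2 := hlow y
      rw [inv_mul_le_iff₀ hC] at h2
      have h3 : 0 ≤ (A (ρ X)).mulVec y ⬝ᵥ y := by
        by_contra hneg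
        nlinarith [sq_nonneg (euclNorm y)]
      have h4 : euclNorm ξ ≤ N * euclNorm y := by simpa only [y, hJ] using hJy y
      set q := (A (ρ X)).mulVec y ⬝ᵥ y
      calc euclNorm ξ ^ 2 ≤ (N * euclNorm y) ^ 2 := pow_le_pow_left₀ (hn ξ) h4 2
        _ = N ^ 2 * euclNorm y ^ 2 := by ring
        _ ≤ N ^ 2 * (C * q) := by gcongr
        _ ≤ N ^ 2 * (C * ((D * |J.det|) * q)) := by
            gcongr
            exact le_mul_of_one_le_left h3 (hD X hX)
        _ = (D * C * N ^ 2) * (|J.det| * q) := by ring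
        _ ≤ C' * (|J.det| * q) := by
            refine mul_le_mul_of_nonneg_right ?_ (mul_nonneg (abs_nonneg _) h3)
            have : 0 ≤ E * C * N' ^ 2 := by positivity
            simp only [C']; linarith

end IsDiffeo

/-! ### Algebra of the reduction and its stability -/

theorem exists_det_lipschitz (d : ℕ) (R : ℝ) : ∃ L : ℝ, 0 ≤ L ∧ ∀ M N : Mat d,
    (∀ i j, |M i j| ≤ R) → (∀ i j, |N i j| ≤ R) → ∀ q, (∀ i j, |(M - N) i j| ≤ q) →
      |M.det - N.det| ≤ L * q := by
  set S : Set (Idx d → Idx d → ℝ) := Metric.closedBall 0 R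
  have hdet : ContDiff ℝ 1 fun M : Idx d → Idx d → ℝ => Matrix.det (Matrix.of M) := by
    simp only [Matrix.det_apply, Matrix.of_apply]
    refine ContDiff.sum fun p _ => ContDiff.const_smul _ (contDiff_prod fun i _ => ?_)
    exact contDiff_apply_apply ℝ ℝ _ _
  obtain ⟨L, hL⟩ := hdet.contDiffOn.exists_lipschitzOnWith (s := S) one_ne_zero
    (convex_closedBall _ _) (isCompact_closedBall _ _)
  refine ⟨L, L.2, fun M N hM hN q hq => ?_⟩
  have hR : 0 ≤ R := (abs_nonneg _).trans (hM (Sum.inr ()) (Sum.inr ()))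
  have hq0 : 0 ≤ q := (abs_nonneg _).trans (hq (Sum.inr ()) (Sum.inr ()))
  have hmem : ∀ M : Mat d, (∀ i j, |M i j| ≤ R) → (fun i j => M i j) ∈ S := fun M hM => by
    rw [mem_closedBall_zero_iff, pi_norm_le_iff_of_nonneg hR]
    exact fun i => (pi_norm_le_iff_of_nonneg hR).2 (hM i)
  refine (hL.dist_le_mul _ (hmem M hM) _ (hmem N hN)).trans ?_
  refine mul_le_mul_of_nonneg_left ?_ L.2
  rw [dist_pi_le_iff hq0]
  exact fun i => (dist_pi_le_iff hq0).2 (hq i)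

/-- The tangential block of the reduced coefficient matrix. -/
def tangBlock {d : ℕ} (P : Mat d) : Matrix (Fin d) (Fin d) ℝ := fun i j =>
  P (Sum.inr ()) (Sum.inr ()) * P (Sum.inl i) (Sum.inl j)
    - P (Sum.inl i) (Sum.inr ()) * P (Sum.inr ()) (Sum.inl j)

/-- The last column of the reduced coefficient matrix. -/
def normalCol {d : ℕ} (P : Mat d) : Fin d → ℝ := fun i =>
  P (Sum.inl i) (Sum.inr ()) - P (Sum.inr ()) (Sum.inl i)

/-- The reduced coefficient matrix, with last row `(0, 1)`. -/
def reduced {d : ℕ} (P : Mat d) : Mat d :=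
  Matrix.fromBlocks (tangBlock P) (Matrix.replicateCol Unit (normalCol P)) 0 1

/-- The matrix which conjugates `P` to its reduced form. -/
def shearMat {d : ℕ} (P : Mat d) : Mat d :=
  Matrix.fromBlocks 1 (Matrix.replicateCol Unit fun i => P (Sum.inr ()) (Sum.inl i)) 0
    (P (Sum.inr ()) (Sum.inr ()) • 1)

/-- The algebraic core: as `shearMat P` has determinant P_nn, its conjugation formula applied to P
gives exactly the reduced matrix. The shear removes the tangential entries of the last row and the
dilation by P_nn normalizes the corner to 1. -/
theorem shearMat_mul_reduced {d : ℕ} (P : Mat d) :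
    shearMat P * reduced P * (shearMat P).transpose = P (Sum.inr ()) (Sum.inr ()) • P := by
  rw [shearMat, reduced, Matrix.fromBlocks_transpose, Matrix.fromBlocks_multiply,
    Matrix.fromBlocks_multiply]
  ext (i | u) (j | w)
  · simp [Matrix.mul_apply, tangBlock, normalCol]
  · simp [normalCol]
    ring
  · simp
  · simp

theorem det_shearMat {d : ℕ} (P : Mat d) :
    (shearMat P).det = P (Sum.inr ()) (Sum.inr ()) := by
  simp [shearMat, Matrix.det_fromBlocks_zero₂₁]

theorem abs_shearMat_le {d : ℕ} {P : Mat d} {M : ℝ} (hP : ∀ i j, |P i j| ≤ M) (i j : Idx d) :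
    |shearMat P i j| ≤ 1 + M := by
  have hM : 0 ≤ M := (abs_nonneg _).trans (hP (Sum.inr ()) (Sum.inr ()))
  rcases i with i | u <;> rcases j with j | w
  · by_cases h : i = j <;> simp [shearMat, h] <;> linarith
  · simp [shearMat]; linarith [hP (Sum.inr ()) (Sum.inl i)]
  · simp [shearMat]; linarith
  · simp [shearMat]; linarith [hP (Sum.inr ()) (Sum.inr ())]

theorem abs_reduced_le {d : ℕ} {P : Mat d} {M : ℝ} (hP : ∀ i j, |P i j| ≤ M) (i j : Idx d) :
    |reduced P i j| ≤ 1 + 2 * M + 2 * M ^ 2 := by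
  have hM : 0 ≤ M := (abs_nonneg _).trans (hP (Sum.inr ()) (Sum.inr ()))
  have hmul : ∀ i j k l, |P i j * P k l| ≤ M ^ 2 := fun i j k l => by
    rw [abs_mul, sq]
    exact mul_le_mul (hP _ _) (hP _ _) (abs_nonneg _) hM
  rcases i with i | u <;> rcases j with j | w
  · simp only [reduced, Matrix.fromBlocks_apply₁₁, tangBlock]
    refine (abs_sub _ _).trans ?_
    nlinarith [hmul (Sum.inr ()) (Sum.inr ()) (Sum.inl i) (Sum.inl j),
      hmul (Sum.inl i) (Sum.inr ()) (Sum.inr ()) (Sum.inl j)]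
  · simp only [reduced, Matrix.fromBlocks_apply₁₂, Matrix.replicateCol_apply, normalCol]
    refine (abs_sub _ _).trans ?_
    nlinarith [hP (Sum.inl i) (Sum.inr ()), hP (Sum.inr ()) (Sum.inl i)]
  · simp [reduced]; positivity
  · simp [reduced]; nlinarith

/-- The conjugate of a matrix `P'` close to `P` by a matrix `J` close to `shearMat P` is close to
`reduced P`. -/
theorem exists_conj_sub_reduced_le (d : ℕ) {R R' M : ℝ} (hM : 0 ≤ M) (hR : 1 + M ≤ R)
    (hR' : 0 ≤ R') : ∃ K : ℝ, 0 ≤ K ∧ ∀ (J P P' : Mat d) (q : ℝ), J.det ≠ 0 →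
      (∀ i j, |J i j| ≤ R) → (∀ i j, |J⁻¹ i j| ≤ R') → (∀ i j, |P i j| ≤ M) →
      0 ≤ P (Sum.inr ()) (Sum.inr ()) → (∀ i j, |(P' - P) i j| ≤ q) →
      (∀ i j, |(J - shearMat P) i j| ≤ q) → ∀ i j,
        |(|J.det| • (J⁻¹ * P' * (J⁻¹).transpose) - reduced P) i j| ≤ K * q := by
  obtain ⟨L, hL, hdet⟩ := exists_det_lipschitz d R
  have hR0 : 0 ≤ R := by linarith
  set n : ℝ := (Fintype.card (Idx d) : ℝ)
  set S := 1 + 2 * M + 2 * M ^ 2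
  have hS : 0 ≤ S := by positivity
  set E := detBound d R + L * M + (n * (n * (S * R)) + n * (n * (R * S)))
  have hE : 0 ≤ E := by positivity
  refine ⟨n * (n * (R' * E) * R'), by positivity,
    fun J P P' q hJ hJR hJR' hP hP0 hPP' hJS => ?_⟩
  have hq0 : 0 ≤ q := (abs_nonneg _).trans (hPP' (Sum.inr ()) (Sum.inr ()))
  have hSR : ∀ i j, |shearMat P i j| ≤ R := fun i j => (abs_shearMat_le hP i j).trans hR
  have hQ := abs_reduced_le hP
  have hdet' : |(|J.det| - P (Sum.inr ()) (Sum.inr ()))| ≤ L * q := by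
    have h1 := hdet J (shearMat P) hJR hSR q hJS
    rw [det_shearMat] at h1
    have h2 := abs_abs_sub_abs_le J.det (P (Sum.inr ()) (Sum.inr ()))
    rw [abs_of_nonneg hP0] at h2
    exact h2.trans h1
  -- This telescopes |det J| P′ - J (`reduced P`) Jᵀ through the exact identity for `shearMat P`;
  -- every summand contains one small factor.
  set F : Mat d := |J.det| • (P' - P) + (|J.det| - P (Sum.inr ()) (Sum.inr ())) • P
    - ((J - shearMat P) * (reduced P * J.transpose)
      + shearMat P * (reduced P * (J - shearMat P).transpose))
  have hF : F = |J.det| • P' - J * reduced P * J.transpose := by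
    have := shearMat_mul_reduced P
    rw [Matrix.mul_assoc] at this
    simp only [F, Matrix.sub_mul, Matrix.mul_sub, Matrix.transpose_sub, this, sub_smul, smul_sub,
      Matrix.mul_assoc]
    abel
  have hFb : ∀ i j, |F i j| ≤ E * q := fun i j => by
    have h1 : |(|J.det| * (P' - P) i j)| ≤ detBound d R * q := by
      rw [abs_mul, abs_abs]
      exact mul_le_mul (abs_det_le hJR) (hPP' i j) (abs_nonneg _) (by positivity)
    have h2 : |(|J.det| - P (Sum.inr ()) (Sum.inr ())) * P i j| ≤ L * q * M := by
      rw [abs_mul]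
      exact mul_le_mul hdet' (hP i j) (abs_nonneg _) (by positivity)
    have h3 := abs_mul_apply_le hq0 hJS
      (abs_mul_apply_le (N := J.transpose) hS hQ fun i j => hJR j i) i j
    have h4 := abs_mul_apply_le hR0 hSR
      (abs_mul_apply_le (N := (J - shearMat P).transpose) hS hQ fun i j => hJS j i) i j
    have e : F i j = |J.det| * (P' - P) i j
        + (|J.det| - P (Sum.inr ()) (Sum.inr ())) * P i j
        - (((J - shearMat P) * (reduced P * J.transpose)) i j
          + (shearMat P * (reduced P * (J - shearMat P).transpose)) i j) := rfl
    rw [e]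
    refine (abs_sub _ _).trans ((add_le_add (abs_add_le _ _) (abs_add_le _ _)).trans ?_)
    refine (add_le_add (add_le_add h1 h2) (add_le_add h3 h4)).trans (le_of_eq ?_)
    simp only [E, n]
    ring
  have hconj : |J.det| • (J⁻¹ * P' * (J⁻¹).transpose) - reduced P =
      J⁻¹ * F * (J⁻¹).transpose := by
    have h1 : J⁻¹ * J = 1 := Matrix.nonsing_inv_mul _ hJ.isUnit
    have h2 : J.transpose * (J⁻¹).transpose = 1 := by
      rw [← Matrix.transpose_mul, h1, Matrix.transpose_one]
    have h3 : J⁻¹ * (J * reduced P * J.transpose) * (J⁻¹).transpose = reduced P := by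
      calc _ = (J⁻¹ * J) * reduced P * (J.transpose * (J⁻¹).transpose) := by
            simp only [Matrix.mul_assoc]
        _ = _ := by rw [h1, h2, Matrix.one_mul, Matrix.mul_one]
    rw [hF, Matrix.mul_sub, Matrix.sub_mul, h3, Matrix.mul_smul, Matrix.smul_mul]
  intro i j
  rw [hconj]
  refine (abs_mul_apply_le (by positivity) (abs_mul_apply_le hR' hJR' hFb)
    (N := (J⁻¹).transpose) (fun i j => hJR' j i) i j).trans (le_of_eq ?_)
  simp only [n]
  ring

/-! ### Assembly of the construction -/

/-- The smoothed coefficient matrix. -/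
def avg {d : ℕ} (κ : Pt d → ℝ) (a : Idx d → Idx d → Pt d → ℝ) (X : Pt d) : Mat d :=
  fun i j => smoothing κ (a i j) X

/-- The change of variable attached to the smoothed last row of the coefficients. -/
def change {d : ℕ} (κ : Pt d → ℝ) (a : Idx d → Idx d → Pt d → ℝ) : Pt d → Pt d :=
  shear (rowVec κ a) (smoothing κ (a (Sum.inr ()) (Sum.inr ())))

/-- The coefficients, the mollifier and the change of variable of the construction. -/
structure IsData {d : ℕ} (A : Pt d → Mat d) (a : Idx d → Idx d → Pt d → ℝ) (M : ℝ)
    (κ : Pt d → ℝ) (ε : ℝ) (σ : Pt d → Pt d) : Prop where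
  entries : IsEntries A a M
  contDiff : ContDiff ℝ ∞ κ
  hasCompactSupport : HasCompactSupport κ
  tsupport_subset : tsupport κ ⊆ halfSpace d
  nonneg : ∀ g, 0 ≤ κ g
  integral_eq_one : ∫ g, κ g = 1
  isSlow : IsSlow (rowVec κ a) (smoothing κ (a (Sum.inr ()) (Sum.inr ()))) M⁻¹ ((d + 1) * M) ε
  isDiffeo : IsDiffeo (change κ a) σ

theorem IsWeakDKP.exists_isData {d : ℕ} {A : Pt d → Mat d} (hA : IsWeakDKP A) :
    ∃ a M κ ε σ, IsData A a M κ ε σ := by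
  obtain ⟨a, M, ha⟩ := hA.exists_isEntries
  have hM := ha.pos
  -- The smallness condition reads T times the kernel parameter at most 1/2, which fixes that
  -- parameter as 1/(2T).
  set T : ℝ := (d + 1) * M * (1 + ((d + 1) * M + 1) / M⁻¹)
  have hT : 0 < T := by positivity
  have hε : 0 < 1 / (2 * T) := by positivity
  obtain ⟨κ, h1, h2, h3, h4, h5, h6⟩ := exists_kernel d hε
  have hs := isSlow_rowVec h1 h2 h4 h5 hε.le h6 ha (le_of_eq (by
    calc _ = T * (1 / (2 * T)) := by simp only [T]; ring
      _ = 1 / 2 := by field_simp))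
  obtain ⟨σ, hσ⟩ := hs.exists_isDiffeo
  exact ⟨a, M, κ, _, σ, ha, h1, h2, h3, h4, h5, hs, hσ⟩

/-- The scale-invariant errors of the construction: the increments of the coefficients and the
gradients of the smoothed coefficients. -/
def err {d : ℕ} (κ : Pt d → ℝ) (a : Idx d → Idx d → Pt d → ℝ) :
    (Idx d × Idx d) × Option (Idx d) → Pt d → ℝ
  | (p, none), X => a p.1 p.2 (change κ a X) - smoothing κ (a p.1 p.2) X
  | (p, some m), X => X.2 * grad (smoothing κ (a p.1 p.2)) X m

/-- The sum of all errors. -/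
def totalErr {d : ℕ} (κ : Pt d → ℝ) (a : Idx d → Idx d → Pt d → ℝ) (X : Pt d) : ℝ :=
  ∑ k, |err κ a k X|

theorem abs_err_le {d : ℕ} (κ : Pt d → ℝ) (a : Idx d → Idx d → Pt d → ℝ)
    (k : (Idx d × Idx d) × Option (Idx d)) (X : Pt d) : |err κ a k X| ≤ totalErr κ a X :=
  Finset.single_le_sum (f := fun k => |err κ a k X|) (fun _ _ => abs_nonneg _) (Finset.mem_univ k)

namespace IsData

variable {d : ℕ} {A : Pt d → Mat d} {a : Idx d → Idx d → Pt d → ℝ} {M : ℝ} {κ : Pt d → ℝ} {ε : ℝ}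
  {σ : Pt d → Pt d}

theorem measurable_smoothing (h : IsData A a M κ ε σ) (i j : Idx d) :
    Measurable (smoothing κ (a i j)) :=
  WeakDKP.measurable_smoothing (h.entries.measurable i j) h.contDiff.continuous.measurable

theorem measurable_change (h : IsData A a M κ ε σ) : Measurable (change κ a) := by
  have h1 : Measurable (rowVec κ a) :=
    (PiLp.continuous_toLp 2 _).measurable.comp
      (measurable_pi_lambda _ fun i => h.measurable_smoothing _ _)
  exact measurable_act.comp (measurable_id.prodMk (h1.prodMk (h.measurable_smoothing _ _)))

theorem contDiffOn_smoothing (h : IsData A a M κ ε σ) (i j : Idx d) :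
    ContDiffOn ℝ ∞ (smoothing κ (a i j)) (halfSpace d) :=
  WeakDKP.contDiffOn_smoothing h.contDiff h.hasCompactSupport (h.entries.measurable i j)
    (h.entries.abs_le i j)

theorem hasFDerivAt_smoothing (h : IsData A a M κ ε σ) (i j : Idx d) {X : Pt d}
    (hX : X ∈ halfSpace d) :
    HasFDerivAt (smoothing κ (a i j)) (fderiv ℝ (smoothing κ (a i j)) X) X :=
  (((h.contDiffOn_smoothing i j).contDiffAt
    ((isOpen_halfSpace d).mem_nhds hX)).differentiableAt (by simp)).hasFDerivAt

theorem integrable_kernel (h : IsData A a M κ ε σ) : Integrable κ :=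
  h.contDiff.continuous.integrable_of_hasCompactSupport h.hasCompactSupport

theorem abs_avg_le (h : IsData A a M κ ε σ) (X : Pt d) (i j : Idx d) : |avg κ a X i j| ≤ M := by
  refine (abs_smoothing_le (h.entries.abs_le i j) h.integrable_kernel X).trans (le_of_eq ?_)
  simp only [abs_of_nonneg (h.nonneg _), h.integral_eq_one, mul_one]

theorem contDiffOn_tangBlock (h : IsData A a M κ ε σ) (i j : Fin d) :
    ContDiffOn ℝ 1 (fun X => tangBlock (avg κ a X) i j) (halfSpace d) :=
  (((h.contDiffOn_smoothing _ _).mul (h.contDiffOn_smoothing _ _)).sub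
    ((h.contDiffOn_smoothing _ _).mul (h.contDiffOn_smoothing _ _))).of_le (by simp)

theorem contDiffOn_normalCol (h : IsData A a M κ ε σ) (i : Fin d) :
    ContDiffOn ℝ 1 (fun X => normalCol (avg κ a X) i) (halfSpace d) :=
  ((h.contDiffOn_smoothing _ _).sub (h.contDiffOn_smoothing _ _)).of_le (by simp)

theorem abs_grad_tangBlock_le (h : IsData A a M κ ε σ) {X : Pt d} (hX : X ∈ halfSpace d)
    (i j : Fin d) (m : Idx d) :
    |X.2 * grad (fun Y => tangBlock (avg κ a Y) i j) X m| ≤ 4 * M * totalErr κ a X := by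
  have hM := h.entries.pos
  have h1 := ((h.hasFDerivAt_smoothing (Sum.inr ()) (Sum.inr ()) hX).mul
    (h.hasFDerivAt_smoothing (Sum.inl i) (Sum.inl j) hX)).sub
    ((h.hasFDerivAt_smoothing (Sum.inl i) (Sum.inr ()) hX).mul
    (h.hasFDerivAt_smoothing (Sum.inr ()) (Sum.inl j) hX))
  have h2 : fderiv ℝ (fun Y => tangBlock (avg κ a Y) i j) X = _ := h1.fderiv
  have h3 : ∀ i j k l, |avg κ a X i j * err κ a ((k, l), some m) X| ≤ M * totalErr κ a X :=
    fun i j k l => by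
      rw [abs_mul]
      exact mul_le_mul (h.abs_avg_le X i j) (abs_err_le κ a _ X) (abs_nonneg _) hM.le
  have h4 : X.2 * grad (fun Y => tangBlock (avg κ a Y) i j) X m =
      (avg κ a X (Sum.inr ()) (Sum.inr ()) * err κ a ((Sum.inl i, Sum.inl j), some m) X
        + avg κ a X (Sum.inl i) (Sum.inl j) * err κ a ((Sum.inr (), Sum.inr ()), some m) X)
      - (avg κ a X (Sum.inl i) (Sum.inr ()) * err κ a ((Sum.inr (), Sum.inl j), some m) X
        + avg κ a X (Sum.inr ()) (Sum.inl j) * err κ a ((Sum.inl i, Sum.inr ()), some m) X) := by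
    simp only [grad, h2, err, avg, sub_apply, add_apply,
      smul_apply, smul_eq_mul]
    ring
  rw [h4]
  refine (abs_sub _ _).trans ((add_le_add (abs_add_le _ _) (abs_add_le _ _)).trans ?_)
  refine (add_le_add (add_le_add (h3 _ _ _ _) (h3 _ _ _ _))
    (add_le_add (h3 _ _ _ _) (h3 _ _ _ _))).trans (le_of_eq ?_)
  ring

theorem abs_grad_normalCol_le (h : IsData A a M κ ε σ) {X : Pt d} (hX : X ∈ halfSpace d)
    (i : Fin d) (m : Idx d) :
    |X.2 * grad (fun Y => normalCol (avg κ a Y) i) X m| ≤ 2 * totalErr κ a X := by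
  have h1 := (h.hasFDerivAt_smoothing (Sum.inl i) (Sum.inr ()) hX).sub
    (h.hasFDerivAt_smoothing (Sum.inr ()) (Sum.inl i) hX)
  have h2 : fderiv ℝ (fun Y => normalCol (avg κ a Y) i) X = _ := h1.fderiv
  have h4 : X.2 * grad (fun Y => normalCol (avg κ a Y) i) X m =
      err κ a ((Sum.inl i, Sum.inr ()), some m) X
        - err κ a ((Sum.inr (), Sum.inl i), some m) X := by
    simp only [grad, h2, err, sub_apply]
    ring
  rw [h4, two_mul]
  exact (abs_sub _ _).trans (add_le_add (abs_err_le _ _ _ _) (abs_err_le _ _ _ _))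

theorem mul_gradNorm_le (h : IsData A a M κ ε σ) {X : Pt d} (hX : X ∈ halfSpace d) :
    X.2 * matGradNorm (fun Y => tangBlock (avg κ a Y)) X ≤
        d * (d * ((d + 1) * (4 * M))) * totalErr κ a X ∧
      X.2 * vecGradNorm (fun Y => normalCol (avg κ a Y)) X ≤
        d * ((d + 1) * 2) * totalErr κ a X := by
  have hX2 : 0 < X.2 := hX
  have key : ∀ (f : Pt d → ℝ) (R : ℝ), (∀ m, |X.2 * grad f X m| ≤ R) →
      |euclNorm (grad f X)| ≤ (d + 1) * (R / X.2) := fun f R hf => by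
    rw [abs_of_nonneg (show 0 ≤ euclNorm (grad f X) from Real.sqrt_nonneg _)]
    refine (euclNorm_le (R := R / X.2) fun m => ?_).trans (le_of_eq (by simp))
    rw [le_div_iff₀ hX2, mul_comm, ← abs_of_pos hX2, ← abs_mul]
    exact hf m
  constructor
  · have h1 := matNorm_le (M := Matrix.of fun i j : Fin d =>
      euclNorm (grad (fun Y => tangBlock (avg κ a Y) i j) X)) fun i j =>
        key _ _ (h.abs_grad_tangBlock_le hX i j)
    refine (mul_le_mul_of_nonneg_left h1 hX2.le).trans (le_of_eq ?_)
    simp only [Fintype.card_fin]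
    field_simp
  · have h1 := euclNorm_le (z := fun i : Fin d =>
      euclNorm (grad (fun Y => normalCol (avg κ a Y) i) X)) fun i =>
        key _ _ (h.abs_grad_normalCol_le hX i)
    refine (mul_le_mul_of_nonneg_left h1 hX2.le).trans (le_of_eq ?_)
    simp only [Fintype.card_fin]
    field_simp

/-- Product rule for t v and t h: when t is differentiated the matrix S appears, and what remains is
t∂v and t∂h. -/
theorem jacobian_sub_shearMat (h : IsData A a M κ ε σ) {X : Pt d} (hX : X ∈ halfSpace d)
    (i j : Idx d) :
    (jacobian (change κ a) X - shearMat (avg κ a X)) i j =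
      err κ a ((Sum.inr (), i), some j) X := by
  have hv := fun ξ i => fderiv_rowVec_apply h.contDiff h.hasCompactSupport h.entries hX ξ i
  rw [Matrix.sub_apply, jacobian_apply, change, h.isSlow.fderiv_shear hX]
  rcases i with i | u <;> rcases j with j | w
  · rw [stdBasis_repr_inl, stdBasis_inl]
    simp [shearMat, err, grad, stdBasis_inl, hv, Matrix.one_apply]
  · rw [stdBasis_repr_inl, stdBasis_inr]
    simp [shearMat, err, grad, stdBasis_inr, hv, avg, rowVec]
  · rw [stdBasis_repr_inr, stdBasis_inl]
    simp [shearMat, err, grad, stdBasis_inl]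
  · rw [stdBasis_repr_inr, stdBasis_inr]
    simp [shearMat, err, grad, stdBasis_inr, avg]

theorem one_le_det (h : IsData A a M κ ε σ) {X : Pt d} (hX : X ∈ halfSpace d) :
    1 ≤ detBound d (IsSlow.lowConst M⁻¹ ((d + 1) * M)) * |(jacobian (change κ a) X).det| :=
  h.isSlow.one_le_det h.isDiffeo hX

theorem uniformlyElliptic (h : IsData A a M κ ε σ) (hA : UniformlyElliptic A) :
    UniformlyElliptic (conjugate A (change κ a)) :=
  h.isDiffeo.uniformlyElliptic_conjugate h.measurable_change hA
    (fun _ hX => h.isSlow.abs_jacobian_le hX)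
    (fun _ hX => h.isSlow.abs_jacobian_inv_le h.isDiffeo hX)
    fun _ hX => h.one_le_det hX

theorem exists_matNorm_le (h : IsData A a M κ ε σ) : ∃ K : ℝ, 0 ≤ K ∧ ∀ X ∈ halfSpace d,
    (∀ i j, a i j (change κ a X) = A (change κ a X) i j) →
      matNorm (conjugate A (change κ a) X - reduced (avg κ a X)) ≤ K * totalErr κ a X := by
  have hM := h.entries.pos
  have hε := h.isSlow.ε_nonneg
  obtain ⟨K, hK, hK'⟩ := exists_conj_sub_reduced_le d (M := M) (R := 1 + (d + 1) * M + ε) hM.le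
    (by nlinarith [mul_nonneg (Nat.cast_nonneg d : (0 : ℝ) ≤ d) hM.le]) h.isSlow.lowConst_pos.le
  refine ⟨(d + 1) * ((d + 1) * K), by positivity, fun X hX haA => ?_⟩
  refine (matNorm_le (hK' _ (avg κ a X) (A (change κ a X)) (totalErr κ a X)
    (h.isDiffeo.det_ne_zero hX) (h.isSlow.abs_jacobian_le hX)
    (h.isSlow.abs_jacobian_inv_le h.isDiffeo hX) (h.abs_avg_le X)
    (h.isSlow.c_pos.le.trans (h.isSlow.le_h X hX)) (fun i j => ?_) fun i j => ?_)).trans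
    (le_of_eq ?_)
  · rw [Matrix.sub_apply, ← haA]
    exact abs_err_le κ a ((i, j), none) X
  · rw [h.jacobian_sub_shearMat hX]
    exact abs_err_le _ _ _ _
  · simp
    ring

/-- Both kinds of error have the form smoothing of a by η minus a(ρ X) ∫ η, for η = κ or η a
`kerDeriv`. Measurable majorants are provided so that they can be summed. -/
theorem exists_err_bound (h : IsData A a M κ ε σ) (k : (Idx d × Idx d) × Option (Idx d)) :
    ∃ G : Pt d → ℝ≥0∞, Measurable G ∧ CarlesonFinite G ∧
      ∀ X ∈ halfSpace d, ENNReal.ofReal (err κ a k X ^ 2) ≤ G X := by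
  obtain ⟨⟨i, j⟩, m⟩ := k
  have ham := h.entries.measurable i j
  have haM := h.entries.abs_le i j
  have hK : IsCompact (tsupport κ) := h.hasCompactSupport
  have key : ∀ η : Pt d → ℝ, Continuous η → (∀ g ∉ tsupport κ, η g = 0) →
      ∃ G : Pt d → ℝ≥0∞, Measurable G ∧ CarlesonFinite G ∧ ∀ X, ENNReal.ofReal
        ((smoothing η (a i j) X - a i j (change κ a X) * ∫ g, η g) ^ 2) ≤ G X :=
    fun η hη hη0 => by
      obtain ⟨L, hL, hLη⟩ := smoothing_sub_sq_le hη hK hη0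
      exact ⟨_, (measurable_errOsc h.measurable_change ham (tsupport κ)).const_mul L,
        (h.isSlow.carlesonFinite_errOsc h.isDiffeo ham (h.entries.carlesonFinite i j) hK
          h.tsupport_subset).const_mul hL, hLη (a i j) M ham haM _⟩
  rcases m with _ | m
  · obtain ⟨G, h1, h2, h3⟩ := key κ h.contDiff.continuous fun g hg =>
      image_eq_zero_of_notMem_tsupport hg
    refine ⟨G, h1, h2, fun X _ => le_trans (le_of_eq ?_) (h3 X)⟩
    rw [h.integral_eq_one, mul_one, sub_sq_comm]
    rfl
  · obtain ⟨G, h1, h2, h3⟩ := key _ (continuous_kerDeriv h.contDiff (stdBasis d m)) fun g hg =>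
      kerDeriv_eq_zero _ hg
    refine ⟨G, h1, h2, fun X hX => le_trans (le_of_eq ?_) (h3 X)⟩
    rw [integral_kerDeriv h.contDiff h.hasCompactSupport, mul_zero, sub_zero,
      ← fderiv_smoothing h.contDiff h.hasCompactSupport ham haM hX]
    rfl

/-- Functions dominated by the errors are in `CM`. -/
theorem inCM_of_le (h : IsData A a M κ ε σ) {f : Pt d → ℝ} {K : ℝ}
    (hf0 : ∀ X ∈ halfSpace d, 0 ≤ f X)
    (hf : ∀ᵐ X ∂(nu d), f X ≤ K * totalErr κ a X) : InCM f := by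
  choose G hGm hG hGe using h.exists_err_bound
  set N : ℝ := (Fintype.card ((Idx d × Idx d) × Option (Idx d)) : ℝ)
  refine ((CarlesonFinite.finset_sum Finset.univ (fun k => (hGm k).aemeasurable) hG).const_mul
    (c := ENNReal.ofReal (K ^ 2 * N)) ENNReal.ofReal_ne_top).mono_ae ?_ |>.inCM
  filter_upwards [hf, ae_mem_halfSpace d] with X hX hXH
  have h1 : totalErr κ a X ^ 2 ≤ N * ∑ k, err κ a k X ^ 2 := by
    have := sq_sum_le_card_mul_sum_sq (s := Finset.univ) (f := fun k => |err κ a k X|)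
    simp only [sq_abs] at this
    exact this
  calc ENNReal.ofReal (f X ^ 2) ≤ ENNReal.ofReal (K ^ 2 * N * ∑ k, err κ a k X ^ 2) := by
        refine ENNReal.ofReal_le_ofReal ?_
        calc f X ^ 2 ≤ (K * totalErr κ a X) ^ 2 := pow_le_pow_left₀ (hf0 X hXH) hX 2
          _ = K ^ 2 * totalErr κ a X ^ 2 := by ring
          _ ≤ K ^ 2 * (N * ∑ k, err κ a k X ^ 2) := by gcongr
          _ = _ := by ring
    _ = ENNReal.ofReal (K ^ 2 * N) * ∑ k, ENNReal.ofReal (err κ a k X ^ 2) := by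
        rw [ENNReal.ofReal_mul (by positivity), ENNReal.ofReal_sum_of_nonneg fun _ _ => sq_nonneg _]
    _ ≤ _ := by
        gcongr with k
        exact hGe k X hXH

/-- The entries were modified on a null set; the lower bound on |det J| ensures that its preimage
under ρ is null as well. -/
theorem ae_entries_change (h : IsData A a M κ ε σ) :
    ∀ᵐ X ∂(nu d), ∀ i j, a i j (change κ a X) = A (change κ a X) i j := by
  refine (withDensity_absolutelyContinuous _ _).ae_le ?_
  have h1 : ∀ᵐ Y ∂(volume.restrict (halfSpace d)), ∀ i j, a i j Y = A Y i j :=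
    ae_all_iff.2 fun i => ae_all_iff.2 fun j => h.entries.ae_eq i j
  exact ae_of_ae_map h.measurable_change.aemeasurable
    ((h.isDiffeo.map_restrict_absolutelyContinuous fun _ hX => h.one_le_det hX).ae_le h1)

theorem inCM (h : IsData A a M κ ε σ) :
    InCM fun X => X.2 * matGradNorm (fun Y => tangBlock (avg κ a Y)) X
      + X.2 * vecGradNorm (fun Y => normalCol (avg κ a Y)) X
      + matNorm (conjugate A (change κ a) X - reduced (avg κ a X)) := by
  obtain ⟨K, -, hK⟩ := h.exists_matNorm_le
  refine h.inCM_of_le (K := d * (d * ((d + 1) * (4 * M))) + d * ((d + 1) * 2) + K)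
    (fun X hX => ?_) ?_
  · have hX2 : 0 < X.2 := hX
    exact add_nonneg (add_nonneg (mul_nonneg hX2.le (Real.sqrt_nonneg _))
      (mul_nonneg hX2.le (Real.sqrt_nonneg _))) (Real.sqrt_nonneg _)
  · filter_upwards [h.ae_entries_change, ae_mem_halfSpace d] with X hX hXH
    rw [add_mul, add_mul]
    exact add_le_add (add_le_add (h.mul_gradNorm_le hXH).1 (h.mul_gradNorm_le hXH).2) (hK X hXH hX)

end IsData

theorem change_boundary {d : ℕ} (κ : Pt d → ℝ) (a : Idx d → Idx d → Pt d → ℝ)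
    (x : EuclideanSpace ℝ (Fin d)) : change κ a (x, 0) = (x, 0) := by
  simp [change, shear, act]

end WeakDKP

end

theorem mainTheorem6 {d : ℕ} (hd : 1 ≤ d) (A : WeakDKP.Pt d → WeakDKP.Mat d)
    (hA : WeakDKP.IsWeakDKP A) :
    ∃ ρ : WeakDKP.Pt d → WeakDKP.Pt d,
      WeakDKP.IsBiLipschitzChange ρ ∧
      (∀ x : EuclideanSpace ℝ (Fin d), ρ (x, 0) = (x, 0)) ∧
      WeakDKP.UniformlyElliptic (WeakDKP.conjugate A ρ) ∧
      (∀ u : WeakDKP.Pt d → ℝ, WeakDKP.IsWeakSolution A u →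
        WeakDKP.IsWeakSolution (WeakDKP.conjugate A ρ) (fun X => u (ρ X))) ∧
      ∃ (B : WeakDKP.Pt d → Matrix (Fin d) (Fin d) ℝ) (b : WeakDKP.Pt d → Fin d → ℝ)
        (C : WeakDKP.Pt d → WeakDKP.Mat d),
        (∀ i j, ContDiffOn ℝ 1 (fun X => B X i j) (WeakDKP.halfSpace d)) ∧
        (∀ i, ContDiffOn ℝ 1 (fun X => b X i) (WeakDKP.halfSpace d)) ∧
        (∀ X ∈ WeakDKP.halfSpace d,
          WeakDKP.conjugate A ρ X =
            Matrix.fromBlocks (B X) (Matrix.replicateCol Unit (b X)) 0 1 + C X) ∧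
        WeakDKP.InCM (fun X => X.2 * WeakDKP.matGradNorm B X + X.2 * WeakDKP.vecGradNorm b X
          + WeakDKP.matNorm (C X)) := by
  obtain ⟨a, M, κ, ε, σ, h⟩ := hA.exists_isData
  refine ⟨WeakDKP.change κ a, h.isSlow.isBiLipschitzChange, WeakDKP.change_boundary κ a,
    h.uniformlyElliptic hA.1, fun u hu => h.isDiffeo.isWeakSolution_comp hu,
    fun X => WeakDKP.tangBlock (WeakDKP.avg κ a X), fun X => WeakDKP.normalCol (WeakDKP.avg κ a X),
    -- C_ρ is the remainder by definition, so the decomposition is immediate and the content lies in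
    -- the Carleson bound.
    fun X => WeakDKP.conjugate A (WeakDKP.change κ a) X - WeakDKP.reduced (WeakDKP.avg κ a X),
    h.contDiffOn_tangBlock, h.contDiffOn_normalCol, fun X _ => ?_, h.inCM⟩
  exact (add_sub_cancel _ _).symm
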